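/- \textbf{Notation.} Let $d\ge 2$. For $m\ge 1$ let $\mathcal F_m$ be the set of real-analytic, locally diffeomorphic covering maps $h:\mathbb S^1\to\mathbb S^1$ of degree $m$, i.e. maps with $h(e^{2\pi i x})=e^{2\pi i H(x)}$ for a real-analytic diffeomorphism $H:\mathbb R\to\mathbb R$ with $H'>0$ and $H(x+1)=H(x)+m$; write $Dh(e^{2\pi i x})=H'(x)$. Let $\operatorname{Par}(h)$ be the set of parabolic periodic points: those $p$ with $h^s(p)=p$ and $Dh^s(p)=1$ for some $s\ge1$. Let $\mathcal M_d$ be the set of $h\in\mathcal F_d$ that are metrically expanding: $Dh(x)>1$ for all $x\in\mathbb S^1\setminus\operatorname{Par}(h)$. Let $\mathbb D$ be the open unit disc; $A\subset\subset B$ means that $\overline A$ is compact and contained in $B$. A map $h\in\mathcal F_d$ with $\operatorname{Par}(h)$ finite is a \emph{parabolic external map}, written $(h,W',W,\gamma)$, if: \begin{itemize} \item $h$ extends to a holomorphic covering map $h:W'\to W$ of degree $d$, where $W',W\subset\mathbb C\setminus\{0\}$ are open annular neighborhoods of $\mathbb S^1$ symmetric under $z\mapsto 1/\overline z$; \item for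 each $p\in\operatorname{Par}(h)$ there is a dividing arc $\gamma_p\subset\overline W\setminus\mathbb D$, a simple arc with interior in $W$ and end points on $\partial W$, containing $p$ as an interior point and smooth except at $p$, such that $\gamma_p\cap\gamma_{p'}=\emptyset$ for $p\ne p'$ and $h:\gamma_p\cap W'\to\gamma_{h(p)}\cap W$ is a diffeomorphism (here $\gamma=\bigcup_p\gamma_p$); \item $W\setminus\gamma_p$ is the disjoint union of two connected open sets $\Omega_p,\Delta_p$, and $W'\setminus\gamma_p$ is the disjoint union of two connected open sets $\Omega'_p,\Delta'_p$, such that $h:\Delta'_p\to\Delta_{h(p)}$ is an isomorphism and $(\mathbb D\cup\Omega'_p)\cap(\mathbb D\cup W)\subset\mathbb D\cup\Omega_p$; \item with $\Omega'=\bigcap_p\Omega'_p\subset W'$ (so $\Omega'=W'$ if $\operatorname{Par}(h)=\emptyset$), one has $\Omega'\cup\mathbb D\subset\subset W\cup\mathbb D$. \end{itemize} Let $\mathcal P_d\subset\mathcal F_d$ be the set of parabolic external maps. \textbf{Proposition.} For every $d\ge2$ and every $h\in\mathcal M_d$ there exists $\epsilon_0>0$ such that for every $0<\epsilon\le\epsilon_0$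 the map $h$ has a holomorphic extension $(h,W',W,\gamma)$ as a parabolic external map with range $W\subseteq\{z:|\log|z||<\epsilon\}$. In particular $\mathcal M_d\subset\mathcal P_d$, and for every $h\in\mathcal M_d$ and every $\phi\in\mathcal F_1$ the conjugate map $\phi\circ h\circ\phi^{-1}$ also belongs to $\mathcal P_d$. -/

import Mathlib

open Set Metric
open scoped Topology ContDiff

namespace ParabolicExternal

noncomputable section

/-- The covering `x ↦ exp (2 π i x)` of the unit circle by the real line. -/
def E (x : ℝ) : Circle := Circle.exp (2 * Real.pi * x)

/-- `H` is a lift to the real line, under `E`, of the circle map `h`: a real analytic diffeomorphism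
with `H (x + 1) = H x + d`.  (A positive derivative together with the last equation, for `d > 0`,
makes `H` an increasing diffeomorphism of the real line.) -/
structure IsLift (d : ℕ) (h : Circle → Circle) (H : ℝ → ℝ) : Prop where
  analytic : ∀ x, AnalyticAt ℝ H x
  deriv_pos : ∀ x, 0 < deriv H x
  translate : ∀ x, H (x + 1) = H x + d
  lifts : ∀ x, h (E x) = E (H x)

/-- `F d`: the real analytic, locally diffeomorphic coverings of the unit circle of degree `d`
(for `d > 0`). -/
def F (d : ℕ) : Set (Circle → Circle) := {h | ∃ H : ℝ → ℝ, IsLift d h H}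

/-- The derivative of a circle map with respect to the angle; for a map with a differentiable lift
`H` its value at `E x` is the derivative of `H` at `x`. -/
def D (h : Circle → Circle) (z : Circle) : ℝ :=
  deriv (fun t : ℝ => Complex.arg ((h (z * Circle.exp t) / h z : Circle) : ℂ)) 0

/-- The parabolic periodic points of a circle map of positive degree: the periodic points of
multiplier `1`. -/
def Par (h : Circle → Circle) : Set Circle :=
  {p | ∃ s : ℕ, 0 < s ∧ h^[s] p = p ∧ D (h^[s]) p = 1}

/-- `M d`: the metrically expanding real analytic coverings of degree `d`. -/
def M (d : ℕ) : Set (Circle → Circle) := {h | h ∈ F d ∧ ∀ z, z ∉ Par h → 1 < D h z}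

/-- Reflection in the unit circle, `z ↦ 1 / conj z` (for `z ≠ 0`). -/
def reflection (z : ℂ) : ℂ := 1 / (starRingEnd ℂ) z

/-- A reflection symmetric annular neighbourhood of the unit circle: an open set of nonzero complex
numbers, homeomorphic to a round annulus, containing the unit circle and invariant under the
reflection. -/
structure IsSymmetricAnnulus (W : Set ℂ) : Prop where
  isOpen : IsOpen W
  zero_notMem : (0 : ℂ) ∉ W
  annular : Nonempty (W ≃ₜ {z : ℂ | 1 < ‖z‖ ∧ ‖z‖ < 2})
  circle_subset : sphere (0 : ℂ) 1 ⊆ W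
  symmetric : ∀ z ∈ W, reflection z ∈ W

/-- `g : W' → W` is a holomorphic covering map of degree `d` (for `d > 0`). -/
def IsHolomorphicCovering (d : ℕ) (g : ℂ → ℂ) (W' W : Set ℂ) : Prop :=
  DifferentiableOn ℂ g W' ∧
    (∃ hg : MapsTo g W' W, IsCoveringMap hg.restrict) ∧
    ∀ w ∈ W, {z ∈ W' | g z = w}.ncard = d

/-- `f` is smooth on the (arbitrary) subset `A` of the plane: near each point of `A` it coincides
on `A` with a smooth map defined on a full neighbourhood. -/
def SmoothOnSet (f : ℂ → ℂ) (A : Set ℂ) : Prop :=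
  ∀ z ∈ A, ∃ U : Set ℂ, IsOpen U ∧ z ∈ U ∧ ∃ f₁ : ℂ → ℂ, ContDiffOn ℝ ∞ f₁ U ∧ EqOn f f₁ (A ∩ U)

/-- `f : A → B` is a diffeomorphism between subsets of the plane. -/
def IsDiffeo (f : ℂ → ℂ) (A B : Set ℂ) : Prop :=
  BijOn f A B ∧ SmoothOnSet f A ∧ ∃ k : ℂ → ℂ, SmoothOnSet k B ∧ InvOn k f A B

/-- `f : A → B` is an isomorphism (biholomorphic map) between open subsets of the plane. -/
def IsBiholomorphic (f : ℂ → ℂ) (A B : Set ℂ) : Prop :=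
  BijOn f A B ∧ DifferentiableOn ℂ f A ∧ ∃ k : ℂ → ℂ, DifferentiableOn ℂ k B ∧ InvOn k f A B

/-- The set traced by an arc parametrized by `[-1, 1]`. -/
def trace (c : ℝ → ℂ) : Set ℂ := c '' Icc (-1) 1

/-- `c : [-1, 1] → closure W \ 𝔻` is a simple arc in `W` with end points on the boundary of `W`,
through `c 0 = p`, and smooth (with nonvanishing velocity) except at `p`. -/
structure IsArcThrough (W : Set ℂ) (p : Circle) (c : ℝ → ℂ) : Prop where
  continuousOn : ContinuousOn c (Icc (-1) 1)
  injOn : InjOn c (Icc (-1) 1)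
  zero : c 0 = (p : ℂ)
  inside : ∀ t ∈ Ioo (-1 : ℝ) 1, c t ∈ W
  left_end : c (-1) ∈ frontier W
  right_end : c 1 ∈ frontier W
  outside_disc : ∀ t ∈ Icc (-1 : ℝ) 1, c t ∉ ball (0 : ℂ) 1
  smooth : ContDiffOn ℝ ∞ c (Icc (-1) 1 \ {0})
  regular : ∀ t ∈ Icc (-1 : ℝ) 1 \ {0}, derivWithin c (Icc (-1) 1) t ≠ 0

/-- The set `C` divides the open set `W` into the two connected open sets `Ω` and `Δ`, that is,
these are the two connected components of `W \ C`. -/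
structure Divides (C W Ω Δ : Set ℂ) : Prop where
  isOpen_left : IsOpen Ω
  isOpen_right : IsOpen Δ
  connected_left : IsConnected Ω
  connected_right : IsConnected Δ
  disjoint : Disjoint Ω Δ
  union : Ω ∪ Δ = W \ C

/-- `A ⊂⊂ B`: the closure of `A` is compact and contained in `B`. -/
def CompactlyContained (A B : Set ℂ) : Prop := IsCompact (closure A) ∧ closure A ⊆ B

/-- `(h, W', W, γ)` is a parabolic external map of degree `d`, where `g` is the holomorphic extension
of `h` to `W'`, and `γ p`, for `p ∈ Par h`, is (a parametrization of) the dividing arc at `p`. -/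
structure IsParabolicExternal (d : ℕ) (h : Circle → Circle) (g : ℂ → ℂ) (W' W : Set ℂ)
    (γ : Circle → ℝ → ℂ) : Prop where
  two_le : 2 ≤ d
  mem_F : h ∈ F d
  finite_par : (Par h).Finite
  annulus_domain : IsSymmetricAnnulus W'
  annulus_range : IsSymmetricAnnulus W
  extends_h : ∀ z : Circle, g z = h z
  covering : IsHolomorphicCovering d g W' W
  arc : ∀ p ∈ Par h, IsArcThrough W p (γ p)
  arcs_disjoint : ∀ p ∈ Par h, ∀ q ∈ Par h, p ≠ q → Disjoint (trace (γ p)) (trace (γ q))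
  arc_diffeo : ∀ p ∈ Par h, IsDiffeo g (trace (γ p) ∩ W') (trace (γ (h p)) ∩ W)
  dividing : ∃ Ω Δ Ω' Δ' : Circle → Set ℂ,
    (∀ p ∈ Par h,
      Divides (trace (γ p)) W (Ω p) (Δ p) ∧
      Divides (trace (γ p)) W' (Ω' p) (Δ' p) ∧
      IsBiholomorphic g (Δ' p) (Δ (h p)) ∧
      (ball (0 : ℂ) 1 ∪ Ω' p) ∩ (ball (0 : ℂ) 1 ∪ W) ⊆ ball (0 : ℂ) 1 ∪ Ω p) ∧
    -- `Ω' := ⋂ p, Ω' p`, an intersection of subsets of `W'`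
    CompactlyContained ((W' ∩ ⋂ p ∈ Par h, Ω' p) ∪ ball (0 : ℂ) 1) (W ∪ ball (0 : ℂ) 1)

/-- `P d`: the parabolic external maps of degree `d`. -/
def P (d : ℕ) : Set (Circle → Circle) :=
  {h | ∃ (g : ℂ → ℂ) (W' W : Set ℂ) (γ : Circle → ℝ → ℂ), IsParabolicExternal d h g W' W γ}

end

end ParabolicExternal

/-! Unroll a neighbourhood of the circle to a strip around the real line, oriented so that the upper
half plane lies over the outside of the disc. The map becomes a holomorphic `f` that commutes with
conjugation, satisfies `f (z + 1) = f z + d` and, near the real line, is injective with an inverse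
`G`. Let `W` be the image of the strip `|Im z| < ε`, and `W'` the image of `G` of the same strip.
Translation by `d` before `G` is translation by `1` after it, so `W' → W` is topologically `w ↦ w ^
d` (`Chart.isCoveringMap`, `Model.chart_comp`).

Metric expansion means that `f' ≥ 1` on the real line, with equality exactly over the parabolic
points, which are finite in number (`IsLift.expanding`). Where `f' > 1`, heights grow under `f`, and
`W'` is compactly inside `W`. Only near a parabolic point may `f` lower a point. There `f` is a germ
`z + c z ^ q + ...` that repels along both real directions, hence also raises heights in thin
sectors about the real axis. A dividing arc placed in these two sectors cuts off the region where
heights can drop.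

Half of an arc is built backwards in `exists_halfArc`. A short curve `β` joins `G b` to a point `b`
at height `ε`, with jets at its two ends that correspond under `G`; its successive pull backs fit
together to a smooth curve that tends to `0`. The points stay in the sector because slopes decrease
under `G` (`sector_backward`). The velocities stay in a cone field invariant under pull back
(`Cone.backward`), so the real part is monotone and the half arc is a graph. Every sign condition
needed on the germ reduces to one principle, `sector_im_nonneg`: a function that is real on the axis
and has a positive first coefficient has positive imaginary part above the axis in a thin sector.
Left halves come from right halves by reflection in the imaginary axis.

Since the arcs are permuted by `f` and `G`, the regions that they bound correspond as required
(`ArcModel.f_mem_upperRegion`). For the compact containment (`ArcModel.compactlyContained`), a point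
of the closure at height at least `ε` is either raised by `f`, which is impossible, or is mapped
strictly above an arc, and then lies in the part that was cut off.

For a conjugate by `φ` nothing changes in the strip. Only the coordinate is replaced, by `exp (2 π i
Φ (-z))` with `Φ` the complexified lift of `φ`, so the conjugate itself need not be metrically
expanding. -/

namespace ParabolicExternal

noncomputable section

open Filter Complex ComplexConjugate

/-! ### Parabolic germs on thin sectors -/

/-- The filter of thin sectors at `0` above the positive real axis. -/
def sectorFilter : Filter ℂ :=
  comap (fun z : ℂ => (z.re, z.im / z.re)) (𝓝[>] (0 : ℝ) ×ˢ 𝓝[≥] (0 : ℝ))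

/-- The truncated sector above the positive real axis of slope `κ` and width `r`. -/
def sector (κ r : ℝ) : Set ℂ := {z | 0 < z.re ∧ z.re < r ∧ 0 ≤ z.im ∧ z.im ≤ κ * z.re}

theorem sector_mono {κ κ' r r' : ℝ} (hκ : κ ≤ κ') (hr : r ≤ r') : sector κ r ⊆ sector κ' r' :=
  fun _ hz => ⟨hz.1, hz.2.1.trans_le hr, hz.2.2.1,
    hz.2.2.2.trans (mul_le_mul_of_nonneg_right hκ hz.1.le)⟩

theorem eventually_sectorFilter {p : ℂ → Prop} :
    (∀ᶠ z in sectorFilter, p z) ↔ ∃ κ > 0, ∃ r > 0, ∀ z ∈ sector κ r, p z := by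
  have hb := ((nhdsGT_basis (0 : ℝ)).prod (nhdsGE_basis (0 : ℝ))).comap
    (fun z : ℂ => (z.re, z.im / z.re))
  change (∀ᶠ z in comap _ _, p z) ↔ _
  rw [hb.eventually_iff]
  constructor
  · rintro ⟨⟨r, κ⟩, ⟨hr, hκ⟩, h⟩
    simp only at hr hκ
    refine ⟨κ / 2, by positivity, r, hr, fun z hz => h ⟨⟨hz.1, hz.2.1⟩, ?_, ?_⟩⟩
    · exact div_nonneg hz.2.2.1 hz.1.le
    · change z.im / z.re < κ
      rw [div_lt_iff₀ hz.1]
      have := hz.2.2.2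
      nlinarith [hz.1]
  · rintro ⟨κ, hκ, r, hr, h⟩
    refine ⟨(r, κ), ⟨hr, hκ⟩, fun z hz => h z ?_⟩
    obtain ⟨⟨h1, h2⟩, h3, h4⟩ := hz
    simp only at h1 h2 h3 h4
    refine ⟨h1, h2, ?_, ?_⟩
    · have := mul_nonneg h3 h1.le
      rwa [div_mul_cancel₀ _ h1.ne'] at this
    · rw [div_lt_iff₀ h1] at h4
      exact h4.le

theorem tendsto_sector_re : Tendsto (fun z : ℂ => z.re) sectorFilter (𝓝[>] 0) :=
  tendsto_fst.comp tendsto_comap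

theorem tendsto_sector_slope : Tendsto (fun z : ℂ => z.im / z.re) sectorFilter (𝓝 0) :=
  (tendsto_snd.comp tendsto_comap).mono_right nhdsWithin_le_nhds

theorem eventually_sector_re_pos : ∀ᶠ z in sectorFilter, 0 < z.re :=
  tendsto_sector_re.eventually self_mem_nhdsWithin

theorem eq_re_mul_slope {z : ℂ} (hz : 0 < z.re) :
    z = (z.re : ℂ) * (1 + ((z.im / z.re : ℝ) : ℂ) * I) := by
  apply Complex.ext
  · simp
  · simp; field_simp

theorem tendsto_sector_zero : Tendsto (fun z : ℂ => z) sectorFilter (𝓝 0) := by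
  have h1 : Tendsto (fun z : ℂ => (z.re : ℂ) * (1 + ((z.im / z.re : ℝ) : ℂ) * I)) sectorFilter
      (𝓝 (((0 : ℝ) : ℂ) * (1 + ((0 : ℝ) : ℂ) * I))) :=
    ((continuous_ofReal.tendsto 0).comp (tendsto_sector_re.mono_right nhdsWithin_le_nhds)).mul
      (tendsto_const_nhds.add (((continuous_ofReal.tendsto 0).comp tendsto_sector_slope).mul
        tendsto_const_nhds))
  simp only [ofReal_zero, zero_mul] at h1
  refine h1.congr' ?_
  filter_upwards [eventually_sector_re_pos] with z hz
  exact (eq_re_mul_slope hz).symm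

/-- Write `z = x (1 + i σ)` with `x` the real part and `σ` the slope. After division by `x ^ m` the
function tends to `c`, because `σ` tends to `0`; a real positive limit gives both inequalities. -/
theorem sector_leading {f : ℂ → ℂ} (hf : ContinuousAt f 0) {c : ℝ} (hc : 0 < c) (h0 : f 0 = c)
    (m : ℕ) : ∀ᶠ z in sectorFilter, c / 2 * z.re ^ m ≤ (z ^ m * f z).re ∧
      3 * |(z ^ m * f z).im| ≤ (z ^ m * f z).re := by
  have h1 : Tendsto (fun z : ℂ => (1 + ((z.im / z.re : ℝ) : ℂ) * I) ^ m * f z) sectorFilter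
      (𝓝 ((1 + ((0 : ℝ) : ℂ) * I) ^ m * f 0)) :=
    ((tendsto_const_nhds.add (((continuous_ofReal.tendsto 0).comp tendsto_sector_slope).mul
        tendsto_const_nhds)).pow m).mul (hf.tendsto.comp tendsto_sector_zero)
  simp only [ofReal_zero, zero_mul, add_zero, one_pow, one_mul, h0] at h1
  have hre := (continuous_re.tendsto _).comp h1
  have him := (continuous_im.tendsto _).comp h1
  simp only [ofReal_re, ofReal_im] at hre him
  have e1 := hre.eventually (lt_mem_nhds (show c / 2 < c by linarith))
  have e2 := him.eventually (Metric.ball_mem_nhds (0 : ℝ) (show 0 < c / 6 by positivity))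
  filter_upwards [eventually_sector_re_pos, e1, e2] with z hz h3 h4
  simp only [Function.comp, dist_zero_right, Real.norm_eq_abs] at h3 h4
  set w := (1 + ((z.im / z.re : ℝ) : ℂ) * I) ^ m * f z with hw
  have hzw : z ^ m * f z = ((z.re ^ m : ℝ) : ℂ) * w := by
    conv_lhs => rw [show z ^ m = ((z.re : ℂ) * (1 + ((z.im / z.re : ℝ) : ℂ) * I)) ^ m by
      rw [← eq_re_mul_slope hz]]
    rw [hw, mul_pow, ofReal_pow]; ring
  have hx : 0 < z.re ^ m := by positivity
  rw [hzw, re_ofReal_mul, im_ofReal_mul, abs_mul, abs_of_pos hx]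
  constructor
  · nlinarith
  · nlinarith

/-- Along a vertical segment the derivative of `Im Q` is `Re Q'`, which is positive by
`sector_leading` applied to `Q' = z ^ m (...)`. Since `Im Q` vanishes at the foot of the segment, it
is positive above. This one lemma yields all the conditions of `Good` on the sign of an imaginary
part. -/
theorem sector_im_nonneg {Q f : ℂ → ℂ} {q : ℂ} {m : ℕ} (hf : AnalyticAt ℂ f 0) {c : ℝ} (hc : 0 < c)
    (h0 : f 0 = c) (hQ : ∀ᶠ z in 𝓝 (0 : ℂ), Q z = q + z ^ (m + 1) * f z)
    (hreal : ∀ᶠ x : ℝ in 𝓝[>] 0, (Q x).im = 0) :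
    ∀ᶠ z in sectorFilter, 0 ≤ (Q z).im ∧ (0 < z.im → 0 < (Q z).im) := by
  have hd : ∀ᶠ z in 𝓝 (0 : ℂ), HasDerivAt Q (z ^ m * ((m + 1) * f z + z * deriv f z)) z := by
    filter_upwards [hQ.eventually_nhds, hf.eventually_analyticAt] with z h1 h2
    have h3 : HasDerivAt (fun z => q + z ^ (m + 1) * f z)
        (((m + 1 : ℕ) * z ^ m * f z + z ^ (m + 1) * deriv f z)) z := by
      have := ((hasDerivAt_pow (m + 1) z).mul h2.differentiableAt.hasDerivAt).const_add q
      simpa using this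
    refine (h3.congr_of_eventuallyEq h1).congr_deriv ?_
    push_cast; ring
  have hcont : ContinuousAt (fun z => ((m : ℂ) + 1) * f z + z * deriv f z) 0 :=
    (continuousAt_const.mul hf.continuousAt).add (continuousAt_id.mul hf.deriv.continuousAt)
  have hlead := sector_leading hcont (c := (m + 1) * c) (by positivity) (by simp [h0]) m
  have hreal' := tendsto_sector_re.eventually hreal
  have key := (hlead.and (tendsto_sector_zero.eventually hd)).and hreal'
  rw [eventually_sectorFilter] at key
  obtain ⟨κ, hκ, r, hr, key⟩ := key
  rw [eventually_sectorFilter]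
  refine ⟨κ, hκ, r, hr, fun z hz => ?_⟩
  -- The sector contains the whole vertical segment below each of its points, apart from the
  -- condition at the foot, which is real.
  have hseg : ∀ t ∈ Icc 0 z.im, (z.re + t * I : ℂ) ∈ sector κ r := fun t ht => by
    refine ⟨by simpa using hz.1, by simpa using hz.2.1, by simpa using ht.1, ?_⟩
    simpa using ht.2.trans hz.2.2.2
  have hder : ∀ t ∈ Icc 0 z.im, HasDerivAt (fun t : ℝ => (Q (z.re + t * I)).im)
      (((z.re + t * I : ℂ) ^ m * ((m + 1) * f (z.re + t * I) +
        (z.re + t * I) * deriv f (z.re + t * I))).re) t := fun t ht => by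
    have h1 := (key _ (hseg t ht)).1.2
    have h2 : HasDerivAt (fun t : ℝ => (z.re + t * I : ℂ)) I t := by
      simpa using (((hasDerivAt_id t).ofReal_comp).mul_const I).const_add (z.re : ℂ)
    have h3 := h1.comp t h2
    have h4 := (imCLM.hasFDerivAt.comp_hasDerivAt t h3)
    refine h4.congr_deriv ?_
    simp
  have hmono : StrictMonoOn (fun t : ℝ => (Q (z.re + t * I)).im) (Icc 0 z.im) := by
    apply strictMonoOn_of_deriv_pos (convex_Icc _ _)
    · exact fun t ht => (hder t ht).continuousAt.continuousWithinAt
    · intro t ht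
      have ht' := interior_subset ht
      rw [(hder t ht').deriv]
      refine lt_of_lt_of_le ?_ (key _ (hseg t ht')).1.1.1
      have := (hseg t ht').1
      positivity
  have hzz : (z.re + z.im * I : ℂ) = z := re_add_im z
  have h0 : (Q (z.re + (0 : ℝ) * I)).im = 0 := by
    simpa using (key z hz).2
  have hpos : 0 < z.im → 0 < (Q z).im := fun hy => by
    have := hmono ⟨le_rfl, hy.le⟩ ⟨hy.le, le_rfl⟩ hy
    simp only [hzz] at this
    rw [h0] at this
    exact this
  refine ⟨?_, hpos⟩
  rcases hz.2.2.1.eq_or_lt with h | h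
  · rw [← h] at hzz
    rw [← hzz, h0]
  · exact (hpos h).le

/-- The properties of a map `F`, close to the identity and expanding in the real direction, at a
point `z` of a thin sector: `F` pushes `z` away from `0`, mainly to the right, increases the slope,
rotates vectors counterclockwise, but not faster than it rotates the field `z ^ N`. -/
structure Good (F : ℂ → ℂ) (N : ℕ) (a : ℝ) (z : ℂ) : Prop where
  pow_re : 0 < (z ^ N).re
  pow_im : 0 ≤ (z ^ N).im
  pow_im_le : 3 * (z ^ N).im ≤ (z ^ N).re
  deriv_re : 0 < (deriv F z).re
  deriv_im : 0 ≤ (deriv F z).im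
  slope : 0 ≤ (F z * conj z).im
  twist_re : 0 < (F z ^ N / (z ^ N * deriv F z)).re
  twist_im : 0 ≤ (F z ^ N / (z ^ N * deriv F z)).im
  push_re : a * z.re ^ N ≤ (F z - z).re
  push_im_le : 3 * |(F z - z).im| ≤ (F z - z).re
  push_im : 0 < z.im → 0 < (F z - z).im

/-- What matters is the first coefficient `N s(0)` of the power: it has to beat the first
coefficient of `F'` in the twist `F ^ N / (z ^ N F')`. -/
theorem one_add_pow_expand {s : ℂ → ℂ} (hs : AnalyticAt ℂ s 0) {j : ℕ} (hj : j ≠ 0) (N : ℕ) :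
    ∃ A : ℂ → ℂ, AnalyticAt ℂ A 0 ∧ A 0 = N * s 0 ∧
      ∀ z, (1 + z ^ j * s z) ^ N = 1 + z ^ j * A z := by
  induction N with
  | zero => exact ⟨fun _ => 0, analyticAt_const, by simp, by simp⟩
  | succ N ih =>
    obtain ⟨A, hA, hA0, h⟩ := ih
    refine ⟨fun z => A z + s z + z ^ j * (A z * s z), by fun_prop, ?_, fun z => ?_⟩
    · simp [hA0, hj]; ring
    · rw [pow_succ, h]; ring

/-- Each of the functions `z ^ N`, `F'`, `F z / z`, `F ^ N / (z ^ N F')` and `F z - z` is real on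
the axis and has the form `q + z ^ (m + 1) f z` with `f 0 > 0`, so `sector_im_nonneg` and
`sector_leading` apply to it. -/
theorem eventually_good {F s : ℂ → ℂ} {j : ℕ} (hs : AnalyticAt ℂ s 0) {c : ℝ} (hc : 0 < c)
    (h0 : s 0 = c) (hF : ∀ᶠ z in 𝓝 (0 : ℂ), F z = z + z ^ (j + 2) * s z)
    (hreal : ∀ᶠ x : ℝ in 𝓝 0, (F x).im = 0) {N : ℕ} (hN : j + 2 < N) :
    ∀ᶠ z in sectorFilter, Good F N (c / 2) z := by
  set u : ℂ → ℂ := fun z => (j + 2) * s z + z * deriv s z with hu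
  have hua : AnalyticAt ℂ u 0 := by
    have := hs.deriv
    fun_prop
  have hu0 : u 0 = ((j + 2) * c : ℝ) := by simp [hu, h0]
  have hF' : ∀ᶠ z in 𝓝 (0 : ℂ), HasDerivAt F (1 + z ^ (j + 1) * u z) z := by
    filter_upwards [hF.eventually_nhds, hs.eventually_analyticAt] with z h1 h2
    have h3 : HasDerivAt (fun z => z + z ^ (j + 2) * s z)
        (1 + ((j + 2 : ℕ) * z ^ (j + 1) * s z + z ^ (j + 2) * deriv s z)) z :=
      (hasDerivAt_id z).add ((hasDerivAt_pow (j + 2) z).mul h2.differentiableAt.hasDerivAt)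
    refine (h3.congr_of_eventuallyEq h1).congr_deriv ?_
    simp only [hu]; push_cast; ring
  have hd : ∀ᶠ z in 𝓝 (0 : ℂ), deriv F z = 1 + z ^ (j + 1) * u z := hF'.mono fun z h => h.deriv
  have hFr : ∀ᶠ x : ℝ in 𝓝[>] 0, (F x).im = 0 := hreal.filter_mono nhdsWithin_le_nhds
  have hz0 : Tendsto (fun x : ℝ => (x : ℂ)) (𝓝 0) (𝓝 0) := by
    simpa using continuous_ofReal.tendsto 0
  have hdr : ∀ᶠ x : ℝ in 𝓝 0, (deriv F x).im = 0 := by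
    filter_upwards [hreal.eventually_nhds, hz0.eventually hF'] with x h1 h2
    have h3 := imCLM.hasFDerivAt.comp_hasDerivAt x h2.comp_ofReal
    have h4 : HasDerivAt (fun y : ℝ => (F y).im) 0 x :=
      (hasDerivAt_const x (0 : ℝ)).congr_of_eventuallyEq h1
    rw [h2.deriv]
    exact h3.unique h4
  have hdr' := hdr.filter_mono (nhdsWithin_le_nhds (s := Ioi 0))
  have hreal_of_im : ∀ {w : ℂ}, w.im = 0 → w = (w.re : ℂ) := fun h => by
    apply Complex.ext <;> simp [h]
  obtain ⟨A, hA, hA0, hAN⟩ := one_add_pow_expand hs (j := j + 1) (by omega) N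
  -- powers
  obtain ⟨M, rfl⟩ : ∃ M, N = M + 1 := ⟨N - 1, by omega⟩
  have p1 := sector_leading (f := fun _ => 1) continuousAt_const one_pos (by simp) (M + 1)
  have p2 := sector_im_nonneg (Q := fun z => z ^ (M + 1)) (f := fun _ => 1) (q := 0) (m := M)
    analyticAt_const one_pos (by simp) (by simp)
    (Eventually.of_forall fun x => by rw [← ofReal_pow, ofReal_im])
  -- derivative
  have d0 : Tendsto (fun z => (1 + z ^ (j + 1) * u z).re) (𝓝 0) (𝓝 1) := by
    have : ContinuousAt (fun z => (1 + z ^ (j + 1) * u z).re) 0 := by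
      have := hua.continuousAt
      fun_prop
    simpa [ContinuousAt] using this
  have d1 := d0.eventually (lt_mem_nhds one_pos)
  have d2 := sector_im_nonneg (Q := deriv F) (f := u) (q := 1) (m := j) hua (c := (j + 2) * c)
    (by positivity) hu0 hd hdr'
  -- slope
  have s2 := sector_im_nonneg (Q := fun z => 1 + z ^ (j + 1) * s z) (f := s) (q := 1) (m := j) hs hc
    h0 (by simp) (by
      have h1 := (hz0.eventually hF).filter_mono (nhdsWithin_le_nhds (s := Ioi (0 : ℝ)))
      filter_upwards [h1, hFr, self_mem_nhdsWithin] with x h1 h2 h3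
      have hx : (x : ℂ) ≠ 0 := by exact_mod_cast (ne_of_gt h3)
      have : (1 + (x : ℂ) ^ (j + 1) * s x) = F x / x := by
        rw [h1]; field_simp; ring
      rw [this, div_ofReal_im, h2, zero_div])
  -- twist
  set τ : ℂ → ℂ := fun z => (A z - u z) / (1 + z ^ (j + 1) * u z) with hτ
  have hτa : AnalyticAt ℂ τ 0 := by
    apply AnalyticAt.div (hA.sub hua) (by fun_prop)
    simp
  have hτ0 : τ 0 = (((M + 1 : ℕ) - (j + 2)) * c : ℝ) := by
    simp [hτ, hA0, hu0, h0]; ring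
  -- The twist expands as `1 + (N - (j + 2)) c z ^ (j + 1) + ...`. Its first coefficient is positive
  -- exactly because `N > j + 2`.
  have hτc : 0 < (((M + 1 : ℕ) : ℝ) - (j + 2)) * c := by
    apply mul_pos _ hc
    have : ((j + 2 : ℕ) : ℝ) < (M + 1 : ℕ) := by exact_mod_cast hN
    push_cast at this ⊢
    linarith
  set Tw : ℂ → ℂ := fun z => (1 + z ^ (j + 1) * s z) ^ (M + 1) / (1 + z ^ (j + 1) * u z) with hTw
  have hne : ∀ᶠ z in 𝓝 (0 : ℂ), 1 + z ^ (j + 1) * u z ≠ 0 := by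
    filter_upwards [d1] with z hz h
    rw [h] at hz
    simp at hz
  have hTwe : ∀ᶠ z in 𝓝 (0 : ℂ), Tw z = 1 + z ^ (j + 1) * τ z := by
    filter_upwards [hne] with z hz
    simp only [hTw, hτ, hAN]
    field_simp
    ring
  have t0 : Tendsto (fun z => (Tw z).re) (𝓝 0) (𝓝 1) := by
    have : ContinuousAt (fun z => (Tw z).re) 0 := by
      have h1 := hua.continuousAt
      have h2 := hs.continuousAt
      refine continuous_re.continuousAt.comp (ContinuousAt.div (by fun_prop) (by fun_prop) ?_)
      simp
    simpa [ContinuousAt, hTw] using this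
  have t1 := t0.eventually (lt_mem_nhds one_pos)
  have hFz : ∀ᶠ z in 𝓝 (0 : ℂ), z ≠ 0 → 1 + z ^ (j + 1) * s z = F z / z := by
    filter_upwards [hF] with z h1 h2
    rw [h1]; field_simp; ring
  have t2 := sector_im_nonneg (Q := Tw) (f := τ) (q := 1) (m := j) hτa hτc hτ0 hTwe (by
      filter_upwards [(hz0.eventually hFz).filter_mono nhdsWithin_le_nhds,
        (hz0.eventually hd).filter_mono nhdsWithin_le_nhds, hFr, hdr', self_mem_nhdsWithin]
        with x h1 h2 h3 h4 h5
      have hx : (x : ℂ) ≠ 0 := by exact_mod_cast (ne_of_gt h5)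
      simp only [hTw]
      rw [h1 hx, ← h2, hreal_of_im h3, hreal_of_im h4, ← ofReal_div, ← ofReal_pow, ← ofReal_div,
        ofReal_im])
  -- push
  have q1 := sector_leading hs.continuousAt hc h0 (j + 2)
  have q2 := sector_im_nonneg (Q := fun z => F z - z) (f := s) (q := 0) (m := j + 1) hs hc h0
    (hF.mono fun z h => by rw [h]; ring) (hFr.mono fun x h => by simp [h])
  have r1 := (tendsto_sector_re.mono_right nhdsWithin_le_nhds).eventually (gt_mem_nhds one_pos)
  have z0 := tendsto_sector_zero
  filter_upwards [eventually_sector_re_pos, r1, p1, p2, z0.eventually d1, z0.eventually hd, d2, s2,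
    z0.eventually hF, z0.eventually hFz, z0.eventually t1, t2, q1, q2]
    with z hre hre1 p1 p2 d1 hd d2 s2 hFe hFz t1 t2 q1 q2
  have hzne : z ≠ 0 := fun h => by simp [h] at hre
  have hTz : Tw z = F z ^ (M + 1) / (z ^ (M + 1) * deriv F z) := by
    simp only [hTw]
    rw [hFz hzne, hd, div_pow, div_div]
  have hsub : F z - z = z ^ (j + 2) * s z := by rw [hFe]; ring
  simp only [mul_one] at p1
  have hp := p1.1
  have hrp : 0 < z.re ^ (M + 1) := by positivity
  refine ⟨by linarith, p2.1, ?_, by rw [hd]; exact d1, d2.1, ?_, by rwa [← hTz],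
    by rw [← hTz]; exact t2.1, ?_, ?_, q2.2⟩
  · exact (mul_le_mul_of_nonneg_left (le_abs_self _) (by norm_num)).trans p1.2
  · have : F z * conj z = ((Complex.normSq z : ℝ) : ℂ) * (1 + z ^ (j + 1) * s z) := by
      rw [hFz hzne, ← mul_conj]; field_simp
    rw [this, im_ofReal_mul]
    exact mul_nonneg (normSq_nonneg z) s2.1
  · rw [hsub]
    refine le_trans ?_ q1.1
    apply mul_le_mul_of_nonneg_left _ (by positivity)
    -- As `0 < Re z < 1` and `j + 2 < N`, the true push of order `j + 2` dominates one of order `N`.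
    -- This gives a lower bound with the same exponent for all the germs.
    exact pow_le_pow_of_le_one hre.le hre1.le hN.le
  · rw [hsub]; exact q1.2

/-- Factor `F z - z` by its order of vanishing at `0`. The order is at least `2` since `F` fixes `0`
with derivative `1`; the first coefficient is a limit of positive reals along the positive
half-line, and nonzero by the choice of the order. -/
theorem exists_expansion {F : ℂ → ℂ} (hF : AnalyticAt ℂ F 0) (h0 : F 0 = 0) (h1 : deriv F 0 = 1)
    (hreal : ∀ᶠ x : ℝ in 𝓝 0, (F x).im = 0) (hpush : ∀ᶠ x : ℝ in 𝓝[>] 0, x < (F x).re) :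
    ∃ (j : ℕ) (s : ℂ → ℂ) (c : ℝ), AnalyticAt ℂ s 0 ∧ 0 < c ∧ s 0 = c ∧
      ∀ᶠ z in 𝓝 (0 : ℂ), F z = z + z ^ (j + 2) * s z := by
  have hz0 : Tendsto (fun x : ℝ => (x : ℂ)) (𝓝 0) (𝓝 0) := by
    simpa using continuous_ofReal.tendsto 0
  have hle : 𝓝[>] (0 : ℝ) ≤ 𝓝 0 := nhdsWithin_le_nhds
  have hD : AnalyticAt ℂ (fun z => F z - z) 0 := hF.sub analyticAt_id
  have hne : ¬ ∀ᶠ z in 𝓝 (0 : ℂ), F z - z = 0 := fun h => by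
    obtain ⟨x, h2, h3⟩ := ((hz0.eventually h).filter_mono hle |>.and hpush).exists
    rw [sub_eq_zero] at h2
    simp [h2] at h3
  obtain ⟨n, s, hs, hs0, hn⟩ := hD.exists_eventuallyEq_pow_smul_nonzero_iff.mpr hne
  simp only [sub_zero, smul_eq_mul] at hn
  obtain ⟨j, rfl⟩ : ∃ j, n = j + 2 := by
    have hn0 := hn.self_of_nhds
    match n, hn, hn0 with
    | 0, hn, hn0 => exact absurd (by simpa [h0] using hn0.symm) hs0
    | 1, hn, hn0 =>
      exfalso
      have e1 : HasDerivAt (fun z => F z - z) (1 - 1) 0 :=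
        (h1 ▸ hF.differentiableAt.hasDerivAt).sub (hasDerivAt_id 0)
      have e2 : HasDerivAt (fun z => z ^ 1 * s z) (s 0) 0 := by
        have := (hasDerivAt_pow 1 (0 : ℂ)).mul hs.differentiableAt.hasDerivAt
        refine this.congr_deriv (by simp)
      have := e1.unique (e2.congr_of_eventuallyEq hn)
      rw [sub_self] at this
      exact hs0 this.symm
    | j + 2, _, _ => exact ⟨j, rfl⟩
  have hlim : Tendsto (fun x : ℝ => s x) (𝓝[>] 0) (𝓝 (s 0)) :=
    (hs.continuousAt.tendsto.comp hz0).mono_left hle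
  have hsx : ∀ᶠ x : ℝ in 𝓝[>] 0, 0 < (s x).re ∧ (s x).im = 0 := by
    filter_upwards [(hz0.eventually hn).filter_mono hle, hreal.filter_mono hle, hpush,
      self_mem_nhdsWithin] with x e1 e2 e3 e4
    have e5 : (0 : ℝ) < x ^ (j + 2) := pow_pos e4 _
    rw [← ofReal_pow] at e1
    have e6 := congrArg Complex.re e1
    have e7 := congrArg Complex.im e1
    rw [re_ofReal_mul, sub_re, ofReal_re] at e6
    rw [im_ofReal_mul, sub_im, ofReal_im, e2, sub_zero] at e7
    refine ⟨?_, ?_⟩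
    · by_contra hcon
      nlinarith
    · exact (mul_eq_zero.mp e7.symm).resolve_left e5.ne'
  have him : (s 0).im = 0 := by
    refine tendsto_nhds_unique ((continuous_im.tendsto _).comp hlim) ?_
    exact tendsto_const_nhds.congr' (hsx.mono fun x h => h.2.symm)
  have hre : 0 ≤ (s 0).re :=
    ge_of_tendsto ((continuous_re.tendsto _).comp hlim) (hsx.mono fun x h => h.1.le)
  have hs0' : s 0 = ((s 0).re : ℂ) := by apply Complex.ext <;> simp [him]
  refine ⟨j, s, (s 0).re, hs, lt_of_le_of_ne hre fun h => hs0 ?_, hs0', ?_⟩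
  · rw [hs0', ← h, ofReal_zero]
  · exact hn.mono fun z h => by rw [← h]; ring

/-- A real analytic germ, tangent to the identity and expanding on the positive half-line, is
well-behaved on thin sectors. -/
theorem exists_eventually_good {F : ℂ → ℂ} (hF : AnalyticAt ℂ F 0) (h0 : F 0 = 0)
    (h1 : deriv F 0 = 1) (hreal : ∀ᶠ x : ℝ in 𝓝 0, (F x).im = 0)
    (hpush : ∀ᶠ x : ℝ in 𝓝[>] 0, x < (F x).re) :
    ∃ N₀ : ℕ, ∀ N ≥ N₀, ∃ a > 0, ∀ᶠ z in sectorFilter, Good F N a z := by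
  obtain ⟨j, s, c, hs, hc, hs0, h⟩ := exists_expansion hF h0 h1 hreal hpush
  exact ⟨j + 3, fun N hN => ⟨c / 2, by positivity, eventually_good hs hc hs0 h hreal (by omega)⟩⟩

/-! ### An invariant cone field, and curves extended by pull back -/

section

/-- The invariant cone field: directions `v` at `z` between `z ^ N` rotated by `-π/4` and `π/4`. -/
def Cone (N : ℕ) (z v : ℂ) : Prop :=
  v ≠ 0 ∧ 0 ≤ ((1 + I) * v).re ∧ 0 ≤ ((1 + I) * v * conj (z ^ N)).im

theorem Cone.im_nonneg {F : ℂ → ℂ} {N : ℕ} {a : ℝ} {z v : ℂ} (hz : Good F N a z)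
    (hv : Cone N z v) : 0 ≤ ((1 + I) * v).im := by
  have h1 := hv.2.1
  have h2 := hv.2.2
  have h3 := hz.pow_re
  have h4 := hz.pow_im
  set u := (1 + I) * v
  rw [mul_im, conj_re, conj_im] at h2
  by_contra hcon
  nlinarith [mul_nonneg h1 h4]

/-- This is what the cone field is for: a curve with velocities in the cones is a graph over the
real axis. -/
theorem Cone.re_pos {F : ℂ → ℂ} {N : ℕ} {a : ℝ} {z v : ℂ} (hz : Good F N a z)
    (hv : Cone N z v) : 0 < v.re := by
  have h1 := hv.2.1
  have h2 := hv.im_nonneg hz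
  simp only [mul_re, mul_im, add_re, add_im, one_re, one_im, I_re, I_im] at h1 h2
  rcases (show 0 ≤ v.re by linarith).eq_or_lt with h | h
  · exact absurd (Complex.ext h.symm (by simp; linarith)) hv.1
  · exact h

/-- The starting condition: directions with argument in `(0, π/4]` are in the cone, since `z ^ N`
turns by less than `π/4`. -/
theorem Cone.of_im_le_re {F : ℂ → ℂ} {N : ℕ} {a : ℝ} {z v : ℂ} (hz : Good F N a z)
    (h0 : 0 < v.im) (h1 : v.im ≤ v.re) : Cone N z v := by
  have h3 := hz.pow_re
  have h4 := hz.pow_im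
  have h5 := hz.pow_im_le
  refine ⟨fun h => by simp [h] at h0, ?_, ?_⟩
  · simp only [mul_re, add_re, add_im, one_re, one_im, I_re, I_im]; linarith
  · rw [mul_im, conj_re, conj_im]
    simp only [mul_re, mul_im, add_re, add_im, one_re, one_im, I_re, I_im]
    nlinarith [mul_nonneg (sub_nonneg.mpr h1) h4, mul_nonneg h0.le h3.le,
      mul_nonneg (sub_nonneg.mpr h1) h3.le]

/-- Division by `F'` turns `v` clockwise, so the upper bound `π/4` persists. The lower bound moves
with `z ^ N`, and passing from `F w` to `w` it turns clockwise at least as much as `v`: this is the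
sign of the twist `F ^ N / (w ^ N F')`. -/
theorem Cone.backward {F : ℂ → ℂ} {N : ℕ} {a : ℝ} {w v : ℂ} (hw : Good F N a w)
    (hz : Good F N a (F w)) (hv : Cone N (F w) v) : Cone N w (v / deriv F w) := by
  have h0 := hv.im_nonneg hz
  have d1 := hw.deriv_re
  have d2 := hw.deriv_im
  have hd : deriv F w ≠ 0 := fun h => by simp [h] at d1
  have hp := hz.pow_re
  have hp' := hw.pow_re
  have hFw : F w ^ N ≠ 0 := fun h => by simp [h] at hp
  have hwN : w ^ N ≠ 0 := fun h => by simp [h] at hp'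
  have n1 : 0 < normSq (deriv F w) := normSq_pos.mpr hd
  refine ⟨div_ne_zero hv.1 hd, ?_, ?_⟩
  · rw [← mul_div_assoc, div_re]
    have := hv.2.1
    positivity
  · have e : (1 + I) * (v / deriv F w) * conj (w ^ N) =
        ((normSq (w ^ N) / normSq (F w ^ N) : ℝ) : ℂ) *
          ((1 + I) * v * conj (F w ^ N) * (F w ^ N / (w ^ N * deriv F w))) := by
      rw [ofReal_div, ← mul_conj, ← mul_conj]
      have : conj (F w ^ N) ≠ 0 := by simpa using hFw
      field_simp
    rw [e, im_ofReal_mul, mul_im]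
    have q1 : 0 ≤ ((1 + I) * v * conj (F w ^ N)).re := by
      rw [mul_re, conj_re, conj_im]
      nlinarith [mul_nonneg hv.2.1 hp.le, mul_nonneg h0 hz.pow_im]
    have := hv.2.2
    have t1 := hw.twist_re
    have t2 := hw.twist_im
    exact mul_nonneg (div_nonneg (normSq_nonneg _) (normSq_nonneg _)) (by positivity)

section Extension

variable {ι : Type*} (s : ι → ι) (G : ι → ℂ → ℂ) (β : ι → ℝ → ℂ)

/-- The `n`-fold pull back of the curves `β i` by the maps `G i`. -/
def pullCurve : ℕ → ι → ℝ → ℂ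
  | 0, i, t => β i t
  | n + 1, i, t => G i (pullCurve n (s i) (t + 1))

/-- The extension of the curves `β i`, given on `(0, 1]`, to `(-∞, 1]` by pulling back. -/
def extCurve (i : ι) (t : ℝ) : ℂ := pullCurve s G β ⌊1 - t⌋₊ i t

variable {s G β}

/-- The matching of `β` with its first pull back near `t = 0` propagates, under `n` further pull
backs, to a neighbourhood of `t = -n`. -/
theorem pullCurve_succ_eq (h : ∀ i t, |t| < 1 / 3 → β i t = G i (β (s i) (t + 1))) (n : ℕ) :
    ∀ (i : ι) (t : ℝ), |t + n| < 1 / 3 → pullCurve s G β (n + 1) i t = pullCurve s G β n i t := by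
  induction n with
  | zero => exact fun i t ht => (h i t (by simpa using ht)).symm
  | succ n ih =>
    intro i t ht
    change G i _ = G i _
    rw [ih]
    rwa [add_assoc, add_comm (1 : ℝ), ← Nat.cast_succ]

theorem extCurve_of_pos {t : ℝ} (ht : 0 < t) (i : ι) : extCurve s G β i t = β i t := by
  have : ⌊1 - t⌋₊ = 0 := Nat.floor_eq_zero.mpr (by linarith)
  rw [extCurve, this]; rfl

theorem extCurve_of_nonpos {t : ℝ} (ht : t ≤ 0) (i : ι) :
    extCurve s G β i t = G i (extCurve s G β (s i) (t + 1)) := by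
  have : ⌊1 - t⌋₊ = ⌊1 - (t + 1)⌋₊ + 1 := by
    rw [← Nat.floor_add_one (by linarith)]; congr 1; ring
  rw [extCurve, this]; rfl

/-- The piecewise definition has seams at the nonpositive integers. Near each parameter the
extension is nevertheless a single iterated pull back, hence as smooth as `β` and the maps `G i`. -/
theorem extCurve_eventuallyEq (h : ∀ i t, |t| < 1 / 3 → β i t = G i (β (s i) (t + 1)))
    (i : ι) (t₀ : ℝ) : extCurve s G β i =ᶠ[𝓝 t₀] pullCurve s G β ⌊1 - t₀⌋₊ i := by
  rcases lt_or_ge 1 t₀ with h1 | h1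
  · have e : ⌊1 - t₀⌋₊ = 0 := Nat.floor_eq_zero.mpr (by linarith)
    filter_upwards [lt_mem_nhds h1] with t ht
    rw [e, extCurve_of_pos (by linarith)]; rfl
  set n := ⌊1 - t₀⌋₊ with hn
  have h2 : (n : ℝ) ≤ 1 - t₀ := Nat.floor_le (by linarith)
  have h3 : 1 - t₀ < n + 1 := Nat.lt_floor_add_one _
  filter_upwards [lt_mem_nhds (show -(n : ℝ) < t₀ by linarith),
    gt_mem_nhds (show t₀ < 1 - n + 1 / 3 by linarith)] with t h4 h5
  rcases le_or_gt t (1 - n) with h6 | h6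
  · have : ⌊1 - t⌋₊ = n := by
      rw [Nat.floor_eq_iff (by have : (0 : ℝ) ≤ n := n.cast_nonneg; linarith)]
      constructor <;> linarith
    rw [extCurve, this]
  · rcases Nat.eq_zero_or_eq_succ_pred n with h7 | h7
    · rw [h7, extCurve_of_pos (by simp [h7] at h4; linarith)]; rfl
    -- Just to the right of `1 - n` the number of pull backs drops to `n - 1`; there the pull backs
    -- of orders `n` and `n - 1` agree.
    · set m := n.pred
      rw [h7] at h4 h5 h6
      push_cast at h4 h5 h6
      have : ⌊1 - t⌋₊ = m := by
        rw [Nat.floor_eq_iff (by have : (0 : ℝ) ≤ m := m.cast_nonneg; linarith)]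
        constructor <;> linarith
      rw [extCurve, this, h7, pullCurve_succ_eq h]
      rw [abs_lt]; constructor <;> linarith

theorem extCurve_eventuallyEq_of_nonpos
    (h : ∀ i t, |t| < 1 / 3 → β i t = G i (β (s i) (t + 1))) (i : ι) {t : ℝ} (ht : t ≤ 0) :
    extCurve s G β i =ᶠ[𝓝 t] fun t => G i (extCurve s G β (s i) (t + 1)) := by
  have h1 := extCurve_eventuallyEq h i t
  have h2 : ∀ᶠ t' in 𝓝 t, extCurve s G β (s i) (t' + 1) =
      pullCurve s G β ⌊1 - (t + 1)⌋₊ (s i) (t' + 1) :=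
    (((continuous_add_const 1).tendsto t).eventually (extCurve_eventuallyEq h (s i) (t + 1)))
  have : ⌊1 - t⌋₊ = ⌊1 - (t + 1)⌋₊ + 1 := by
    rw [← Nat.floor_add_one (by linarith)]; congr 1; ring
  filter_upwards [h1, h2] with t' h3 h4
  rw [h3, h4, this]; rfl

end Extension

end

/-! ### Backward invariant half arcs at a parabolic point -/

/-- `F` and `G` are mutually inverse germs at `0`, tangent to the identity, and `G` preserves the
upper half plane. -/
structure Germ (F G : ℂ → ℂ) : Prop where
  analyticF : AnalyticAt ℂ F 0
  analyticG : AnalyticAt ℂ G 0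
  G_zero : G 0 = 0
  deriv_F : deriv F 0 = 1
  inv : ∀ᶠ z in 𝓝 (0 : ℂ), F (G z) = z
  im_pos : ∀ᶠ z in 𝓝 (0 : ℂ), 0 < z.im → 0 < (G z).im

/-- The properties of `Germ F G` at a point `z` near `0`. -/
structure Near (F G : ℂ → ℂ) (η : ℝ) (z : ℂ) : Prop where
  inv : F (G z) = z
  im_pos : 0 < z.im → 0 < (G z).im
  analyticG : AnalyticAt ℂ G z
  chain : deriv F (G z) * deriv G z = 1
  deriv_sub : ‖deriv G z - 1‖ ≤ η
  sub : ‖G z - z‖ ≤ η * ‖z‖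

/-- The chain rule for `F (G z) = z` forces `G' (0) = 1`; continuity of `G'` and differentiability
at `0` give the two estimates. -/
theorem Germ.eventually_near {F G : ℂ → ℂ} (h : Germ F G) {η : ℝ} (hη : 0 < η) :
    ∀ᶠ z in 𝓝 (0 : ℂ), Near F G η z := by
  have hG0 : Tendsto G (𝓝 0) (𝓝 0) := by simpa [h.G_zero] using h.analyticG.continuousAt.tendsto
  have hF := hG0.eventually h.analyticF.eventually_analyticAt
  have hch : ∀ᶠ z in 𝓝 (0 : ℂ), deriv F (G z) * deriv G z = 1 := by
    filter_upwards [h.inv.eventually_nhds, h.analyticG.eventually_analyticAt, hF] with z h1 h2 h3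
    have h4 := h3.differentiableAt.hasDerivAt.comp z h2.differentiableAt.hasDerivAt
    exact h4.unique ((hasDerivAt_id z).congr_of_eventuallyEq h1)
  have hd : deriv G 0 = 1 := by
    have := hch.self_of_nhds
    rwa [h.G_zero, h.deriv_F, one_mul] at this
  have hc : Tendsto (fun z => ‖deriv G z - 1‖) (𝓝 0) (𝓝 0) := by
    have : ContinuousAt (fun z => ‖deriv G z - 1‖) 0 :=
      (h.analyticG.deriv.continuousAt.sub continuousAt_const).norm
    simpa [ContinuousAt, hd] using this
  have ho := (hasDerivAt_iff_isLittleO.mp h.analyticG.differentiableAt.hasDerivAt).def hη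
  filter_upwards [h.inv, h.im_pos, h.analyticG.eventually_analyticAt, hch,
    hc.eventually (gt_mem_nhds hη), ho] with z h1 h2 h3 h5 h6 h7
  refine ⟨h1, h2, h3, h5, h6.le, ?_⟩
  simpa [h.G_zero, hd] using h7

theorem norm_le_of_mem_sector {κ r : ℝ} {z : ℂ} (hz : z ∈ sector κ r) :
    ‖z‖ ≤ (1 + κ) * z.re := by
  have := norm_le_abs_re_add_abs_im z
  rw [abs_of_pos hz.1, abs_of_nonneg hz.2.2.1] at this
  linarith [hz.2.2.2]

/-- Thin sectors are mapped into themselves by the inverse of an expanding map. -/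
theorem sector_backward {F G : ℂ → ℂ} {κ r r₁ a : ℝ} {N : ℕ} (hκ : 0 < κ) (hκ1 : κ ≤ 1)
    (hgood : ∀ z ∈ sector (2 * κ) r, Good F N a z) (ha : 0 < a) (hr : r₁ ≤ r / 2) {z : ℂ}
    (hn : Near F G (κ / 20) z) (hz : z ∈ sector κ r₁) (him : 0 < z.im) :
    G z ∈ sector κ r₁ ∧ Good F N a (G z) ∧ (G z).re + a * (G z).re ^ N ≤ z.re ∧
      0 < (G z).im ∧ (G z).im < z.im ∧ (G z).im * z.re ≤ z.im * (G z).re := by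
  have h1 := hn.sub
  have h2 := norm_le_of_mem_sector hz
  obtain ⟨z1, z2, z3, z4⟩ := hz
  set w := G z
  have h3 : ‖w - z‖ ≤ κ / 10 * z.re := by
    refine h1.trans ?_
    have : (1 + κ) * z.re ≤ 2 * z.re := by nlinarith
    have : ‖z‖ ≤ 2 * z.re := h2.trans this
    nlinarith
  have h4 := abs_le.mp ((abs_re_le_norm (w - z)).trans h3)
  have h5 := abs_le.mp ((abs_im_le_norm (w - z)).trans h3)
  rw [sub_re] at h4
  rw [sub_im] at h5
  have h6 : κ * z.re ≤ z.re := by nlinarith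
  have h7 : 0 < κ * z.re := by positivity
  have hw1 : 0 < w.re := by linarith
  have hw0 : 0 < w.im := hn.im_pos him
  -- A crude estimate first: `G` is so close to the identity that the slope at most doubles. Then
  -- `Good` is available at `G z`, and shows that in fact the slope does not grow.
  have hwm : w ∈ sector (2 * κ) r := by
    refine ⟨hw1, by linarith, hw0.le, ?_⟩
    have : κ * (z.re - κ / 10 * z.re) ≤ κ * w.re := mul_le_mul_of_nonneg_left (by linarith) hκ.le
    nlinarith
  have g := hgood w hwm
  have i1 := g.push_re
  have i2 := g.push_im hw0
  have i3 := g.slope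
  rw [hn.inv] at i1 i2 i3
  rw [sub_re] at i1
  rw [sub_im] at i2
  rw [mul_im, conj_re, conj_im] at i3
  have hpos : 0 < a * w.re ^ N := by positivity
  have hsl : w.im * z.re ≤ z.im * w.re := by linarith
  refine ⟨⟨hw1, by linarith, hw0.le, ?_⟩, g, by linarith, hw0, by linarith, hsl⟩
  have : w.im * z.re ≤ κ * w.re * z.re := by nlinarith
  exact le_of_mul_le_mul_right this z1

/-- The transition function of the base curves: `0` for `t ≤ 1/3` and `1` for `t ≥ 2/3`. -/
def cutoff (t : ℝ) : ℝ := Real.smoothTransition (3 * t - 1)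

theorem cutoff_contDiff : ContDiff ℝ ∞ cutoff :=
  Real.smoothTransition.contDiff.comp (by fun_prop)

theorem cutoff_deriv_nonneg (t : ℝ) : 0 ≤ deriv cutoff t :=
  Monotone.deriv_nonneg (fun x y h => Real.smoothTransition.monotone (by linarith))

theorem cutoff_nonneg (t : ℝ) : 0 ≤ cutoff t := Real.smoothTransition.nonneg _

theorem cutoff_le_one (t : ℝ) : cutoff t ≤ 1 := Real.smoothTransition.le_one _

theorem cutoff_eq_zero {t : ℝ} (ht : t ≤ 1 / 3) : cutoff t = 0 :=
  Real.smoothTransition.zero_of_nonpos (by linarith)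

theorem cutoff_eq_one {t : ℝ} (ht : 2 / 3 ≤ t) : cutoff t = 1 :=
  Real.smoothTransition.one_of_one_le (by linarith)

/-- The curve from `G b` to `b` with velocity `δ b` at `b` and the `G`-image of this jet at `G b`. -/
def baseCurve (G : ℂ → ℂ) (b : ℂ) (δ t : ℝ) : ℂ :=
  (1 - (cutoff t : ℂ)) * G (b + t * (δ * b)) + cutoff t * (b + (t - 1) * (δ * b))

/-- Near `t = 1` the curve is a straight segment that does not depend on the map, and near `t = 0`
it is the image of that segment. Hence the end of one curve matches the start of another, with `G'`
arbitrary. -/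
theorem baseCurve_match {G G' : ℂ → ℂ} {b : ℂ} {δ t : ℝ} (ht : |t| < 1 / 3) :
    baseCurve G b δ t = G (baseCurve G' b δ (t + 1)) := by
  rw [abs_lt] at ht
  simp [baseCurve, cutoff_eq_zero ht.2.le, cutoff_eq_one (show 2 / 3 ≤ t + 1 by linarith)]

theorem baseCurve_hasDerivAt {G : ℂ → ℂ} {b : ℂ} {δ t : ℝ}
    (hG : DifferentiableAt ℂ G (b + t * (δ * b))) :
    HasDerivAt (baseCurve G b δ)
      ((1 - (cutoff t : ℂ)) * (deriv G (b + t * (δ * b)) * (δ * b)) + cutoff t * (δ * b) +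
        ((deriv cutoff t : ℝ) : ℂ) * (b + t * (δ * b) - G (b + t * (δ * b)) - δ * b)) t := by
  have hc : HasDerivAt (fun t : ℝ => (cutoff t : ℂ)) ((deriv cutoff t : ℝ) : ℂ) t :=
    ((cutoff_contDiff.differentiable (by simp)).differentiableAt.hasDerivAt).ofReal_comp
  have hl : HasDerivAt (fun t : ℝ => (t : ℂ)) 1 t := (hasDerivAt_id t).ofReal_comp
  have h1 : HasDerivAt (fun t : ℝ => b + t * (δ * b)) (δ * b) t := by
    simpa using (hl.mul_const (δ * b : ℂ)).const_add b
  have h2 : HasDerivAt (fun t : ℝ => b + (t - 1) * (δ * b)) (δ * b) t := by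
    simpa using ((hl.sub_const 1).mul_const (δ * b : ℂ)).const_add b
  have h3 := hG.hasDerivAt.comp t h1
  have h4 := ((hc.const_sub 1).mul h3).add (hc.mul h2)
  refine h4.congr_deriv ?_
  simp only [Function.comp]
  ring

theorem baseCurve_contDiffAt {G : ℂ → ℂ} {b : ℂ} {δ t : ℝ}
    (hG : AnalyticAt ℂ G (b + t * (δ * b))) : ContDiffAt ℝ ∞ (baseCurve G b δ) t := by
  have hc : ContDiff ℝ ∞ (fun t : ℝ => (cutoff t : ℂ)) := ofRealCLM.contDiff.comp cutoff_contDiff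
  have hl : ContDiff ℝ ∞ (fun t : ℝ => (t : ℂ)) := ofRealCLM.contDiff
  have h3 : ContDiffAt ℝ ∞ (fun t : ℝ => G (b + t * (δ * b))) t :=
    (hG.contDiffAt.restrict_scalars ℝ).comp t
      (contDiffAt_const.add (hl.contDiffAt.mul contDiffAt_const))
  exact ((contDiffAt_const.sub hc.contDiffAt).mul h3).add (hc.contDiffAt.mul
    (contDiffAt_const.add ((hl.contDiffAt.sub contDiffAt_const).mul contDiffAt_const)))

theorem mem_sector_convex {κ r p q : ℝ} {z w : ℂ} (hz : z ∈ sector κ r) (hw : w ∈ sector κ r)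
    (hp : 0 ≤ p) (hq : 0 ≤ q) (hpq : p + q = 1) (hz0 : 0 < z.im) (hw0 : 0 < w.im) :
    (p * z + q * w : ℂ) ∈ sector κ r ∧ 0 < (p * z + q * w : ℂ).im := by
  obtain ⟨z1, z2, z3, z4⟩ := hz
  obtain ⟨w1, w2, w3, w4⟩ := hw
  have key : ∀ x y : ℝ, 0 < x → 0 < y → 0 < p * x + q * y := fun x y hx hy => by
    rcases hp.eq_or_lt with h | h
    · have : q = 1 := by linarith
      rw [← h, this]; linarith
    · have := mul_pos h hx
      have := mul_nonneg hq hy.le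
      linarith
  have e1 : (p * z + q * w : ℂ).re = p * z.re + q * w.re := by simp
  have e2 : (p * z + q * w : ℂ).im = p * z.im + q * w.im := by simp
  refine ⟨⟨by rw [e1]; exact key _ _ z1 w1, ?_, by rw [e2]; exact (key _ _ hz0 hw0).le, ?_⟩,
    by rw [e2]; exact key _ _ hz0 hw0⟩
  · rw [e1]
    have := key _ _ (sub_pos.mpr z2) (sub_pos.mpr w2)
    nlinarith
  · rw [e1, e2]
    nlinarith [mul_nonneg hp (sub_nonneg.mpr z4), mul_nonneg hq (sub_nonneg.mpr w4)]

/-- The properties of the base curve at the parameter `t ∈ [0, 1]`. -/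
theorem baseCurve_props {F G : ℂ → ℂ} {κ r r₁ a : ℝ} {N : ℕ} (hκ : 0 < κ) (hκ1 : κ ≤ 1 / 2)
    (hgood : ∀ z ∈ sector (2 * κ) r, Good F N a z) (ha : 0 < a) (hr : r₁ ≤ r / 2)
    (hn : ∀ z ∈ sector κ r₁, Near F G (κ / 20) z) {ε δ : ℝ} (hε : 0 < ε)
    (hεr : 2 * (ε / κ) < r₁) (hδ : 0 < δ) (hδ1 : δ ≤ 1 / 2)
    (hδ2 : ∀ x ∈ Icc (1 : ℝ) 2, δ * (ε / κ) < ((x : ℂ) * ⟨ε / κ, ε⟩ - G (x * ⟨ε / κ, ε⟩)).im)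
    {t : ℝ} (ht : t ∈ Icc (0 : ℝ) 1) :
    ContDiffAt ℝ ∞ (baseCurve G ⟨ε / κ, ε⟩ δ) t ∧
    baseCurve G ⟨ε / κ, ε⟩ δ t ∈ sector κ r₁ ∧ 0 < (baseCurve G ⟨ε / κ, ε⟩ δ t).im ∧
    0 < (deriv (baseCurve G ⟨ε / κ, ε⟩ δ) t).im ∧
    (deriv (baseCurve G ⟨ε / κ, ε⟩ δ) t).im ≤ (deriv (baseCurve G ⟨ε / κ, ε⟩ δ) t).re := by
  set b : ℂ := ⟨ε / κ, ε⟩ with hb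
  obtain ⟨t0, t1⟩ := ht
  have hX : 0 < ε / κ := by positivity
  have hκX : κ * (ε / κ) = ε := by field_simp
  have hεX : 2 * ε ≤ ε / κ := by rw [le_div_iff₀ hκ]; nlinarith
  have hmul : ∀ x : ℝ, 0 < x → x ≤ 2 → (x * b : ℂ) ∈ sector κ r₁ ∧ 0 < (x * b : ℂ).im := by
    intro x hx hx2
    have e1 : (x * b : ℂ).re = x * (ε / κ) := by simp [hb]
    have e2 : (x * b : ℂ).im = x * ε := by simp [hb]
    refine ⟨⟨by rw [e1]; positivity, ?_, by rw [e2]; positivity, ?_⟩, by rw [e2]; positivity⟩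
    · rw [e1]; nlinarith
    · rw [e1, e2]
      apply le_of_eq
      rw [← hκX]; field_simp
  have hu : b + t * (δ * b) = ((1 + t * δ : ℝ) : ℂ) * b := by push_cast; ring
  have htδ : t * δ ≤ 1 := by nlinarith
  have hx0 : 0 ≤ t * δ := by positivity
  obtain ⟨um, up⟩ := hmul (1 + t * δ) (by linarith) (by linarith)
  have hd2 := hδ2 (1 + t * δ) ⟨by linarith, by linarith⟩
  rw [← hu] at um up hd2
  set u := b + t * (δ * b) with hudef
  have nu := hn u um
  obtain ⟨g1, g2, g3, g4, -, -⟩ := sector_backward hκ (by linarith) hgood ha hr nu um up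
  have hl : b + (t - 1) * (δ * b) = ((1 + (t - 1) * δ : ℝ) : ℂ) * b := by push_cast; ring
  obtain ⟨lm, lp⟩ := hmul (1 + (t - 1) * δ) (by nlinarith) (by nlinarith)
  rw [← hl] at lm lp
  refine ⟨baseCurve_contDiffAt nu.analyticG, ?_⟩
  -- The velocity is a convex combination of two vectors plus a nonnegative multiple of a third. It
  -- suffices that each vector `v` of the three satisfies `0 < Im v ≤ Re v`.
  have hder := (baseCurve_hasDerivAt (t := t) nu.analyticG.differentiableAt).deriv
  rw [← hudef] at hder
  have hc0 := cutoff_nonneg t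
  have hc1 := cutoff_le_one t
  have hc2 := cutoff_deriv_nonneg t
  have hconv := mem_sector_convex (p := 1 - cutoff t) (q := cutoff t) g1 lm (by linarith) hc0
    (by ring) g4 lp
  rw [ofReal_sub, ofReal_one] at hconv
  refine ⟨hconv.1, hconv.2, ?_⟩
  -- the three vectors
  have hbm := (hmul 1 one_pos one_le_two).1
  rw [ofReal_one, one_mul] at hbm
  have hbn : ‖(deriv G u - 1) * b‖ ≤ ε / 10 := by
    rw [norm_mul]
    have h1 := norm_le_of_mem_sector hbm
    have h2 : ‖b‖ ≤ 2 * (ε / κ) := h1.trans (by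
      change (1 + κ) * (ε / κ) ≤ _; nlinarith)
    calc _ ≤ κ / 20 * (2 * (ε / κ)) := mul_le_mul nu.deriv_sub h2 (norm_nonneg _) (by positivity)
      _ = κ * (ε / κ) / 10 := by ring
      _ = ε / 10 := by rw [hκX]
  have b1 := abs_le.mp ((abs_re_le_norm _).trans hbn)
  have b2 := abs_le.mp ((abs_im_le_norm _).trans hbn)
  have hbre : b.re = ε / κ := rfl
  have hbim : b.im = ε := rfl
  have hAe : deriv G u * (δ * b) = (δ : ℂ) * (b + (deriv G u - 1) * b) := by ring
  have hA1 : 0 < (deriv G u * (δ * b)).im := by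
    rw [hAe, im_ofReal_mul, add_im, hbim]; apply mul_pos hδ; linarith
  have hA2 : (deriv G u * (δ * b)).im ≤ (deriv G u * (δ * b)).re := by
    rw [hAe, im_ofReal_mul, re_ofReal_mul, add_im, add_re, hbim, hbre]
    apply mul_le_mul_of_nonneg_left _ hδ.le; linarith
  have hBre : (δ * b : ℂ).re = δ * (ε / κ) := by rw [re_ofReal_mul]
  have hBim : (δ * b : ℂ).im = δ * ε := by rw [im_ofReal_mul]
  have hB1 : 0 < (δ * b : ℂ).im := by rw [hBim]; positivity
  have hB2 : (δ * b : ℂ).im ≤ (δ * b : ℂ).re := by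
    rw [hBim, hBre]; apply mul_le_mul_of_nonneg_left _ hδ.le; linarith
  have g5 := g2.push_im_le
  rw [nu.inv] at g5
  have g6 := le_abs_self (u - G u).im
  have hδε : δ * ε ≤ δ * (ε / κ) := mul_le_mul_of_nonneg_left (by linarith) hδ.le
  -- The third vector is the displacement `u - G u` less the velocity `δ b`. By the choice of `δ`
  -- the displacement wins in height, and it is mainly horizontal, with real part at least three
  -- times its imaginary part.
  have hC1 : 0 < (u - G u - δ * b).im := by rw [sub_im, hBim]; linarith
  have hC2 : (u - G u - δ * b).im ≤ (u - G u - δ * b).re := by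
    rw [sub_im _ (δ * b : ℂ), sub_re _ (δ * b : ℂ), hBim, hBre]
    have : 0 < δ * ε := by positivity
    linarith
  rw [hder, ← ofReal_one, ← ofReal_sub]
  simp only [add_im, add_re, im_ofReal_mul (1 - cutoff t), im_ofReal_mul (cutoff t),
    im_ofReal_mul (deriv cutoff t), re_ofReal_mul (1 - cutoff t), re_ofReal_mul (cutoff t),
    re_ofReal_mul (deriv cutoff t)]
  have hp : 0 ≤ 1 - cutoff t := by linarith
  constructor
  · have h3 := mul_nonneg hc2 hC1.le
    rcases hp.eq_or_lt with h | h
    · rw [← h, show cutoff t = 1 by linarith]; linarith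
    · have h1 := mul_pos h hA1
      have h2 := mul_nonneg hc0 hB1.le
      linarith
  · exact add_le_add (add_le_add (mul_le_mul_of_nonneg_left hA2 hp)
      (mul_le_mul_of_nonneg_left hB2 hc0)) (mul_le_mul_of_nonneg_left hC2 hc2)

/-- A family of smooth curves `σ i : (-∞, 1] → ℂ` in a thin sector, ending at height `ε`,
backward invariant under the maps `G i`, and converging to `0`. -/
structure HalfArc {ι : Type*} (s : ι → ι) (F G : ι → ℂ → ℂ) (κ r ε : ℝ) (σ : ι → ℝ → ℂ) :
    Prop where
  smooth : ∀ i, ∀ t ≤ 1, ContDiffAt ℝ ∞ (σ i) t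
  deriv_re : ∀ i, ∀ t ≤ 1, 0 < (deriv (σ i) t).re
  mem : ∀ i, ∀ t ≤ 1, σ i t ∈ sector κ r
  im_pos : ∀ i, ∀ t ≤ 1, 0 < (σ i t).im
  im_lt : ∀ i, ∀ t < 1, (σ i t).im < ε
  one : ∀ i, σ i 1 = ⟨ε / κ, ε⟩
  back : ∀ i, ∀ t ≤ 0, σ i t = G i (σ (s i) (t + 1))
  fwd : ∀ i, ∀ t ≤ 0, F i (σ i t) = σ (s i) (t + 1)
  exit : ∀ i, ∀ t ∈ Ioc (0 : ℝ) 1, ε < (F i (σ i t)).im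
  tendsto : ∀ i, Tendsto (fun t => (σ i t).re) atBot (𝓝 0)

/-- `deriv` takes the value `0` where the derivative does not exist, so a positive real part
certifies differentiability. -/
theorem Good.differentiableAt {F : ℂ → ℂ} {N : ℕ} {a : ℝ} {z : ℂ} (h : Good F N a z) :
    DifferentiableAt ℂ F z := by
  by_contra hd
  have := h.deriv_re
  rw [deriv_zero_of_not_differentiableAt hd] at this
  simp at this

theorem hasDerivAt_re_im {f : ℝ → ℂ} {f' : ℂ} {t : ℝ} (h : HasDerivAt f f' t) :
    HasDerivAt (fun t => (f t).re) f'.re t ∧ HasDerivAt (fun t => (f t).im) f'.im t :=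
  ⟨reCLM.hasFDerivAt.comp_hasDerivAt t h,
    imCLM.hasFDerivAt.comp_hasDerivAt t h⟩

theorem strictMonoOn_of_hasDerivAt_pos {f f' : ℝ → ℝ} {s : Set ℝ} (hs : Convex ℝ s)
    (h : ∀ t ∈ s, HasDerivAt f (f' t) t) (hpos : ∀ t ∈ s, 0 < f' t) : StrictMonoOn f s := by
  apply strictMonoOn_of_deriv_pos hs fun t ht => (h t ht).continuousAt.continuousWithinAt
  intro t ht
  rw [(h t (interior_subset ht)).deriv]
  exact hpos t (interior_subset ht)

/-- The half arc is the extension by pull back of the base curves from `G i b` to `b = ε / κ + i ε`.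
Sector, height and cone conditions hold on the base curves and are inherited by each pull back. All
curves end at the same point `b`, so that the curve of `i` can be continued by pulling back that of
`s i`. -/
theorem exists_halfArc {ι : Type*} [Finite ι] (s : ι → ι) {F G : ι → ℂ → ℂ} {κ r a : ℝ} {N : ℕ}
    (hκ : 0 < κ) (hκ1 : κ ≤ 1 / 2) (hr : 0 < r) (ha : 0 < a)
    (hgood : ∀ i, ∀ z ∈ sector (2 * κ) r, Good (F i) N a z) (hgerm : ∀ i, Germ (F i) (G i)) :
    ∃ ε₀ > 0, ∀ ε, 0 < ε → ε ≤ ε₀ → ∃ σ, HalfArc s F G κ r ε σ := by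
  obtain ⟨ρ, hρ, hnear⟩ := Metric.eventually_nhds_iff.mp (eventually_all.mpr fun i =>
    (hgerm i).eventually_near (show 0 < κ / 20 by positivity))
  simp only [dist_zero_right] at hnear
  set r₁ := min (r / 2) (ρ / 2) with hr₁
  have hr0 : 0 < r₁ := by positivity
  have hrr : r₁ ≤ r / 2 := min_le_left _ _
  have hrρ : r₁ ≤ ρ / 2 := min_le_right _ _
  have hn : ∀ i, ∀ z ∈ sector κ r₁, Near (F i) (G i) (κ / 20) z := fun i z hz => by
    refine hnear ?_ i
    have h1 := norm_le_of_mem_sector hz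
    have h2 := hz.2.1
    have h3 := hz.1
    nlinarith
  -- This bound gives `2 ε / κ < r₁`, so that the points `x b` with `1 ≤ x ≤ 2`, among which the
  -- segment at `b` is moved, lie in the small sector.
  refine ⟨κ * r₁ / 4, by positivity, fun ε hε hεε => ?_⟩
  set b : ℂ := ⟨ε / κ, ε⟩ with hb
  have hX : 0 < ε / κ := by positivity
  have hXr : 2 * (ε / κ) < r₁ := by
    have : ε / κ ≤ r₁ / 4 := by rw [div_le_iff₀ hκ]; linarith
    linarith
  have hκX : κ * (ε / κ) = ε := by field_simp
  have hback := fun i z (hz : z ∈ sector κ r₁) (him : 0 < z.im) =>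
    sector_backward hκ (by linarith) (hgood i) ha hrr (hn i z hz) hz him
  have hbx : ∀ x ∈ Icc (1 : ℝ) 2, (x * b : ℂ) ∈ sector κ r₁ ∧ 0 < (x * b : ℂ).im := fun x hx => by
    have e1 : (x * b : ℂ).re = x * (ε / κ) := re_ofReal_mul _ _
    have e2 : (x * b : ℂ).im = x * ε := im_ofReal_mul _ _
    obtain ⟨h1, h2⟩ := hx
    refine ⟨⟨by rw [e1]; positivity, by rw [e1]; nlinarith, by rw [e2]; positivity, ?_⟩,
      by rw [e2]; positivity⟩
    rw [e1, e2]; nlinarith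
  have hbs : b ∈ sector κ r₁ := by simpa using (hbx 1 (by simp)).1
  -- the velocity
  obtain ⟨δ, hδ, hδ1, hδ2⟩ : ∃ δ : ℝ, 0 < δ ∧ δ ≤ 1 / 2 ∧ ∀ i, ∀ x ∈ Icc (1 : ℝ) 2,
      δ * (ε / κ) < ((x : ℂ) * b - G i (x * b)).im := by
    have h1 : ∀ i, ∃ m > 0, ∀ x ∈ Icc (1 : ℝ) 2, m ≤ ((x : ℂ) * b - G i (x * b)).im := by
      intro i
      have hcont : ContinuousOn (fun x : ℝ => ((x : ℂ) * b - G i (x * b)).im) (Icc 1 2) := by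
        intro x hx
        have h2 := (hn i _ (hbx x hx).1).analyticG.continuousAt
        have h3 : ContinuousAt (fun x : ℝ => (x : ℂ) * b) x := by fun_prop
        have h4 : ContinuousAt (fun x : ℝ => G i ((x : ℂ) * b)) x :=
          ContinuousAt.comp (f := fun x : ℝ => (x : ℂ) * b) h2 h3
        exact (continuous_im.continuousAt.comp (h3.sub h4)).continuousWithinAt
      obtain ⟨x₀, hx₀, hmin⟩ := isCompact_Icc.exists_isMinOn (nonempty_Icc.mpr one_le_two) hcont
      refine ⟨_, ?_, fun x hx => hmin hx⟩
      have := (hback i _ (hbx x₀ hx₀).1 (hbx x₀ hx₀).2).2.2.2.2.1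
      simp only [sub_im]; linarith
    choose m hm hmx using h1
    have h2 : ∀ᶠ δ in 𝓝[>] (0 : ℝ), ∀ i, δ * (ε / κ) < m i := by
      refine eventually_all.mpr fun i => ?_
      filter_upwards [Ioo_mem_nhdsGT (show 0 < m i / (ε / κ) from div_pos (hm i) hX)] with δ hδ
      exact (lt_div_iff₀ hX).mp hδ.2
    obtain ⟨δ, h3, h4⟩ := (h2.and (Ioo_mem_nhdsGT (show (0 : ℝ) < 1 / 2 by norm_num))).exists
    exact ⟨δ, h4.1, h4.2.le, fun i x hx => (h3 i).trans_le (hmx i x hx)⟩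
  set β : ι → ℝ → ℂ := fun i => baseCurve (G i) b δ with hβ
  have hbase := fun i t (ht : t ∈ Icc (0 : ℝ) 1) => baseCurve_props hκ hκ1 (hgood i) ha hrr (hn i)
    hε hXr hδ hδ1 (hδ2 i) ht
  have hmatch : ∀ i t, |t| < 1 / 3 → β i t = G i (β (s i) (t + 1)) := fun i t ht =>
    baseCurve_match ht
  have hβ1 : ∀ i, β i 1 = b := fun i => by
    simp [hβ, baseCurve, cutoff_eq_one (show (2 / 3 : ℝ) ≤ 1 by norm_num)]
  have hβ0 : ∀ i, β i 0 = G i b := fun i => by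
    simp [hβ, baseCurve, cutoff_eq_zero (show (0 : ℝ) ≤ 1 / 3 by norm_num)]
  have hβd : ∀ i, ∀ t ∈ Icc (0 : ℝ) 1, HasDerivAt (β i) (deriv (β i) t) t := fun i t ht =>
    ((hbase i t ht).1.differentiableAt (by simp)).hasDerivAt
  have hsub : sector κ r₁ ⊆ sector (2 * κ) r := sector_mono (by linarith) (by linarith)
  have hβim : ∀ i, ∀ t ∈ Ico (0 : ℝ) 1, (β i t).im < ε := fun i t ht => by
    have hm : StrictMonoOn (fun t => (β i t).im) (Icc 0 1) :=
      strictMonoOn_of_hasDerivAt_pos (convex_Icc _ _)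
        (fun t ht => (hasDerivAt_re_im (hβd i t ht)).2) fun t ht => (hbase i t ht).2.2.2.1
    have := hm ⟨ht.1, ht.2.le⟩ ⟨zero_le_one, le_rfl⟩ ht.2
    simpa [hβ1, hb] using this
  -- The image of the base curve under `F i` starts at `b`, at height `ε`, and rises: multiplication
  -- by `F'` keeps the imaginary part of the velocity positive.
  have hβexit : ∀ i, ∀ t ∈ Ioc (0 : ℝ) 1, ε < (F i (β i t)).im := fun i t ht => by
    have hm : StrictMonoOn (fun t => (F i (β i t)).im) (Icc 0 1) := by
      refine strictMonoOn_of_hasDerivAt_pos (f' := fun t =>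
        (deriv (F i) (β i t) * deriv (β i) t).im) (convex_Icc _ _) (fun t ht => ?_) fun t ht => ?_
      · have g := hgood i _ (hsub (hbase i t ht).2.1)
        exact (hasDerivAt_re_im (g.differentiableAt.hasDerivAt.comp t (hβd i t ht))).2
      · have g := hgood i _ (hsub (hbase i t ht).2.1)
        obtain ⟨-, -, -, h4, h5⟩ := hbase i t ht
        rw [mul_im]
        exact add_pos_of_pos_of_nonneg (mul_pos g.deriv_re h4)
          (mul_nonneg g.deriv_im (h4.le.trans h5))
    have := hm ⟨le_rfl, zero_le_one⟩ ⟨ht.1.le, ht.2⟩ ht.1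
    simpa only [hβ0, (hn i b hbs).inv] using this
  set σ := extCurve s G β with hσ
  -- the invariant properties
  have hinv : ∀ n : ℕ, ∀ i, ∀ t ≤ (1 : ℝ), -(n : ℝ) < t → ContDiffAt ℝ ∞ (σ i) t ∧
      σ i t ∈ sector κ r₁ ∧ 0 < (σ i t).im ∧ (t < 1 → (σ i t).im < ε) ∧
      Cone N (σ i t) (deriv (σ i) t) := by
    have hpos : ∀ i, ∀ t ∈ Ioc (0 : ℝ) 1, ContDiffAt ℝ ∞ (σ i) t ∧
      σ i t ∈ sector κ r₁ ∧ 0 < (σ i t).im ∧ (t < 1 → (σ i t).im < ε) ∧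
      Cone N (σ i t) (deriv (σ i) t) := by
      intro i t ht
      have he : σ i =ᶠ[𝓝 t] β i := by
        filter_upwards [lt_mem_nhds ht.1] with t' ht'
        exact extCurve_of_pos ht' i
      obtain ⟨h1, h2, h3, h4, h5⟩ := hbase i t ⟨ht.1.le, ht.2⟩
      rw [he.deriv_eq, he.self_of_nhds]
      exact ⟨h1.congr_of_eventuallyEq he, h2, h3, fun h => hβim i t ⟨ht.1.le, h⟩,
        Cone.of_im_le_re (hgood i _ (hsub h2)) h4 h5⟩
    -- Induction on the number of pull backs; the case `t ≤ 0` is inherited from the parameter `t +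
    -- 1` of the curve of `s i`.
    intro n
    induction n with
    | zero => exact fun i t ht1 ht0 => hpos i t ⟨by simpa using ht0, ht1⟩
    | succ n ih =>
      intro i t ht1 ht0
      rcases lt_or_ge 0 t with h0 | h0
      · exact hpos i t ⟨h0, ht1⟩
      push_cast at ht0
      obtain ⟨h1, h2, h3, h4, h5⟩ := ih (s i) (t + 1) (by linarith) (by linarith)
      have he : σ i =ᶠ[𝓝 t] fun t => G i (σ (s i) (t + 1)) :=
        extCurve_eventuallyEq_of_nonpos hmatch i h0
      have nr := hn i _ h2
      obtain ⟨g1, g2, g3, g4, g5, g6⟩ := hback i _ h2 h3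
      have hshift : HasDerivAt (fun t => σ (s i) (t + 1)) (deriv (σ (s i)) (t + 1)) t :=
        HasDerivAt.comp_add_const t 1 ((h1.differentiableAt (by simp)).hasDerivAt)
      -- Pulling back divides the velocity by `F'`, which is the form used by `Cone.backward`.
      have hd : deriv (σ i) t = deriv (σ (s i)) (t + 1) /
          deriv (F i) (G i (σ (s i) (t + 1))) := by
        have e1 : deriv (fun t => G i (σ (s i) (t + 1))) t = _ :=
          (nr.analyticG.differentiableAt.hasDerivAt.comp t hshift).deriv
        rw [he.deriv_eq, e1]
        have := nr.chain
        have h0 : deriv (F i) (G i (σ (s i) (t + 1))) ≠ 0 := left_ne_zero_of_mul_eq_one this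
        rw [eq_div_iff h0, mul_comm (deriv (G i) _), mul_assoc, mul_comm (deriv (G i) _), this,
          mul_one]
      have hc : ContDiffAt ℝ ∞ (fun t => G i (σ (s i) (t + 1))) t :=
        (nr.analyticG.contDiffAt.restrict_scalars ℝ).comp t
          (ContDiffAt.comp t (f := fun t : ℝ => t + 1) h1 (by fun_prop))
      rw [hd, he.self_of_nhds]
      refine ⟨hc.congr_of_eventuallyEq he, g1, g4, fun _ => ?_, ?_⟩
      · change (G i (σ (s i) (t + 1))).im < ε
        rcases (show t + 1 ≤ 1 by linarith).eq_or_lt with h | h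
        · rw [h] at g5 ⊢
          have : (σ (s i) 1).im = ε := by
            rw [hσ, extCurve_of_pos one_pos, hβ1]
          linarith
        · exact g5.trans (h4 h)
      · refine Cone.backward g2 ?_ ?_
        · rw [nr.inv]; exact hgood i _ (hsub h2)
        · rw [nr.inv]; exact h5
  have hinv' : ∀ i, ∀ t ≤ (1 : ℝ), ContDiffAt ℝ ∞ (σ i) t ∧
      σ i t ∈ sector κ r₁ ∧ 0 < (σ i t).im ∧ (t < 1 → (σ i t).im < ε) ∧
      Cone N (σ i t) (deriv (σ i) t) := fun i t ht => by
    obtain ⟨n, hn⟩ := exists_nat_gt (-t)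
    exact hinv n i t ht (by linarith)
  have hrec : ∀ i, ∀ t ≤ (0 : ℝ), σ i t = G i (σ (s i) (t + 1)) := fun i t ht =>
    extCurve_of_nonpos ht i
  refine ⟨σ, fun i t ht => (hinv' i t ht).1, fun i t ht => ?_, fun i t ht => ?_,
    fun i t ht => (hinv' i t ht).2.2.1, fun i t ht => (hinv' i t ht.le).2.2.2.1 ht, fun i => ?_,
    hrec, fun i t ht => ?_, fun i t ht => ?_, fun i => ?_⟩
  · obtain ⟨h1, h2, h3, h4, h5⟩ := hinv' i t ht
    exact h5.re_pos (hgood i _ (hsub h2))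
  · exact sector_mono le_rfl (by linarith) (hinv' i t ht).2.1
  · rw [hσ, extCurve_of_pos one_pos, hβ1]
  · rw [hrec i t ht]
    exact (hn i _ (hinv' (s i) (t + 1) (by linarith)).2.1).inv
  · rw [hσ, extCurve_of_pos ht.1]
    exact hβexit i t ht
  · rw [Metric.tendsto_nhds]
    intro e he
    have hpp : 0 < a * e ^ N := by positivity
    -- Convergence to `0`: if the real part is at least `e` at time `t`, each forward step adds at
    -- least `a e ^ N`. The sector has bounded width, so the number of such steps is bounded, and
    -- for `t` very negative the real part is below `e`.
    have hstep : ∀ n : ℕ, ∀ i, ∀ t c : ℝ, t + n ≤ 1 → e ≤ c → c ≤ (σ i t).re →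
        n * (a * e ^ N) + c ≤ (σ (s^[n] i) (t + n)).re := by
      intro n
      induction n with
      | zero => intro i t c _ _ h; simpa using h
      | succ n ih =>
        intro i t c ht hc h
        push_cast at ht
        have hn0 : (0 : ℝ) ≤ n := n.cast_nonneg
        obtain ⟨-, h2, h3, -, -⟩ := hinv' (s i) (t + 1) (by linarith)
        obtain ⟨-, -, g3, -, -, -⟩ := hback i _ h2 h3
        rw [← hrec i t (by linarith)] at g3
        have hp : e ^ N ≤ (σ i t).re ^ N := pow_le_pow_left₀ he.le (hc.trans h) N
        have hp' : a * e ^ N ≤ a * (σ i t).re ^ N := mul_le_mul_of_nonneg_left hp ha.le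
        have := ih (s i) (t + 1) (c + a * e ^ N) (by linarith) (by linarith) (by linarith)
        rw [show t + 1 + (n : ℝ) = t + (n + 1 : ℕ) by push_cast; ring] at this
        rw [Function.iterate_succ_apply]
        push_cast at this ⊢
        linarith
    obtain ⟨n, hnr⟩ := exists_nat_gt (r₁ / (a * e ^ N))
    rw [div_lt_iff₀ hpp] at hnr
    filter_upwards [eventually_le_atBot (1 - (n : ℝ))] with t ht
    have hn0 : (0 : ℝ) ≤ n := n.cast_nonneg
    have h1 := (hinv' i t (by linarith)).2.1.1
    rw [dist_zero_right, Real.norm_eq_abs, abs_of_pos h1]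
    by_contra hcon
    have h2 := hstep n i t e (by linarith) le_rfl (not_lt.mp hcon)
    have h3 := (hinv' (s^[n] i) (t + n) (by linarith)).2.1.2.1
    linarith

/-! ### Complexification of real analytic lifts -/

/-- The real Taylor coefficients, regarded as complex numbers, have the same norms. Their power
series therefore converges on a complex disc and restricts to `H` on the real line. -/
theorem exists_local_complexification {H : ℝ → ℝ} {x : ℝ} (hH : AnalyticAt ℝ H x) :
    ∃ r > 0, ∃ S : ℂ → ℂ, DifferentiableOn ℂ S (ball (x : ℂ) r) ∧
      ∀ y : ℝ, |y - x| < r → S y = H y := by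
  obtain ⟨p, ρ, hp⟩ := hH
  obtain ⟨r, hr0, hr⟩ := ENNReal.lt_iff_exists_nnreal_btwn.mp hp.r_pos
  have hr0' : 0 < r := by exact_mod_cast hr0
  set q := FormalMultilinearSeries.ofScalars ℂ (fun n => (p.coeff n : ℂ)) with hq
  obtain ⟨C, -, hC⟩ := p.norm_mul_pow_le_of_lt_radius (hr.trans_le hp.r_le)
  have hrad : (r : ENNReal) ≤ q.radius := by
    refine q.le_radius_of_bound C fun n => ?_
    rw [hq, FormalMultilinearSeries.ofScalars_norm, norm_real,
      ← FormalMultilinearSeries.norm_apply_eq_norm_coef]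
    exact hC n
  have hqs : HasFPowerSeriesOnBall q.sum q 0 q.radius :=
    q.hasFPowerSeriesOnBall (lt_of_lt_of_le (by exact_mod_cast hr0') hrad)
  refine ⟨r, hr0', fun z => q.sum (z - x), ?_, fun y hy => ?_⟩
  · intro z hz
    have h1 : DifferentiableAt ℂ q.sum (z - x) := by
      refine (hqs.analyticAt_of_mem ?_).differentiableAt
      rw [Metric.mem_eball, edist_zero_right]
      refine lt_of_lt_of_le ?_ hrad
      rw [mem_ball, dist_eq_norm] at hz
      rw [enorm_eq_nnnorm]
      exact_mod_cast hz
    exact (h1.comp z ((differentiableAt_id).sub_const (x : ℂ))).differentiableWithinAt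
  · have h1 := hp.hasSum (y := y - x) (by
      rw [Metric.mem_eball, edist_zero_right]
      refine lt_trans ?_ hr
      rw [enorm_eq_nnnorm]
      exact_mod_cast hy)
    rw [add_sub_cancel] at h1
    have h2 := (ofRealCLM.hasSum h1)
    simp only [ofRealCLM_apply] at h2
    have h3 : q.sum ((y : ℂ) - x) = ∑' n, q n fun _ => ((y : ℂ) - x) := rfl
    change q.sum ((y : ℂ) - x) = _
    rw [h3, ← h2.tsum_eq]
    congr 1
    ext n
    rw [hq, FormalMultilinearSeries.ofScalars_apply_eq,
      FormalMultilinearSeries.apply_eq_pow_smul_coeff]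
    simp only [smul_eq_mul]; push_cast; ring

/-- The open strip of half-width `R` around the real line. -/
def strip (R : ℝ) : Set ℂ := {z | |z.im| < R}

theorem isOpen_strip (R : ℝ) : IsOpen (strip R) :=
  isOpen_lt (continuous_abs.comp continuous_im) continuous_const

theorem strip_eq (R : ℝ) : strip R = imLm ⁻¹' Ioo (-R) R := by
  ext z; simp [strip, abs_lt]

theorem convex_strip (R : ℝ) : Convex ℝ (strip R) := by
  rw [strip_eq]; exact (convex_Ioo _ _).linear_preimage _

theorem strip_mono {R R' : ℝ} (h : R ≤ R') : strip R ⊆ strip R' := fun _ hz => lt_of_lt_of_le hz h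

theorem ofReal_mem_strip {R : ℝ} (hR : 0 < R) (x : ℝ) : (x : ℂ) ∈ strip R := by
  simpa [strip] using hR

theorem add_ofReal_mem_strip {R : ℝ} {z : ℂ} (x : ℝ) : z + x ∈ strip R ↔ z ∈ strip R := by
  simp [strip]

theorem conj_mem_strip {R : ℝ} {z : ℂ} : conj z ∈ strip R ↔ z ∈ strip R := by
  simp [strip]

/-- The identity theorem for a connected open set meeting the real line. -/
theorem eqOn_of_eqOn_real {f g : ℂ → ℂ} {U : Set ℂ} (hU : IsOpen U) (hc : IsPreconnected U)
    (hf : DifferentiableOn ℂ f U) (hg : DifferentiableOn ℂ g U) {x : ℝ} (hx : (x : ℂ) ∈ U)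
    (h : ∀ᶠ y : ℝ in 𝓝 x, f y = g y) : EqOn f g U := by
  refine (hf.analyticOnNhd hU).eqOn_of_preconnected_of_frequently_eq (hg.analyticOnNhd hU) hc hx ?_
  have h1 : Tendsto (fun y : ℝ => (y : ℂ)) (𝓝[≠] x) (𝓝[≠] (x : ℂ)) := by
    refine tendsto_nhdsWithin_of_tendsto_nhds_of_eventually_within _
      ((continuous_ofReal.tendsto x).mono_left nhdsWithin_le_nhds) ?_
    filter_upwards [self_mem_nhdsWithin] with y hy
    simpa using hy
  exact h1.frequently (h.filter_mono nhdsWithin_le_nhds).frequently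

theorem eqOn_strip {f g : ℂ → ℂ} {R : ℝ} (hR : 0 < R) (hf : DifferentiableOn ℂ f (strip R))
    (hg : DifferentiableOn ℂ g (strip R)) (h : ∀ y : ℝ, f y = g y) : EqOn f g (strip R) :=
  eqOn_of_eqOn_real (isOpen_strip R) (convex_strip R).isPreconnected hf hg
    (ofReal_mem_strip hR 0) (Eventually.of_forall h)

/-- By periodicity only the compact interval `[0, 1]` matters, and an open set contains a uniform
neighbourhood of it. -/
theorem exists_strip_subset {V : Set ℂ} (hV : IsOpen V) (hr : ∀ x : ℝ, (x : ℂ) ∈ V)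
    (hp : ∀ z, ∀ n : ℤ, z ∈ V → z + n ∈ V) : ∃ R > 0, strip R ⊆ V := by
  have hK : IsCompact ((fun x : ℝ => (x : ℂ)) '' Icc 0 1) :=
    isCompact_Icc.image continuous_ofReal
  obtain ⟨R, hR, h⟩ := hK.exists_thickening_subset_open hV (by rintro _ ⟨x, -, rfl⟩; exact hr x)
  refine ⟨R, hR, fun z hz => ?_⟩
  have h1 : z - ⌊z.re⌋ ∈ V := by
    apply h
    rw [mem_thickening_iff]
    refine ⟨_, ⟨Int.fract z.re, ⟨Int.fract_nonneg _, (Int.fract_lt_one _).le⟩, rfl⟩, ?_⟩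
    rw [dist_eq_norm]
    have : z - ⌊z.re⌋ - (Int.fract z.re : ℝ) = (z.im : ℂ) * I := by
      apply Complex.ext <;> simp
    rw [this]; simpa [strip] using hz
  simpa using hp _ ⌊z.re⌋ h1

/-- Local extensions on discs with real centres agree on overlaps by the identity theorem. Radii and
extensions are chosen on a fundamental interval and transported by translation, so that the union of
the discs is periodic and contains a strip. -/
theorem exists_complexification {H : ℝ → ℝ} {d : ℕ} (hH : ∀ x, AnalyticAt ℝ H x)
    (hd : ∀ x, H (x + 1) = H x + d) :
    ∃ R > 0, ∃ f : ℂ → ℂ, DifferentiableOn ℂ f (strip R) ∧ ∀ x : ℝ, f x = H x := by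
  choose r hr S hS hSr using fun x => exists_local_complexification (hH x)
  -- periodic families of discs and local extensions
  set ρ : ℝ → ℝ := fun x => r (Int.fract x) with hρ
  set T : ℝ → ℂ → ℂ := fun x z => S (Int.fract x) (z - ⌊x⌋) + d * ⌊x⌋ with hT
  have hHn : ∀ (n : ℤ) x, H (x + n) = H x + d * n := by
    intro n
    induction n with
    | zero => simp
    | succ n ih => intro x; push_cast; rw [← add_assoc, hd]; have := ih x; push_cast at this; linarith
    | pred n ih =>
      intro x
      have h1 := ih x
      have h2 := hd (x + (-(n : ℤ) - 1 : ℤ))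
      push_cast at *
      rw [show x + (-(n : ℝ) - 1) + 1 = x + -n by ring] at h2
      linarith
  have hball : ∀ (x : ℝ) (z : ℂ), z ∈ ball (x : ℂ) (ρ x) ↔
      z - ⌊x⌋ ∈ ball ((Int.fract x : ℝ) : ℂ) (r (Int.fract x)) := by
    intro x z
    simp only [mem_ball, dist_eq_norm, hρ, Int.fract]
    push_cast
    rw [show z - (⌊x⌋ : ℂ) - (x - ⌊x⌋) = z - x by ring]
  have hTd : ∀ x : ℝ, DifferentiableOn ℂ (T x) (ball (x : ℂ) (ρ x)) := fun x =>
    ((hS (Int.fract x)).comp (differentiableOn_id.sub_const _)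
      fun z hz => (hball x z).mp hz).add_const _
  have hTr : ∀ x y : ℝ, |y - x| < ρ x → T x y = H y := by
    intro x y hy
    have h1 := hSr (Int.fract x) (y - ⌊x⌋) (by
      simp only [hρ] at hy
      rw [Int.fract] at hy ⊢
      rwa [show y - (⌊x⌋ : ℝ) - (x - ⌊x⌋) = y - x by ring])
    have h2 := hHn ⌊x⌋ (y - ⌊x⌋)
    rw [sub_add_cancel] at h2
    simp only [hT]
    push_cast at h1
    rw [h1, h2]; push_cast; ring
  have hagree : ∀ (x x' : ℝ) (z : ℂ), z ∈ ball (x : ℂ) (ρ x) → z ∈ ball (x' : ℂ) (ρ x') → T x z = T x' z := by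
    intro x x' z hz hz'
    -- The centres being real, the discs that contain `z` also contain its real part. A nonempty
    -- overlap is thus a convex set that meets the real line.
    have hre : ∀ (y ρ : ℝ), z ∈ ball (y : ℂ) ρ → ((z.re : ℝ) : ℂ) ∈ ball (y : ℂ) ρ := by
      intro y ρ h
      rw [mem_ball, dist_eq_norm] at h ⊢
      refine lt_of_le_of_lt ?_ h
      rw [← ofReal_sub, norm_real]
      simpa using abs_re_le_norm (z - y)
    have hU : IsOpen (ball (x : ℂ) (ρ x) ∩ ball (x' : ℂ) (ρ x')) := isOpen_ball.inter isOpen_ball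
    refine eqOn_of_eqOn_real hU ((convex_ball _ _).inter (convex_ball _ _)).isPreconnected
      ((hTd x).mono inter_subset_left) ((hTd x').mono inter_subset_right)
      (x := z.re) ⟨hre _ _ hz, hre _ _ hz'⟩ ?_ ⟨hz, hz'⟩
    have hnhds := continuous_ofReal.continuousAt.preimage_mem_nhds
      (hU.mem_nhds ⟨hre _ _ hz, hre _ _ hz'⟩)
    filter_upwards [hnhds] with y hy
    have e : ∀ x ρ : ℝ, (y : ℂ) ∈ ball (x : ℂ) ρ → |y - x| < ρ := fun x ρ h => by
      rw [mem_ball, dist_eq_norm, ← ofReal_sub, norm_real] at h; exact h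
    rw [hTr x y (e _ _ hy.1), hTr x' y (e _ _ hy.2)]
  obtain ⟨R, hR, hsub⟩ := exists_strip_subset (V := ⋃ x : ℝ, ball (x : ℂ) (ρ x))
    (isOpen_iUnion fun _ => isOpen_ball)
    (fun x => mem_iUnion.mpr ⟨x, mem_ball_self (hr _)⟩) (fun z n hz => by
      obtain ⟨x, hx⟩ := mem_iUnion.mp hz
      refine mem_iUnion.mpr ⟨x + n, ?_⟩
      simp only [hρ, Int.fract_add_intCast, mem_ball, dist_eq_norm] at hx ⊢
      push_cast
      rwa [add_sub_add_right_eq_sub])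
  choose c hc using fun z (hz : z ∈ strip R) => mem_iUnion.mp (hsub hz)
  classical
  set f : ℂ → ℂ := fun z => if hz : z ∈ strip R then T (c z hz) z else 0 with hf
  have hfT : ∀ (x : ℝ) (z : ℂ), z ∈ strip R → z ∈ ball (x : ℂ) (ρ x) → f z = T x z := by
    intro x z hz hx
    simp only [hf, dif_pos hz]
    exact hagree _ _ _ (hc z hz) hx
  refine ⟨R, hR, f, fun z hz => ?_, fun x => ?_⟩
  · have h1 := (hTd (c z hz)).differentiableAt (isOpen_ball.mem_nhds (hc z hz))
    refine (h1.congr_of_eventuallyEq ?_).differentiableWithinAt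
    filter_upwards [isOpen_ball.mem_nhds (hc z hz), (isOpen_strip R).mem_nhds hz] with w h2 h3
    exact hfT _ _ h3 h2
  · rw [hfT x x (ofReal_mem_strip hR x) (mem_ball_self (hr _)), hTr x x (by simpa using hr _)]

/-! ### Strip maps and their inverses -/

section

/-- The holomorphic extension `f` to a strip of a lift of degree `d` of a circle covering, with the
real part of the derivative bounded below by `c`. -/
structure StripMap (d : ℕ) (R c : ℝ) (f : ℂ → ℂ) : Prop where
  R_pos : 0 < R
  c_pos : 0 < c
  differentiableOn : DifferentiableOn ℂ f (strip R)
  translate : ∀ z ∈ strip R, f (z + 1) = f z + d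
  map_conj : ∀ z ∈ strip R, f (conj z) = conj (f z)
  deriv_re : ∀ z ∈ strip R, c ≤ (deriv f z).re

theorem hasDerivAt_ofReal_of_complex {f : ℂ → ℂ} {H : ℝ → ℝ} (h : ∀ x : ℝ, f x = H x) {x : ℝ}
    (hf : DifferentiableAt ℂ f x) : HasDerivAt H (deriv f x).re x ∧ (deriv f x).im = 0 := by
  have h1 := hf.hasDerivAt.comp_ofReal
  have h2 : (fun y : ℝ => f y) = fun y : ℝ => ((H y : ℝ) : ℂ) := funext h
  rw [h2] at h1
  have h3 := reCLM.hasFDerivAt.comp_hasDerivAt x h1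
  have h4 := imCLM.hasFDerivAt.comp_hasDerivAt x h1
  refine ⟨h3, ?_⟩
  exact h4.unique ((hasDerivAt_const x (0 : ℝ)).congr_of_eventuallyEq
    (Eventually.of_forall fun y => by simp))

/-- The translation and conjugation rules hold on the real line and extend by the identity theorem.
The bound on `Re f'` holds on a periodic open neighbourhood of the real line, hence on a narrower
strip. -/
theorem exists_stripMap {H : ℝ → ℝ} {d : ℕ} {c : ℝ} (hc : 0 < c) (hH : ∀ x, AnalyticAt ℝ H x)
    (hd : ∀ x, H (x + 1) = H x + d) (hcH : ∀ x, c < deriv H x) :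
    ∃ R f, StripMap d R c f ∧ ∀ x : ℝ, f x = H x := by
  obtain ⟨R, hR, f, hf, hfr⟩ := exists_complexification hH hd
  have hfa : ∀ z ∈ strip R, DifferentiableAt ℂ f z := fun z hz =>
    hf.differentiableAt ((isOpen_strip R).mem_nhds hz)
  have htr : ∀ z ∈ strip R, f (z + 1) = f z + d := by
    have hone : ∀ z ∈ strip R, z + 1 ∈ strip R := fun z hz => by
      simpa using (add_ofReal_mem_strip 1).mpr hz
    refine eqOn_strip hR (hf.comp (differentiableOn_id.add_const 1) hone) (hf.add_const _) ?_
    intro y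
    have := hfr (y + 1)
    push_cast at this
    rw [this, hd, hfr]; push_cast; rfl
  have hconj : ∀ z ∈ strip R, f (conj z) = conj (f z) := by
    have : EqOn f (conj ∘ f ∘ conj) (strip R) := by
      refine eqOn_strip hR hf (fun z hz => ?_) fun y => ?_
      · have h1 := hfa (conj z) (conj_mem_strip.mpr hz)
        have := h1.conj_conj
        rw [conj_conj] at this
        exact this.differentiableWithinAt
      · simp [hfr]
    intro z hz
    rw [this hz]; simp
  have hderiv : DifferentiableOn ℂ (deriv f) (strip R) := hf.deriv (isOpen_strip R)
  have hdp : ∀ z ∈ strip R, deriv f (z + 1) = deriv f z := by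
    intro z hz
    rw [← deriv_comp_add_const]
    have : (fun x => f (x + 1)) =ᶠ[𝓝 z] fun x => f x + d := by
      filter_upwards [(isOpen_strip R).mem_nhds hz] with w hw using htr w hw
    rw [this.deriv_eq, deriv_add_const]
  have hdpn : ∀ n : ℤ, ∀ z ∈ strip R, deriv f (z + n) = deriv f z := by
    intro n
    induction n with
    | zero => simp
    | succ n ih =>
      intro z hz
      have h1 : z + n ∈ strip R := by simpa using (add_ofReal_mem_strip n).mpr hz
      have := hdp _ h1
      have h2 := ih z hz
      push_cast at *
      rw [← add_assoc, this, h2]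
    | pred n ih =>
      intro z hz
      have h1 : z + (-n - 1) ∈ strip R := by
        simpa using (add_ofReal_mem_strip (-n - 1)).mpr hz
      have := hdp _ h1
      have h2 := ih z hz
      push_cast at *
      rw [← this, ← h2]; congr 1; ring
  obtain ⟨R', hR', hsub⟩ := exists_strip_subset
    (V := {z | z ∈ strip R ∧ c < (deriv f z).re}) (by
      have : ContinuousOn (fun z => (deriv f z).re) (strip R) :=
        continuous_re.comp_continuousOn hderiv.continuousOn
      exact this.isOpen_inter_preimage (isOpen_strip R) isOpen_Ioi) (fun x => by
      refine ⟨ofReal_mem_strip hR x, ?_⟩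
      rw [← (hasDerivAt_ofReal_of_complex hfr (hfa x (ofReal_mem_strip hR x))).1.deriv]
      exact hcH x) (fun z n hz => by
      refine ⟨by simpa using (add_ofReal_mem_strip n).mpr hz.1, ?_⟩
      rw [hdpn n z hz.1]; exact hz.2)
  exact ⟨R', f, ⟨hR', hc, hf.mono fun z hz => (hsub hz).1, fun z hz => htr z (hsub hz).1,
    fun z hz => hconj z (hsub hz).1, fun z hz => (hsub hz).2.le⟩, hfr⟩

namespace StripMap

variable {d : ℕ} {R c : ℝ} {f : ℂ → ℂ}

theorem mono (hf : StripMap d R c f) {R' : ℝ} (h0 : 0 < R') (h : R' ≤ R) : StripMap d R' c f :=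
  ⟨h0, hf.c_pos, hf.differentiableOn.mono (strip_mono h), fun z hz => hf.translate z (strip_mono h hz),
    fun z hz => hf.map_conj z (strip_mono h hz), fun z hz => hf.deriv_re z (strip_mono h hz)⟩

theorem analyticAt (hf : StripMap d R c f) {z : ℂ} (hz : z ∈ strip R) : AnalyticAt ℂ f z :=
  hf.differentiableOn.analyticAt ((isOpen_strip R).mem_nhds hz)

theorem deriv_ne_zero (hf : StripMap d R c f) {z : ℂ} (hz : z ∈ strip R) : deriv f z ≠ 0 :=
  fun h => by
    have h1 := hf.deriv_re z hz
    have h2 := hf.c_pos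
    rw [h, zero_re] at h1
    linarith

theorem translate_int (hf : StripMap d R c f) (n : ℤ) :
    ∀ z ∈ strip R, f (z + n) = f z + d * n := by
  induction n with
  | zero => simp
  | succ n ih =>
    intro z hz
    have h1 : z + n ∈ strip R := by simpa using (add_ofReal_mem_strip n).mpr hz
    have := hf.translate _ h1
    have h2 := ih z hz
    push_cast at *
    rw [← add_assoc, this, h2]; ring
  | pred n ih =>
    intro z hz
    have h1 : z + (-n - 1) ∈ strip R := by
      simpa using (add_ofReal_mem_strip (-n - 1)).mpr hz
    have := hf.translate _ h1
    have h2 := ih z hz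
    push_cast at *
    rw [show z + (-(n : ℂ) - 1) + 1 = z + -n by ring, h2] at this
    linear_combination -this

theorem im_ofReal (hf : StripMap d R c f) (x : ℝ) : (f x).im = 0 := by
  have := hf.map_conj x (ofReal_mem_strip hf.R_pos x)
  rw [conj_ofReal] at this
  exact conj_eq_iff_im.mp this.symm

/-- Differentiate `t ↦ Re (conj e * f (w + t e))` with `e = z - w`: the derivative is `|e| ^ 2 Re
f'`. A positive lower bound for `Re f'` on a convex set thus yields injectivity together with a
Lipschitz bound for the inverse. -/
theorem expand (hf : StripMap d R c f) {z w : ℂ} (hz : z ∈ strip R) (hw : w ∈ strip R) :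
    c * ‖z - w‖ ^ 2 ≤ (conj (z - w) * (f z - f w)).re := by
  set e := z - w with he
  have hseg : ∀ t ∈ Icc (0 : ℝ) 1, w + t * e ∈ strip R := by
    intro t ht
    have := (convex_strip R) hw hz (sub_nonneg.mpr ht.2) ht.1 (by ring)
    simp only [real_smul] at this
    convert this using 1
    rw [he]; push_cast; ring
  have hd : ∀ t ∈ Icc (0 : ℝ) 1, HasDerivAt (fun t : ℝ => (conj e * f (w + t * e)).re)
      (‖e‖ ^ 2 * (deriv f (w + t * e)).re) t := by
    intro t ht
    have h1 : HasDerivAt (fun t : ℝ => w + t * e) e t := by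
      simpa using (((hasDerivAt_id t).ofReal_comp).mul_const e).const_add w
    have h2 := (hf.analyticAt (hseg t ht)).differentiableAt.hasDerivAt.comp t h1
    have h3 := reCLM.hasFDerivAt.comp_hasDerivAt t (h2.const_mul (conj e))
    refine h3.congr_deriv ?_
    rw [reCLM_apply, show conj e * (deriv f (w + t * e) * e) =
      (e * conj e) * deriv f (w + t * e) by ring, mul_conj, re_ofReal_mul, normSq_eq_norm_sq]
  have hmono : MonotoneOn (fun t : ℝ => (conj e * f (w + t * e)).re - c * ‖e‖ ^ 2 * t)
      (Icc 0 1) := by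
    have hd2 : ∀ t ∈ Icc (0 : ℝ) 1, HasDerivAt
        (fun t : ℝ => (conj e * f (w + t * e)).re - c * ‖e‖ ^ 2 * t)
        (‖e‖ ^ 2 * (deriv f (w + t * e)).re - c * ‖e‖ ^ 2) t := fun t ht => by
      refine ((hd t ht).sub ((hasDerivAt_id t).const_mul (c * ‖e‖ ^ 2))).congr_deriv ?_
      rw [mul_one]
    refine monotoneOn_of_deriv_nonneg (convex_Icc _ _)
      (fun t ht => (hd2 t ht).continuousAt.continuousWithinAt)
      (fun t ht => (hd2 t (interior_subset ht)).differentiableAt.differentiableWithinAt)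
      fun t ht => ?_
    rw [(hd2 t (interior_subset ht)).deriv]
    nlinarith [hf.deriv_re _ (hseg t (interior_subset ht)), sq_nonneg ‖e‖]
  have := hmono ⟨le_rfl, zero_le_one⟩ ⟨zero_le_one, le_rfl⟩ zero_le_one
  simp only [ofReal_zero, zero_mul, add_zero, mul_zero, sub_zero, ofReal_one, one_mul, mul_one]
    at this
  rw [show w + e = z by rw [he]; ring] at this
  rw [mul_sub, sub_re]
  linarith

theorem dist_le (hf : StripMap d R c f) {z w : ℂ} (hz : z ∈ strip R) (hw : w ∈ strip R) :
    c * ‖z - w‖ ≤ ‖f z - f w‖ := by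
  have h1 := hf.expand hz hw
  have h2 := (re_le_norm _).trans_eq (norm_mul (conj (z - w)) (f z - f w))
  rw [norm_conj] at h2
  rcases (norm_nonneg (z - w)).eq_or_lt with h | h
  · rw [← h]; simp
  · nlinarith

theorem injOn (hf : StripMap d R c f) : InjOn f (strip R) := by
  intro z hz w hw h
  have h1 := hf.dist_le hz hw
  rw [h, sub_self, norm_zero] at h1
  have := hf.c_pos
  have h2 : ‖z - w‖ ≤ 0 := by
    by_contra hcon
    nlinarith
  exact sub_eq_zero.mp (norm_le_zero_iff.mp h2)

/-- The case `w = Re z` of `expand`, where `f w` is real. It compares heights and shows that `f`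
preserves the two sides of the real line. -/
theorem im_mul (hf : StripMap d R c f) {z : ℂ} (hz : z ∈ strip R) :
    c * z.im ^ 2 ≤ z.im * (f z).im := by
  have h1 := hf.expand hz (ofReal_mem_strip hf.R_pos z.re)
  have h2 : z - z.re = (z.im : ℂ) * I := by apply Complex.ext <;> simp
  rw [h2] at h1
  have h3 : conj ((z.im : ℂ) * I) * (f z - f z.re) = (z.im : ℂ) * (-I * (f z - f z.re)) := by
    simp; ring
  rw [h3, re_ofReal_mul] at h1
  simpa [hf.im_ofReal] using h1

theorem im_pos_iff (hf : StripMap d R c f) {z : ℂ} (hz : z ∈ strip R) :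
    0 < (f z).im ↔ 0 < z.im := by
  have h1 := hf.im_mul hz
  have h2 := hf.c_pos
  constructor
  · intro h
    by_contra hcon
    rcases (not_lt.mp hcon).eq_or_lt with h3 | h3
    · have : z = (z.re : ℂ) := by apply Complex.ext <;> simp [h3]
      rw [this, hf.im_ofReal] at h
      exact lt_irrefl _ h
    · nlinarith [mul_pos_of_neg_of_neg h3 h3]
  · intro h
    by_contra hcon
    nlinarith [mul_pos h h, mul_pos h2 (mul_pos h h)]

theorem im_le (hf : StripMap d R c f) {z : ℂ} (hz : z ∈ strip R) : c * |z.im| ≤ |(f z).im| := by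
  have h1 := (hf.im_mul hz).trans (le_abs_self _)
  rw [abs_mul, ← sq_abs] at h1
  rcases (abs_nonneg z.im).eq_or_lt with h | h
  · rw [← h]; simp
  · nlinarith

/-- The image of a strip covers a strip. -/
theorem strip_subset_image (hf : StripMap d R c f) : strip (c * (R / 2)) ⊆ f '' strip R := by
  have hR := hf.R_pos
  have hc := hf.c_pos
  have hsub : strip (R / 2) ⊆ strip R := strip_mono (by linarith)
  have hopen : IsOpen (f '' strip (R / 2)) := by
    rw [isOpen_iff_mem_nhds]
    rintro _ ⟨z, hz, rfl⟩
    have h1 := (hf.analyticAt (hsub hz)).hasStrictDerivAt.map_nhds_eq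
      (hf.deriv_ne_zero (hsub hz))
    rw [← h1]
    exact image_mem_map ((isOpen_strip _).mem_nhds hz)
  -- The image of the half-width strip is open, and closed relative to the connected target strip:
  -- preimages of a convergent sequence are Cauchy by `dist_le`, and `im_le` keeps their limit
  -- inside the half-width strip.
  refine ((convex_strip (c * (R / 2))).isPreconnected.subset_of_closure_inter_subset hopen
    ⟨f 0, ?_, 0, by simp [strip, hR], rfl⟩ ?_).trans (image_mono hsub)
  · have := hf.im_ofReal 0
    rw [ofReal_zero] at this
    change |(f 0).im| < _
    rw [this, abs_zero]
    positivity
  · rintro w ⟨hw, hws⟩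
    obtain ⟨u, hu, hlim⟩ := mem_closure_iff_seq_limit.mp hw
    choose z hz hzu using hu
    have hcau : CauchySeq z := by
      rw [Metric.cauchySeq_iff]
      intro e he
      obtain ⟨N, hN⟩ := Metric.cauchySeq_iff.mp hlim.cauchySeq (c * e) (by positivity)
      refine ⟨N, fun m hm n hn => ?_⟩
      have h1 := hN m hm n hn
      have h2 := hf.dist_le (hsub (hz m)) (hsub (hz n))
      rw [hzu, hzu, ← dist_eq_norm, ← dist_eq_norm] at h2
      exact lt_of_mul_lt_mul_left (h2.trans_lt h1) hc.le
    obtain ⟨z₀, hz₀⟩ := cauchySeq_tendsto_of_complete hcau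
    have hle : |z₀.im| ≤ R / 2 :=
      le_of_tendsto ((continuous_abs.comp continuous_im).continuousAt.tendsto.comp hz₀)
        (Eventually.of_forall fun n => (hz n).le)
    have hz₀R : z₀ ∈ strip R := lt_of_le_of_lt hle (by linarith)
    have hfz : f z₀ = w := by
      refine tendsto_nhds_unique
        ((hf.analyticAt hz₀R).continuousAt.tendsto.comp hz₀) ?_
      simpa only [Function.comp_def, hzu] using hlim
    refine ⟨z₀, ?_, hfz⟩
    have h1 := hf.im_le hz₀R
    rw [hfz] at h1
    exact lt_of_mul_lt_mul_left (h1.trans_lt hws) hc.le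

end StripMap

/-- `G` is a right inverse on `strip R₁` of the map `f` on `strip R`. -/
structure StripInv (f G : ℂ → ℂ) (R R₁ : ℝ) : Prop where
  mem : ∀ w ∈ strip R₁, G w ∈ strip R
  right : ∀ w ∈ strip R₁, f (G w) = w

theorem StripMap.exists_inv {d : ℕ} {R c : ℝ} {f : ℂ → ℂ} (hf : StripMap d R c f) :
    ∃ G, StripInv f G R (c * (R / 2)) := by
  choose! G hG using hf.strip_subset_image
  exact ⟨G, fun w hw => (hG hw).1, fun w hw => (hG hw).2⟩

namespace StripInv

variable {d : ℕ} {R c R₁ : ℝ} {f G : ℂ → ℂ}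

theorem left (hG : StripInv f G R R₁) (hf : StripMap d R c f) {z : ℂ} (hz : z ∈ strip R)
    (hfz : f z ∈ strip R₁) : G (f z) = z :=
  hf.injOn (hG.mem _ hfz) hz (hG.right _ hfz)

theorem continuousAt (hG : StripInv f G R R₁) (hf : StripMap d R c f) {w : ℂ}
    (hw : w ∈ strip R₁) : ContinuousAt G w := by
  have hc := hf.c_pos
  rw [Metric.continuousAt_iff]
  intro e he
  obtain ⟨δ, hδ, hball⟩ := Metric.isOpen_iff.mp (isOpen_strip R₁) w hw
  refine ⟨min δ (c * e), by positivity, fun x hx => ?_⟩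
  have hxs := hball (mem_ball.mpr (hx.trans_le (min_le_left _ _)))
  have h1 := hf.dist_le (hG.mem x hxs) (hG.mem w hw)
  rw [hG.right x hxs, hG.right w hw, ← dist_eq_norm, ← dist_eq_norm] at h1
  exact lt_of_mul_lt_mul_left (h1.trans_lt (hx.trans_le (min_le_right _ _))) hc.le

theorem hasDerivAt (hG : StripInv f G R R₁) (hf : StripMap d R c f) {w : ℂ} (hw : w ∈ strip R₁) :
    HasDerivAt G (deriv f (G w))⁻¹ w := by
  refine HasDerivAt.of_local_left_inverse (hG.continuousAt hf hw)
    (hf.analyticAt (hG.mem w hw)).differentiableAt.hasDerivAt (hf.deriv_ne_zero (hG.mem w hw)) ?_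
  filter_upwards [(isOpen_strip R₁).mem_nhds hw] with x hx using hG.right x hx

theorem differentiableOn (hG : StripInv f G R R₁) (hf : StripMap d R c f) :
    DifferentiableOn ℂ G (strip R₁) := fun _ hw =>
  (hG.hasDerivAt hf hw).differentiableAt.differentiableWithinAt

theorem translate (hG : StripInv f G R R₁) (hf : StripMap d R c f) {w : ℂ} (hw : w ∈ strip R₁)
    (n : ℤ) : G (w + d * n) = G w + n := by
  have h1 : w + d * n ∈ strip R₁ := by
    simpa using (add_ofReal_mem_strip ((d : ℝ) * n)).mpr hw
  have h2 : G w + n ∈ strip R := by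
    simpa using (add_ofReal_mem_strip (n : ℝ)).mpr (hG.mem w hw)
  apply hf.injOn (hG.mem _ h1) h2
  rw [hG.right _ h1, hf.translate_int n _ (hG.mem w hw), hG.right w hw]

theorem map_conj (hG : StripInv f G R R₁) (hf : StripMap d R c f) {w : ℂ} (hw : w ∈ strip R₁) :
    G (conj w) = conj (G w) := by
  have h1 := conj_mem_strip.mpr hw
  apply hf.injOn (hG.mem _ h1) (conj_mem_strip.mpr (hG.mem w hw))
  rw [hG.right _ h1, hf.map_conj _ (hG.mem w hw), hG.right w hw]

theorem im_pos_iff (hG : StripInv f G R R₁) (hf : StripMap d R c f) {w : ℂ} (hw : w ∈ strip R₁) :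
    0 < (G w).im ↔ 0 < w.im := by
  rw [← hf.im_pos_iff (hG.mem w hw), hG.right w hw]

theorem im_le (hG : StripInv f G R R₁) (hf : StripMap d R c f) {w : ℂ} (hw : w ∈ strip R₁) :
    c * |(G w).im| ≤ |w.im| := by
  have := hf.im_le (hG.mem w hw)
  rwa [hG.right w hw] at this

end StripInv

end

/-! ### Annuli as quotients of strips, and coverings between them -/

section

/-- Used to replace a chart by an exponential: both are open quotient maps of the same strip with
the same fibres. -/
theorem exists_homeomorph_of_isOpenQuotientMap {X Y Z : Type*} [TopologicalSpace X]
    [TopologicalSpace Y] [TopologicalSpace Z] {p : X → Y} {q : X → Z} (hp : IsOpenQuotientMap p)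
    (hq : IsOpenQuotientMap q) (h : ∀ x x', p x = p x' ↔ q x = q x') :
    ∃ e : Y ≃ₜ Z, ∀ x, e (p x) = q x := by
  have e1 : ∀ x, q (Function.surjInv hp.surjective (p x)) = q x := fun x =>
    (h _ _).mp (Function.surjInv_eq hp.surjective _)
  have e2 : ∀ x, p (Function.surjInv hq.surjective (q x)) = p x := fun x =>
    (h _ _).mpr (Function.surjInv_eq hq.surjective _)
  refine ⟨⟨⟨fun y => q (Function.surjInv hp.surjective y),
    fun z => p (Function.surjInv hq.surjective z), fun y => ?_, fun z => ?_⟩, ?_, ?_⟩, e1⟩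
  · simp only [e2, Function.surjInv_eq hp.surjective]
  · simp only [e1, Function.surjInv_eq hq.surjective]
  · refine hp.isQuotientMap.continuous_iff.mpr ?_
    convert hq.continuous using 1
    exact funext e1
  · refine hq.isQuotientMap.continuous_iff.mpr ?_
    convert hp.continuous using 1
    exact funext e2

theorem isOpenQuotientMap_restrict {X Y : Type*} [TopologicalSpace X] [TopologicalSpace Y]
    {f : X → Y} {S : Set X} {T : Set Y} (hS : IsOpen S) (hc : ContinuousOn f S)
    (ho : ∀ U ⊆ S, IsOpen U → IsOpen (f '' U)) (hm : MapsTo f S T) (hsurj : SurjOn f S T) :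
    IsOpenQuotientMap (hm.restrict f S T) where
  surjective := by
    rintro ⟨y, hy⟩
    obtain ⟨x, hx, rfl⟩ := hsurj hy
    exact ⟨⟨x, hx⟩, rfl⟩
  continuous := hc.mapsToRestrict hm
  isOpenMap := by
    intro U hU
    obtain ⟨V, hV, rfl⟩ := isOpen_induced_iff.mp hU
    refine isOpen_induced_iff.mpr ⟨f '' (V ∩ S), ho _ inter_subset_right (hV.inter hS), ?_⟩
    ext ⟨y, hy⟩
    constructor
    · rintro ⟨x, ⟨hxV, hxS⟩, hxy⟩
      exact ⟨⟨x, hxS⟩, hxV, Subtype.ext hxy⟩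
    · rintro ⟨⟨x, hxS⟩, hxV, hxy⟩
      exact ⟨x, ⟨hxV, hxS⟩, congrArg Subtype.val hxy⟩

/-- `Θ` uniformizes its image by the strip of half-width `ε` modulo the translations by multiples
of `p`. -/
structure Chart (p : ℕ) (ε : ℝ) (Θ : ℂ → ℂ) : Prop where
  p_pos : 0 < p
  ε_pos : 0 < ε
  differentiableOn : DifferentiableOn ℂ Θ (strip ε)
  deriv_ne_zero : ∀ z ∈ strip ε, deriv Θ z ≠ 0
  eq_iff : ∀ z ∈ strip ε, ∀ w ∈ strip ε, Θ z = Θ w ↔ ∃ n : ℤ, z = w + p * n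

theorem isOpenMap_exp_mul {a : ℂ} (ha : a ≠ 0) : IsOpenMap fun z => exp (a * z) :=
  isOpenMap_exp.comp (Homeomorph.mulLeft₀ a ha).isOpenMap

theorem exp_eq_exp_div_iff {p : ℕ} (hp : 0 < p) (z w : ℂ) :
    exp (2 * Real.pi * I / p * z) = exp (2 * Real.pi * I / p * w) ↔ ∃ n : ℤ, z = w + p * n := by
  have hp' : (p : ℂ) ≠ 0 := by exact_mod_cast hp.ne'
  have h2 : (2 * Real.pi * I : ℂ) ≠ 0 := two_pi_I_ne_zero
  rw [exp_eq_exp_iff_exists_int]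
  refine exists_congr fun n => ?_
  constructor
  · intro h
    have h3 : (2 * Real.pi * I / p) * z = (2 * Real.pi * I / p) * (w + p * n) := by
      rw [h]; field_simp
    exact mul_left_cancel₀ (div_ne_zero h2 hp') h3
  · rintro rfl
    field_simp

theorem ofReal_add_ofReal_mul_I_re (a b : ℝ) : ((a : ℂ) + b * I).re = a := by simp

theorem ofReal_add_ofReal_mul_I_im (a b : ℝ) : ((a : ℂ) + b * I).im = b := by simp

namespace Chart

variable {p : ℕ} {ε : ℝ} {Θ : ℂ → ℂ}

theorem mono (hΘ : Chart p ε Θ) {ε' : ℝ} (h0 : 0 < ε') (h : ε' ≤ ε) : Chart p ε' Θ :=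
  ⟨hΘ.p_pos, h0, hΘ.differentiableOn.mono (strip_mono h),
    fun z hz => hΘ.deriv_ne_zero z (strip_mono h hz),
    fun z hz w hw => hΘ.eq_iff z (strip_mono h hz) w (strip_mono h hw)⟩

theorem analyticAt (hΘ : Chart p ε Θ) {z : ℂ} (hz : z ∈ strip ε) : AnalyticAt ℂ Θ z :=
  hΘ.differentiableOn.analyticAt ((isOpen_strip ε).mem_nhds hz)

theorem isOpen_image (hΘ : Chart p ε Θ) {U : Set ℂ} (hU : IsOpen U) (hs : U ⊆ strip ε) :
    IsOpen (Θ '' U) := by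
  rw [isOpen_iff_mem_nhds]
  rintro _ ⟨z, hz, rfl⟩
  rw [← (hΘ.analyticAt (hs hz)).hasStrictDerivAt.map_nhds_eq (hΘ.deriv_ne_zero z (hs hz))]
  exact image_mem_map (hU.mem_nhds hz)

theorem isOpenQuotientMap (hΘ : Chart p ε Θ) :
    IsOpenQuotientMap ((mapsTo_image Θ (strip ε)).restrict Θ (strip ε) (Θ '' strip ε)) :=
  isOpenQuotientMap_restrict (isOpen_strip ε) hΘ.differentiableOn.continuousOn
    (fun _ hs hU => hΘ.isOpen_image hU hs) _ (surjOn_image _ _)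

theorem add_mem_strip {z : ℂ} (hz : z ∈ strip ε) (n : ℤ) : z + p * n ∈ strip ε := by
  simpa using (add_ofReal_mem_strip ((p : ℝ) * n)).mpr hz

theorem map_add (hΘ : Chart p ε Θ) {z : ℂ} (hz : z ∈ strip ε) (n : ℤ) : Θ (z + p * n) = Θ z :=
  (hΘ.eq_iff _ (add_mem_strip hz n) _ hz).mpr ⟨n, rfl⟩

theorem exists_rep (hΘ : Chart p ε Θ) {z : ℂ} (hz : z ∈ strip ε) (P : ℝ) :
    ∃ z' ∈ strip ε, Θ z' = Θ z ∧ |z'.re - P| ≤ p / 2 ∧ z'.im = z.im ∧ ∃ n : ℤ, z = z' + p * n := by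
  have hp : (0 : ℝ) < p := by exact_mod_cast hΘ.p_pos
  set n := round ((z.re - P) / p) with hn
  have hm : z + p * (-n : ℤ) ∈ strip ε := add_mem_strip hz _
  refine ⟨z + p * (-n : ℤ), hm, hΘ.map_add hz _, ?_, by simp, n, by push_cast; ring⟩
  have h1 := abs_sub_round ((z.re - P) / p)
  rw [← hn] at h1
  have h2 : (z + p * (-n : ℤ)).re - P = p * ((z.re - P) / p - n) := by
    simp; field_simp; ring
  rw [h2, abs_mul, abs_of_pos hp]
  nlinarith

/-- The domain uniformized by a chart is an annulus. -/
theorem annular (hΘ : Chart p ε Θ) :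
    Nonempty ((Θ '' strip ε) ≃ₜ {z : ℂ | 1 < ‖z‖ ∧ ‖z‖ < 2}) := by
  have hp : (0 : ℝ) < p := by exact_mod_cast hΘ.p_pos
  have hε := hΘ.ε_pos
  obtain ⟨l, hl, hl2⟩ : ∃ l : ℝ, 0 < l ∧ Real.log 2 = l := ⟨_, Real.log_pos one_lt_two, rfl⟩
  have hpi := Real.pi_pos
  -- A real affine map onto which `exp` can be composed: the strip goes to `0 < Re < log 2`, and
  -- translation by `p` becomes translation by `2 π i`.
  set L : ℂ ≃ₜ ℂ :=
    { toFun := fun z => (l / 2 * (1 + z.im / ε) : ℝ) + (2 * Real.pi / p * z.re : ℝ) * I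
      invFun := fun w => (w.im * p / (2 * Real.pi) : ℝ) + (ε * (2 * w.re / l - 1) : ℝ) * I
      left_inv := fun z => by
        simp only [ofReal_add_ofReal_mul_I_re, ofReal_add_ofReal_mul_I_im]
        apply Complex.ext
        · rw [ofReal_add_ofReal_mul_I_re]; field_simp
        · rw [ofReal_add_ofReal_mul_I_im]; field_simp; ring
      right_inv := fun w => by
        simp only [ofReal_add_ofReal_mul_I_re, ofReal_add_ofReal_mul_I_im]
        apply Complex.ext
        · rw [ofReal_add_ofReal_mul_I_re]; field_simp; ring
        · rw [ofReal_add_ofReal_mul_I_im]; field_simp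
      continuous_toFun := by fun_prop
      continuous_invFun := by fun_prop } with hL
  have hLre : ∀ z, (L z).re = l / 2 * (1 + z.im / ε) := fun z =>
    ofReal_add_ofReal_mul_I_re _ _
  have hLe : ∀ z, L z = ((l / 2 * (1 + z.im / ε) : ℝ) : ℂ) +
    (2 * Real.pi / p * z.re : ℝ) * I := fun z => rfl
  have hnorm : ∀ z, ‖exp (L z)‖ = Real.exp (l / 2 * (1 + z.im / ε)) := fun z => by
    rw [norm_exp, hLre]
  have hiff : ∀ z, z ∈ strip ε ↔ exp (L z) ∈ {z : ℂ | 1 < ‖z‖ ∧ ‖z‖ < 2} := fun z => by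
    change |z.im| < ε ↔ 1 < ‖exp (L z)‖ ∧ ‖exp (L z)‖ < 2
    rw [hnorm, Real.one_lt_exp_iff, ← Real.lt_log_iff_exp_lt two_pos, hl2, abs_lt]
    have e1 : 0 < l / 2 * (1 + z.im / ε) ↔ -ε < z.im := by
      rw [mul_pos_iff_of_pos_left (by positivity), ← neg_lt_iff_pos_add', lt_div_iff₀ hε, neg_one_mul]
    have e2 : l / 2 * (1 + z.im / ε) < l ↔ z.im < ε := by
      rw [show l / 2 * (1 + z.im / ε) < l ↔
        l / 2 * (1 + z.im / ε) < l / 2 * 2 by ring_nf,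
        mul_lt_mul_iff_right₀ (by positivity), ← lt_sub_iff_add_lt', div_lt_iff₀ hε]
      norm_num
    rw [e1, e2]
  have hm : MapsTo (fun z => exp (L z)) (strip ε) {z : ℂ | 1 < ‖z‖ ∧ ‖z‖ < 2} := fun z hz =>
    (hiff z).mp hz
  have hq := isOpenQuotientMap_restrict (isOpen_strip ε)
    (f := fun z => exp (L z)) (continuous_exp.comp L.continuous).continuousOn
    (fun U _ hU => (isOpenMap_exp.comp L.isOpenMap) U hU) hm (fun w hw => by
      have hw0 : w ≠ 0 := fun h => by
        have := hw.1
        rw [h, norm_zero] at this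
        linarith
      have he : exp (L (L.symm (log w))) = w := by rw [L.apply_symm_apply, exp_log hw0]
      refine ⟨L.symm (log w), (hiff _).mpr (by rw [he]; exact hw), he⟩)
  obtain ⟨e, -⟩ := exists_homeomorph_of_isOpenQuotientMap hΘ.isOpenQuotientMap hq (by
    rintro ⟨z, hz⟩ ⟨w, hw⟩
    simp only [MapsTo.restrict, Subtype.map, Subtype.mk.injEq]
    rw [hΘ.eq_iff z hz w hw, exp_eq_exp_iff_exists_int]
    refine exists_congr fun n => ?_
    rw [hLe, hLe]
    have hpi' : (Real.pi : ℂ) ≠ 0 := by exact_mod_cast hpi.ne'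
    have hpc : (p : ℂ) ≠ 0 := by exact_mod_cast hp.ne'
    constructor
    · rintro rfl
      have h1 : (w + p * n).im = w.im := by simp
      have h2 : (w + p * n).re = w.re + p * n := by simp
      rw [h1, h2]; push_cast; field_simp; ring
    · intro h
      have h3 : (2 * Real.pi * I : ℂ) * n = ((0 : ℝ) : ℂ) + (2 * Real.pi * n : ℝ) * I := by
        push_cast; ring
      rw [mul_comm (n : ℂ), h3] at h
      have h1 := congrArg Complex.re h
      have h2 := congrArg Complex.im h
      rw [ofReal_add_ofReal_mul_I_re, add_re _ (_ + _), ofReal_add_ofReal_mul_I_re,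
        ofReal_add_ofReal_mul_I_re, add_zero] at h1
      rw [ofReal_add_ofReal_mul_I_im, add_im _ (_ + _), ofReal_add_ofReal_mul_I_im,
        ofReal_add_ofReal_mul_I_im] at h2
      apply Complex.ext
      · simp
        field_simp at h2
        linarith
      · simp
        field_simp at h1
        linarith)
  exact ⟨e⟩

/-- If `Θ'` and `Θ` uniformize `W'` and `W` with periods `p` and `1` then the map `Θ' z ↦ Θ z` is a
covering. -/
theorem isCoveringMap {Θ' : ℂ → ℂ} (hΘ' : Chart p ε Θ') (hΘ : Chart 1 ε Θ) {g : ℂ → ℂ}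
    (hg : ∀ z ∈ strip ε, g (Θ' z) = Θ z) (hm : MapsTo g (Θ' '' strip ε) (Θ '' strip ε)) :
    IsCoveringMap (hm.restrict g _ _) := by
  have hp := hΘ'.p_pos
  have hpc : (p : ℂ) ≠ 0 := by exact_mod_cast hp.ne'
  have h2 : (2 * Real.pi * I : ℂ) ≠ 0 := two_pi_I_ne_zero
  -- Exponentials with periods `1` and `p` serve as standard charts. Since `E₂ ^ p = E₁`, the map
  -- becomes the power `w ↦ w ^ p` over the round annulus `A`, a known covering.
  set E₁ : ℂ → ℂ := fun z => exp (2 * Real.pi * I / (1 : ℕ) * z) with hE₁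
  set E₂ : ℂ → ℂ := fun z => exp (2 * Real.pi * I / p * z) with hE₂
  set A : Set ℂ := E₁ '' strip ε with hA
  have hpow : ∀ z, E₂ z ^ p = E₁ z := fun z => by
    simp only [hE₁, hE₂]; rw [← exp_nat_mul]; congr 1; push_cast; field_simp
  have hm₂ : MapsTo E₂ (strip ε) ((fun w => w ^ p) ⁻¹' A) := fun z hz => by
    rw [mem_preimage, hpow]; exact mem_image_of_mem _ hz
  have hs₂ : SurjOn E₂ (strip ε) ((fun w => w ^ p) ⁻¹' A) := by
    rintro w ⟨z, hz, hzw⟩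
    have hw0 : w ≠ 0 := by
      rintro rfl
      simp only [zero_pow hp.ne'] at hzw
      exact exp_ne_zero _ hzw
    have he : E₂ (p / (2 * Real.pi * I) * log w) = w := by
      simp only [hE₂]
      rw [show 2 * Real.pi * I / p * (p / (2 * Real.pi * I) * log w) = log w by field_simp]
      exact exp_log hw0
    refine ⟨_, ?_, he⟩
    have h3 : E₁ (p / (2 * Real.pi * I) * log w) = E₁ z := by
      rw [← hpow, he, hzw]
    obtain ⟨n, hn⟩ := (exp_eq_exp_div_iff one_pos _ _).mp h3
    rw [hn]
    exact add_mem_strip hz n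
  have q₁ := isOpenQuotientMap_restrict (isOpen_strip ε) (f := E₁) (by fun_prop)
    (fun U _ hU => isOpenMap_exp_mul (div_ne_zero h2 (by simp)) U hU)
    (mapsTo_image E₁ (strip ε)) (surjOn_image _ _)
  have q₂ := isOpenQuotientMap_restrict (isOpen_strip ε) (f := E₂) (by fun_prop)
    (fun U _ hU => isOpenMap_exp_mul (div_ne_zero h2 hpc) U hU) hm₂ hs₂
  obtain ⟨e₁, he₁⟩ := exists_homeomorph_of_isOpenQuotientMap hΘ.isOpenQuotientMap q₁ (by
    rintro ⟨z, hz⟩ ⟨w, hw⟩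
    simp only [MapsTo.restrict, Subtype.map, Subtype.mk.injEq]
    rw [hΘ.eq_iff z hz w hw, ← exp_eq_exp_div_iff one_pos])
  obtain ⟨e₂, he₂⟩ := exists_homeomorph_of_isOpenQuotientMap hΘ'.isOpenQuotientMap q₂ (by
    rintro ⟨z, hz⟩ ⟨w, hw⟩
    simp only [MapsTo.restrict, Subtype.map, Subtype.mk.injEq]
    rw [hΘ'.eq_iff z hz w hw, ← exp_eq_exp_div_iff hp])
  have hcov : IsCoveringMap (A.restrictPreimage fun w : ℂ => w ^ p) :=
    ((isCoveringMapOn_npow p hpc).mono (by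
      rintro _ ⟨z, -, rfl⟩; exact exp_ne_zero _)).isCoveringMap_restrictPreimage
  have := (hcov.comp_homeomorph e₂).homeomorph_comp e₁.symm
  convert this using 1
  ext1 ⟨_, z, hz, rfl⟩
  have h3 := he₂ ⟨z, hz⟩
  have h4 := he₁ ⟨z, hz⟩
  simp only [Function.comp]
  rw [Homeomorph.eq_symm_apply]
  have e5 : hm.restrict g _ _ ⟨Θ' z, z, hz, rfl⟩ =
    (mapsTo_image Θ (strip ε)).restrict Θ (strip ε) (Θ '' strip ε) ⟨z, hz⟩ :=
      Subtype.ext (hg z hz)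
  rw [e5, h4]
  have e6 : e₂ ⟨Θ' z, z, hz, rfl⟩ = hm₂.restrict E₂ _ _ ⟨z, hz⟩ := h3
  rw [e6]
  exact Subtype.ext (hpow z).symm

/-- The fibre over `Θ u` consists of the classes of `u + j` modulo `p`, with representatives `0 ≤ j
< p`. -/
theorem ncard_fiber {Θ' : ℂ → ℂ} (hΘ' : Chart p ε Θ') (hΘ : Chart 1 ε Θ) {g : ℂ → ℂ}
    (hg : ∀ z ∈ strip ε, g (Θ' z) = Θ z) {w : ℂ} (hw : w ∈ Θ '' strip ε) :
    {z ∈ Θ' '' strip ε | g z = w}.ncard = p := by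
  obtain ⟨u, hu, rfl⟩ := hw
  have hp := hΘ'.p_pos
  have hadd : ∀ j : ℤ, u + j ∈ strip ε := fun j => by
    simpa using (add_ofReal_mem_strip (j : ℝ)).mpr hu
  have hset : {z ∈ Θ' '' strip ε | g z = Θ u} = (fun j : ℕ => Θ' (u + (j : ℤ))) '' Iio p := by
    ext z
    constructor
    · rintro ⟨⟨v, hv, rfl⟩, hz⟩
      rw [hg v hv, hΘ.eq_iff v hv u hu] at hz
      obtain ⟨n, hn⟩ := hz
      have hp0 : (0 : ℤ) < p := by exact_mod_cast hp
      have h0 := Int.emod_nonneg n hp0.ne'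
      obtain ⟨j, hj⟩ := Int.eq_ofNat_of_zero_le h0
      refine ⟨j, ?_, ?_⟩
      · have := Int.emod_lt_of_pos n hp0
        rw [hj] at this
        exact_mod_cast this
      · simp only
        rw [hΘ'.eq_iff _ (hadd _) v hv]
        refine ⟨-(n / p), ?_⟩
        rw [hn, ← hj]
        have := Int.mul_ediv_add_emod n p
        have h3 : (n : ℂ) = (p : ℂ) * ((n / p : ℤ) : ℂ) + ((n % p : ℤ) : ℂ) := by exact_mod_cast this.symm
        push_cast
        rw [h3]; ring
    · rintro ⟨j, hj, rfl⟩
      refine ⟨⟨_, hadd j, rfl⟩, ?_⟩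
      simp only
      rw [hg _ (hadd j), hΘ.eq_iff _ (hadd j) u hu]
      exact ⟨j, by push_cast; ring⟩
  rw [hset, InjOn.ncard_image, ← Finset.coe_Iio, ncard_coe_finset, Nat.card_Iio]
  intro j hj k hk hjk
  simp only at hjk
  rw [hΘ'.eq_iff _ (hadd _) _ (hadd _)] at hjk
  obtain ⟨n, hn⟩ := hjk
  rw [add_assoc, add_right_inj] at hn
  have hn' : (j : ℤ) = k + p * n := by exact_mod_cast hn
  have hj' : (j : ℤ) < p := by exact_mod_cast hj
  have hk' : (k : ℤ) < p := by exact_mod_cast hk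
  have : n = 0 := by
    have hp0 : (0 : ℤ) < p := by exact_mod_cast hp
    by_contra hne
    rcases lt_or_gt_of_ne hne with h | h <;> nlinarith
  rw [this, mul_zero, add_zero] at hn'
  exact_mod_cast hn'

end Chart

end

/-! ### Graphs of arcs and the regions that they bound -/

section

/-- `f` is the function whose graph over `(-X, X)` is an arc below the line of height `ε`; it takes
the value `ε` outside this interval. -/
structure IsArcGraph (X ε : ℝ) (f : ℝ → ℝ) : Prop where
  X_pos : 0 < X
  X_le : X ≤ 1 / 4
  continuous : Continuous f
  eq_of_le : ∀ x, X ≤ |x| → f x = ε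
  lt_of_lt : ∀ x, |x| < X → f x < ε
  nonneg : ∀ x, 0 ≤ f x

/-- The open arc, the part of the graph below the height `ε`, based at `Q`. -/
def openArc (X Q : ℝ) (f : ℝ → ℝ) : Set ℂ := {z | |z.re - Q| < X ∧ z.im = f (z.re - Q)}

/-- The region between the arc and the line of height `ε`. -/
def upperRegion (X ε Q : ℝ) (f : ℝ → ℝ) : Set ℂ :=
  {z | |z.re - Q| < X ∧ f (z.re - Q) < z.im ∧ z.im < ε}

/-- The region below the arc, over an interval containing a fundamental interval of the translation
by `p`. -/
def lowerRegion (p : ℕ) (ε Q : ℝ) (f : ℝ → ℝ) : Set ℂ :=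
  {z | |z.re - Q| < p - 1 / 4 ∧ -ε < z.im ∧ z.im < f (z.re - Q)}

theorem isConnected_between {Q a : ℝ} (ha : 0 < a) {lo hi : ℝ → ℝ} (hlo : Continuous lo)
    (hhi : Continuous hi) (h : ∀ x, |x - Q| < a → lo x < hi x) :
    IsConnected {z : ℂ | |z.re - Q| < a ∧ lo z.re < z.im ∧ z.im < hi z.re} := by
  have h1 : IsConnected (Ioo (Q - a) (Q + a) ×ˢ Ioo (0 : ℝ) 1) :=
    (isConnected_Ioo (by linarith)).prod (isConnected_Ioo one_pos)
  have h2 := h1.image (fun q : ℝ × ℝ => ((q.1 : ℝ) : ℂ) +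
    ((1 - q.2) * lo q.1 + q.2 * hi q.1 : ℝ) * I) (by fun_prop)
  convert h2 using 1
  ext z
  have habs : |z.re - Q| < a ↔ z.re ∈ Ioo (Q - a) (Q + a) := by
    rw [abs_lt, mem_Ioo]; constructor <;> rintro ⟨_, _⟩ <;> constructor <;> linarith
  constructor
  · rintro ⟨h3, h4, h5⟩
    have h6 := h _ h3
    have h7 : 0 < hi z.re - lo z.re := by linarith
    refine ⟨(z.re, (z.im - lo z.re) / (hi z.re - lo z.re)), ⟨habs.mp h3, ?_, ?_⟩, ?_⟩
    · exact div_pos (by linarith) h7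
    · simp only; rw [div_lt_one h7]; linarith
    · apply Complex.ext
      · rw [ofReal_add_ofReal_mul_I_re]
      · rw [ofReal_add_ofReal_mul_I_im]; field_simp; ring
  · rintro ⟨⟨x, s⟩, ⟨hx, hs0, hs1⟩, rfl⟩
    simp only at hx hs0 hs1
    rw [mem_ofPred_eq, ofReal_add_ofReal_mul_I_re, ofReal_add_ofReal_mul_I_im]
    have h3 : |x - Q| < a := by
      rw [abs_lt]; constructor <;> linarith [hx.1, hx.2]
    have h4 := h x h3
    refine ⟨h3, ?_, ?_⟩ <;> nlinarith

variable {X ε : ℝ} {f : ℝ → ℝ}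

namespace IsArcGraph

theorem le (hf : IsArcGraph X ε f) (x : ℝ) : f x ≤ ε := by
  rcases lt_or_ge |x| X with h | h
  · exact (hf.lt_of_lt x h).le
  · exact (hf.eq_of_le x h).le

theorem isOpen_upperRegion (hf : IsArcGraph X ε f) (Q : ℝ) : IsOpen (upperRegion X ε Q f) := by
  have := hf.continuous
  have h1 : IsOpen {z : ℂ | |z.re - Q| < X} := isOpen_lt (by fun_prop) (by fun_prop)
  have h2 : IsOpen {z : ℂ | f (z.re - Q) < z.im} := isOpen_lt (by fun_prop) (by fun_prop)
  have h3 : IsOpen {z : ℂ | z.im < ε} := isOpen_lt (by fun_prop) (by fun_prop)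
  exact h1.inter (h2.inter h3)

theorem isOpen_lowerRegion (hf : IsArcGraph X ε f) (p : ℕ) (Q : ℝ) :
    IsOpen (lowerRegion p ε Q f) := by
  have := hf.continuous
  have h1 : IsOpen {z : ℂ | |z.re - Q| < p - 1 / 4} := isOpen_lt (by fun_prop) (by fun_prop)
  have h2 : IsOpen {z : ℂ | -ε < z.im} := isOpen_lt (by fun_prop) (by fun_prop)
  have h3 : IsOpen {z : ℂ | z.im < f (z.re - Q)} := isOpen_lt (by fun_prop) (by fun_prop)
  exact h1.inter (h2.inter h3)

theorem isConnected_upperRegion (hf : IsArcGraph X ε f) (Q : ℝ) :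
    IsConnected (upperRegion X ε Q f) := by
  have := hf.continuous
  exact isConnected_between (lo := fun x => f (x - Q)) (hi := fun _ => ε) hf.X_pos (by fun_prop)
    (by fun_prop) fun x hx => hf.lt_of_lt _ hx

theorem isConnected_lowerRegion (hf : IsArcGraph X ε f) (hε : 0 < ε) {p : ℕ} (hp : 0 < p) (Q : ℝ) :
    IsConnected (lowerRegion p ε Q f) := by
  have := hf.continuous
  have hp' : (1 : ℝ) ≤ p := by exact_mod_cast hp
  exact isConnected_between (lo := fun _ => -ε) (hi := fun x => f (x - Q)) (by linarith)
    (by fun_prop) (by fun_prop) fun x hx => by linarith [hf.nonneg (x - Q)]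

theorem upperRegion_subset (hf : IsArcGraph X ε f) (Q : ℝ) : upperRegion X ε Q f ⊆ strip ε := by
  rintro z ⟨-, h1, h2⟩
  have := hf.nonneg (z.re - Q)
  exact abs_lt.mpr ⟨by linarith, h2⟩

theorem lowerRegion_subset (hf : IsArcGraph X ε f) (p : ℕ) (Q : ℝ) :
    lowerRegion p ε Q f ⊆ strip ε := by
  rintro z ⟨-, h1, h2⟩
  have := hf.le (z.re - Q)
  change |z.im| < ε
  rw [abs_lt]
  constructor <;> linarith

theorem openArc_subset (hf : IsArcGraph X ε f) (Q : ℝ) : openArc X Q f ⊆ strip ε := by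
  rintro z ⟨h1, h2⟩
  have h3 := hf.nonneg (z.re - Q)
  have h4 := hf.lt_of_lt _ h1
  change |z.im| < ε
  rw [abs_lt]
  constructor <;> linarith

end IsArcGraph

theorem int_eq_zero_of_abs_lt {p : ℕ} {n : ℤ} (h : |(p : ℝ) * n| < p) : n = 0 := by
  by_contra hn
  have h1 : (1 : ℝ) ≤ |(n : ℝ)| := by exact_mod_cast Int.one_le_abs hn
  rw [abs_mul, abs_of_nonneg (Nat.cast_nonneg p)] at h
  have h2 : (0 : ℝ) ≤ p := Nat.cast_nonneg p
  nlinarith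

/-- In the strip the two sides are the sets below and above the graph. The graph function equals `ε`
off the arc, so everything away from the arc counts as below; the window of half-width `p - 1/4`
contains a representative of each class. -/
theorem Chart.divides {p : ℕ} {Θ : ℂ → ℂ} (hΘ : Chart p ε Θ) (hf : IsArcGraph X ε f) (Q : ℝ)
    {C : Set ℂ} (hC : C ∩ Θ '' strip ε = Θ '' openArc X Q f) :
    Divides C (Θ '' strip ε) (Θ '' lowerRegion p ε Q f) (Θ '' upperRegion X ε Q f) := by
  have hp : (1 : ℝ) ≤ p := by exact_mod_cast hΘ.p_pos
  have hX := hf.X_le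
  have hsl := hf.lowerRegion_subset p Q
  have hsu := hf.upperRegion_subset Q
  have hsa := hf.openArc_subset Q
  -- The half-widths `p - 1/4` and `X ≤ 1/4` add up to at most `p`, so a point of the lower window
  -- and a point over the arc are congruent only if they are equal.
  have key : ∀ z w : ℂ, ∀ n : ℤ, |z.re - Q| < p - 1 / 4 → |w.re - Q| < X → z = w + p * n →
      z = w := by
    intro z w n hz hw h
    have h1 : z.re = w.re + p * n := by rw [h]; simp
    have : n = 0 := by
      apply int_eq_zero_of_abs_lt (p := p)
      rw [abs_lt] at hz hw ⊢
      constructor <;> linarith [hz.1, hz.2, hw.1, hw.2]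
    rw [h, this]; simp
  refine ⟨hΘ.isOpen_image (hf.isOpen_lowerRegion p Q) hsl,
    hΘ.isOpen_image (hf.isOpen_upperRegion Q) hsu,
    (hf.isConnected_lowerRegion hΘ.ε_pos hΘ.p_pos Q).image _
      (hΘ.differentiableOn.continuousOn.mono hsl),
    (hf.isConnected_upperRegion Q).image _ (hΘ.differentiableOn.continuousOn.mono hsu), ?_, ?_⟩
  · rw [Set.disjoint_left]
    rintro _ ⟨z, hz, rfl⟩ ⟨w, hw, hwz⟩
    obtain ⟨n, hn⟩ := (hΘ.eq_iff z (hsl hz) w (hsu hw)).mp hwz.symm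
    have := key z w n hz.1 hw.1 hn
    rw [this] at hz
    linarith [hz.2.2, hw.2.1]
  · have hCW : Θ '' strip ε \ C = Θ '' strip ε \ (Θ '' openArc X Q f) := by
      rw [← hC]; ext; simp
    rw [hCW]
    apply subset_antisymm
    · rintro _ (⟨z, hz, rfl⟩ | ⟨z, hz, rfl⟩)
      · refine ⟨⟨z, hsl hz, rfl⟩, ?_⟩
        rintro ⟨w, hw, hwz⟩
        obtain ⟨n, hn⟩ := (hΘ.eq_iff z (hsl hz) w (hsa hw)).mp hwz.symm
        have := key z w n hz.1 hw.1 hn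
        rw [this] at hz
        linarith [hz.2.2, hw.2]
      · refine ⟨⟨z, hsu hz, rfl⟩, ?_⟩
        rintro ⟨w, hw, hwz⟩
        obtain ⟨n, hn⟩ := (hΘ.eq_iff z (hsu hz) w (hsa hw)).mp hwz.symm
        have := key z w n (by linarith [hz.1]) hw.1 hn
        rw [this] at hz
        linarith [hz.2.1, hw.2]
    · rintro _ ⟨⟨z, hz, rfl⟩, hzC⟩
      obtain ⟨z', hz', he, h1, -, -⟩ := hΘ.exists_rep hz Q
      rw [← he] at hzC ⊢
      have him : -ε < z'.im ∧ z'.im < ε := abs_lt.mp hz'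
      rcases lt_trichotomy z'.im (f (z'.re - Q)) with h | h | h
      · exact Or.inl ⟨z', ⟨by linarith, him.1, h⟩, rfl⟩
      · refine absurd ⟨z', ⟨?_, h⟩, rfl⟩ hzC
        by_contra hcon
        rw [hf.eq_of_le _ (not_lt.mp hcon)] at h
        linarith
      · refine Or.inr ⟨z', ⟨?_, h, him.2⟩, rfl⟩
        by_contra hcon
        rw [hf.eq_of_le _ (not_lt.mp hcon)] at h
        linarith

/-- Locally `k = F ∘ Θ⁻¹`, by the inverse function theorem. Every map that is defined through a
chart gets its holomorphy in this way. -/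
theorem differentiableAt_of_comp {Θ F k : ℂ → ℂ} {u : ℂ} (hΘ : AnalyticAt ℂ Θ u)
    (h0 : deriv Θ u ≠ 0) (hk : ∀ᶠ z in 𝓝 u, k (Θ z) = F z) (hF : DifferentiableAt ℂ F u) :
    DifferentiableAt ℂ k (Θ u) := by
  have hs := hΘ.hasStrictDerivAt
  set L := hs.localInverse Θ (deriv Θ u) u h0
  have hL : HasStrictDerivAt L (deriv Θ u)⁻¹ (Θ u) := hs.to_localInverse h0
  have hLu : L (Θ u) = u := (hs.hasStrictFDerivAt_equiv h0).localInverse_apply_image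
  have hr : ∀ᶠ y in 𝓝 (Θ u), Θ (L y) = y :=
    (hs.hasStrictFDerivAt_equiv h0).eventually_right_inverse
  have hLt : Tendsto L (𝓝 (Θ u)) (𝓝 u) := by
    have := hL.hasDerivAt.continuousAt.tendsto
    rwa [hLu] at this
  have hF' : DifferentiableAt ℂ F (L (Θ u)) := by rwa [hLu]
  refine (hF'.comp (Θ u) hL.hasDerivAt.differentiableAt).congr_of_eventuallyEq ?_
  filter_upwards [hr, hLt.eventually hk] with y h1 h2
  rw [Function.comp, ← h2, h1]

/-- The box of unit width around `Q`. -/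
def box (Q ε : ℝ) : Set ℂ := {z | |z.re - Q| < 1 / 2 ∧ |z.im| < ε}

theorem isOpen_box (Q ε : ℝ) : IsOpen (box Q ε) :=
  have h1 : IsOpen {z : ℂ | |z.re - Q| < 1 / 2} := isOpen_lt (by fun_prop) (by fun_prop)
  have h2 : IsOpen {z : ℂ | |z.im| < ε} := isOpen_lt (by fun_prop) (by fun_prop)
  h1.inter h2

theorem box_subset (Q ε : ℝ) : box Q ε ⊆ strip ε := fun _ h => h.2

theorem Chart.injOn_box {p : ℕ} {Θ : ℂ → ℂ} (hΘ : Chart p ε Θ) (Q : ℝ) : InjOn Θ (box Q ε) := by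
  intro z hz w hw h
  obtain ⟨n, hn⟩ := (hΘ.eq_iff z hz.2 w hw.2).mp h
  have hp : (1 : ℝ) ≤ p := by exact_mod_cast hΘ.p_pos
  have h1 : z.re = w.re + p * n := by rw [hn]; simp
  have h2 : n = 0 := by
    apply int_eq_zero_of_abs_lt (p := p)
    have hz1 := abs_lt.mp hz.1
    have hw1 := abs_lt.mp hw.1
    rw [abs_lt]
    constructor <;> linarith [hz1.1, hz1.2, hw1.1, hw1.2]
  rw [hn, h2]; simp

/-- The branch of the inverse of the map `Θ' z ↦ Θ z` on the image of a box. -/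
theorem Chart.exists_branch {p : ℕ} {Θ Θ' : ℂ → ℂ} (hΘ : Chart 1 ε Θ) (hΘ' : Chart p ε Θ') (Q : ℝ) :
    ∃ k : ℂ → ℂ, DifferentiableOn ℂ k (Θ '' box Q ε) ∧ ∀ z ∈ box Q ε, k (Θ z) = Θ' z := by
  have hk : ∀ z ∈ box Q ε, (Θ' ∘ Function.invFunOn Θ (box Q ε)) (Θ z) = Θ' z := fun z hz => by
    have h1 := Function.invFunOn_mem (f := Θ) (s := box Q ε) ⟨z, hz, rfl⟩
    have h2 := Function.invFunOn_eq (f := Θ) (s := box Q ε) ⟨z, hz, rfl⟩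
    rw [Function.comp, hΘ.injOn_box Q h1 hz h2]
  refine ⟨_, ?_, hk⟩
  rintro _ ⟨z, hz, rfl⟩
  refine (differentiableAt_of_comp (hΘ.analyticAt hz.2) (hΘ.deriv_ne_zero z hz.2) ?_
    (hΘ'.analyticAt hz.2).differentiableAt).differentiableWithinAt
  filter_upwards [(isOpen_box Q ε).mem_nhds hz] with w hw using hk w hw

theorem Chart.invOn_branch {Θ Θ' g k : ℂ → ℂ} {Q : ℝ} (hg : ∀ z ∈ strip ε, g (Θ' z) = Θ z)
    (hk : ∀ z ∈ box Q ε, k (Θ z) = Θ' z) {S : Set ℂ} (hS : S ⊆ box Q ε) :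
    BijOn g (Θ' '' S) (Θ '' S) ∧ InvOn k g (Θ' '' S) (Θ '' S) := by
  have h1 : InvOn k g (Θ' '' S) (Θ '' S) := by
    constructor
    · rintro _ ⟨z, hz, rfl⟩
      rw [hg z (hS hz).2, hk z (hS hz)]
    · rintro _ ⟨z, hz, rfl⟩
      rw [hk z (hS hz), hg z (hS hz).2]
  refine ⟨h1.bijOn ?_ ?_, h1⟩
  · rintro _ ⟨z, hz, rfl⟩
    exact ⟨z, hz, (hg z (hS hz).2).symm⟩
  · rintro _ ⟨z, hz, rfl⟩
    exact ⟨z, hz, (hk z (hS hz)).symm⟩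

theorem Chart.isBiholomorphic {p : ℕ} {Θ Θ' g : ℂ → ℂ} (hΘ : Chart 1 ε Θ) (hΘ' : Chart p ε Θ')
    (hg : ∀ z ∈ strip ε, g (Θ' z) = Θ z) (hgd : DifferentiableOn ℂ g (Θ' '' strip ε)) {Q : ℝ}
    {S : Set ℂ} (hS : S ⊆ box Q ε) : IsBiholomorphic g (Θ' '' S) (Θ '' S) := by
  obtain ⟨k, hkd, hk⟩ := hΘ.exists_branch hΘ' Q
  obtain ⟨h1, h2⟩ := invOn_branch hg hk hS
  exact ⟨h1, hgd.mono (image_mono (hS.trans (box_subset Q ε))), k, hkd.mono (image_mono hS), h2⟩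

theorem Chart.isDiffeo {p : ℕ} {Θ Θ' g : ℂ → ℂ} (hΘ : Chart 1 ε Θ) (hΘ' : Chart p ε Θ')
    (hg : ∀ z ∈ strip ε, g (Θ' z) = Θ z) (hgd : DifferentiableOn ℂ g (Θ' '' strip ε)) {Q : ℝ}
    {S : Set ℂ} (hS : S ⊆ box Q ε) : IsDiffeo g (Θ' '' S) (Θ '' S) := by
  obtain ⟨k, hkd, hk⟩ := hΘ.exists_branch hΘ' Q
  obtain ⟨h1, h2⟩ := invOn_branch hg hk hS
  have hsm : ∀ {f : ℂ → ℂ} {U : Set ℂ}, IsOpen U → DifferentiableOn ℂ f U → ContDiffOn ℝ ∞ f U :=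
    fun hU hd => (hd.contDiffOn hU).restrict_scalars ℝ
  refine ⟨h1, fun z hz => ?_, k, fun z hz => ?_, h2⟩
  · have hU := hΘ'.isOpen_image (isOpen_strip ε) subset_rfl
    exact ⟨_, hU, image_mono (hS.trans (box_subset Q ε)) hz, g, hsm hU hgd, fun _ _ => rfl⟩
  · have hU := hΘ.isOpen_image (isOpen_box Q ε) (box_subset Q ε)
    exact ⟨_, hU, image_mono hS hz, k, hsm hU hkd, fun _ _ => rfl⟩

end

/-! ### Lifts of circle maps and the structure of metric expansion -/

section

theorem E_eq_iff {x y : ℝ} : E x = E y ↔ ∃ n : ℤ, x = y + n := by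
  rw [E, E, Circle.exp_eq_exp]
  refine exists_congr fun n => ⟨fun h => ?_, fun h => by rw [h]; ring⟩
  have := Real.pi_pos
  have h2 : 2 * Real.pi * (x - (y + n)) = 0 := by linear_combination h
  rcases mul_eq_zero.mp h2 with h3 | h3
  · linarith
  · linarith

theorem E_surjective : Function.Surjective E := fun z => by
  have := Real.pi_pos
  refine ⟨arg z / (2 * Real.pi), ?_⟩
  rw [E, mul_div_cancel₀ _ (by positivity), Circle.exp_arg]

theorem coe_E (x : ℝ) : (E x : ℂ) = exp (2 * Real.pi * I * x) := by
  rw [E, Circle.coe_exp]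
  congr 1
  push_cast
  ring

namespace IsLift

variable {d e : ℕ} {h k φ : Circle → Circle} {H K Φ : ℝ → ℝ}

theorem hasDerivAt (hH : IsLift d h H) (x : ℝ) : HasDerivAt H (deriv H x) x :=
  (hH.analytic x).differentiableAt.hasDerivAt

theorem strictMono (hH : IsLift d h H) : StrictMono H := strictMono_of_deriv_pos hH.deriv_pos

theorem continuous (hH : IsLift d h H) : Continuous H :=
  continuous_iff_continuousAt.mpr fun x => (hH.analytic x).continuousAt

theorem translate_int (hH : IsLift d h H) (x : ℝ) (n : ℤ) : H (x + n) = H x + d * n := by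
  induction n using Int.induction_on with
  | zero => simp
  | succ n ih => push_cast at ih ⊢; rw [← add_assoc, hH.translate, ih]; ring
  | pred n ih =>
    have := hH.translate (x + (-n - 1))
    rw [show x + (-n - 1) + 1 = x + ((-n : ℤ) : ℝ) by push_cast; ring, ih] at this
    push_cast at this ⊢
    linarith

theorem deriv_translate_int (hH : IsLift d h H) (x : ℝ) (n : ℤ) :
    deriv H (x + n) = deriv H x := by
  have h1 : (fun y => H (y + n)) = fun y => H y + d * n := funext fun y => hH.translate_int y n
  rw [← deriv_comp_add_const, h1, deriv_add_const]

theorem deriv_analytic (hH : IsLift d h H) : AnalyticOnNhd ℝ (deriv H) univ :=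
  fun x _ => (hH.analytic x).deriv

protected theorem id : IsLift 1 id id where
  analytic _ := analyticAt_id
  deriv_pos x := by simp
  translate x := by simp
  lifts x := rfl

theorem comp (hK : IsLift e k K) (hH : IsLift d h H) : IsLift (e * d) (k ∘ h) (K ∘ H) where
  analytic x := (hK.analytic _).comp (hH.analytic x)
  deriv_pos x := by
    rw [((hK.hasDerivAt _).comp x (hH.hasDerivAt x)).deriv]
    exact mul_pos (hK.deriv_pos _) (hH.deriv_pos _)
  translate x := by
    have := hK.translate_int (H x) d
    simp only [Function.comp_apply, hH.translate]
    push_cast at this ⊢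
    exact this
  lifts x := by simp [hH.lifts, hK.lifts]

theorem iterate (hH : IsLift d h H) (s : ℕ) : IsLift (d ^ s) h^[s] H^[s] := by
  induction s with
  | zero => simpa using! IsLift.id
  | succ s ih => rw [pow_succ, Function.iterate_succ, Function.iterate_succ]; exact ih.comp hH

theorem D_eq (hH : IsLift d h H) (x : ℝ) : D h (E x) = deriv H x := by
  have hpi := Real.pi_pos
  have h1 : ∀ t : ℝ, h (E x * Circle.exp t) / h (E x) =
      Circle.exp (2 * Real.pi * (H (x + t / (2 * Real.pi)) - H x)) := fun t => by
    have : E x * Circle.exp t = E (x + t / (2 * Real.pi)) := by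
      rw [E, E, ← Circle.exp_add]
      congr 1
      field_simp
    rw [this, hH.lifts, hH.lifts, E, E, mul_sub, Circle.exp_sub]
  have h2 : HasDerivAt (fun t => 2 * Real.pi * (H (x + t / (2 * Real.pi)) - H x)) (deriv H x) 0 := by
    have ha : HasDerivAt (fun t : ℝ => x + t / (2 * Real.pi)) (1 / (2 * Real.pi)) 0 :=
      ((hasDerivAt_id (0 : ℝ)).div_const _).const_add x
    have hb := (((hH.hasDerivAt (x + 0 / (2 * Real.pi))).comp 0 ha).sub_const (H x)).const_mul
      (2 * Real.pi)
    refine hb.congr_deriv ?_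
    simp only [zero_div, add_zero]
    field_simp
  rw [← h2.deriv, D]
  apply EventuallyEq.deriv_eq
  have h3 : Tendsto (fun t => 2 * Real.pi * (H (x + t / (2 * Real.pi)) - H x)) (𝓝 0) (𝓝 0) := by
    have := h2.continuousAt.tendsto
    simpa using this
  -- For small `t` the angle lies in `(-π, π)`, where `arg` recovers it.
  filter_upwards [h3.eventually (Ioo_mem_nhds (neg_lt_zero.mpr hpi) hpi)] with t ht
  rw [h1, Circle.arg_exp ht.1 ht.2.le]

theorem D_comp (hK : IsLift e k K) (hH : IsLift d h H) (z : Circle) :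
    D (k ∘ h) z = D k (h z) * D h z := by
  obtain ⟨x, rfl⟩ := E_surjective z
  rw [(hK.comp hH).D_eq, hH.D_eq, hH.lifts, hK.D_eq]
  exact ((hK.hasDerivAt _).comp x (hH.hasDerivAt x)).deriv

theorem D_pos (hH : IsLift d h H) (z : Circle) : 0 < D h z := by
  obtain ⟨x, rfl⟩ := E_surjective z
  rw [hH.D_eq]
  exact hH.deriv_pos x

/-- In the chain rule for `k^[s] ∘ φ = φ ∘ h^[s]` at a fixed point, the factor `D φ p` appears on
both sides and cancels, so the multiplier is preserved. -/
theorem map_mem_Par {m : ℕ} (hφ : IsLift m φ Φ) (hH : IsLift d h H) (hK : IsLift e k K)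
    (hc : k ∘ φ = φ ∘ h) {p : Circle} (hp : p ∈ Par h) : φ p ∈ Par k := by
  obtain ⟨s, hs, h1, h2⟩ := hp
  have hcs : k^[s] ∘ φ = φ ∘ h^[s] :=
    ((show Function.Semiconj φ h k from fun x => (congrFun hc x).symm).iterate_right s).comp_eq.symm
  refine ⟨s, hs, by rw [← Function.comp_apply (f := k^[s]), hcs, Function.comp_apply, h1], ?_⟩
  have h3 := (hK.iterate s).D_comp hφ p
  rw [hcs, hφ.D_comp (hH.iterate s), h1, h2] at h3
  have := hφ.D_pos p
  exact mul_right_cancel₀ this.ne' (by linarith)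

theorem surjective (hΦ : IsLift 1 φ Φ) : Function.Surjective Φ := by
  refine hΦ.continuous.surjective ?_ ?_
  · refine hΦ.strictMono.monotone.tendsto_atTop_atTop fun b => ?_
    obtain ⟨n, hn⟩ := exists_int_gt (b - Φ 0)
    refine ⟨0 + n, ?_⟩
    rw [hΦ.translate_int]
    push_cast
    linarith
  · refine hΦ.strictMono.monotone.tendsto_atBot_atBot fun b => ?_
    obtain ⟨n, hn⟩ := exists_int_lt (b - Φ 0)
    refine ⟨0 + n, ?_⟩
    rw [hΦ.translate_int]
    push_cast
    linarith

theorem injective (hΦ : IsLift 1 φ Φ) : Function.Injective φ := by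
  intro z w hzw
  obtain ⟨x, rfl⟩ := E_surjective z
  obtain ⟨y, rfl⟩ := E_surjective w
  rw [hΦ.lifts, hΦ.lifts, E_eq_iff] at hzw
  obtain ⟨n, hn⟩ := hzw
  refine E_eq_iff.mpr ⟨n, hΦ.strictMono.injective ?_⟩
  rw [hn, hΦ.translate_int]
  simp

theorem exists_inverse (hΦ : IsLift 1 φ Φ) :
    ∃ ψ Ψ, IsLift 1 ψ Ψ ∧ (∀ z, ψ (φ z) = z) ∧ ∀ z, φ (ψ z) = z := by
  obtain ⟨Ψ, hΨ⟩ := hΦ.surjective.hasRightInverse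
  have hΨ' : ∀ x, Ψ (Φ x) = x := fun x => hΦ.strictMono.injective (hΨ (Φ x))
  have hsurj : Function.Surjective φ := fun z => by
    obtain ⟨y, rfl⟩ := E_surjective z
    exact ⟨E (Ψ y), by rw [hΦ.lifts, hΨ]⟩
  obtain ⟨ψ, hψ⟩ := hsurj.hasRightInverse
  have hψ' : ∀ z, ψ (φ z) = z := fun z => hΦ.injective (hψ (φ z))
  have ha : ∀ y, AnalyticAt ℝ Ψ y := fun y => by
    rw [← hΨ y, ← analyticAt_comp_iff_of_deriv_ne_zero (hΦ.analytic _) (hΦ.deriv_pos _).ne',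
      show Ψ ∘ Φ = id from funext hΨ']
    exact analyticAt_id
  refine ⟨ψ, Ψ, ⟨ha, fun y => ?_, fun y => ?_, fun y => ?_⟩, hψ', hψ⟩
  · have h1 := ((hΦ.hasDerivAt (Ψ y)).comp y (ha y).differentiableAt.hasDerivAt).deriv
    rw [show Φ ∘ Ψ = id from funext hΨ, deriv_id] at h1
    have h2 := hΦ.deriv_pos (Ψ y)
    exact pos_of_mul_pos_right (by rw [← h1]; exact one_pos) h2.le
  · apply hΦ.strictMono.injective
    rw [hΨ, Nat.cast_one, hΦ.translate, hΨ, Nat.cast_one]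
  · apply hΦ.injective
    rw [hψ, hΦ.lifts, hΨ]

end IsLift

/-- The properties of a metrically expanding lift. -/
structure Expanding (h : Circle → Circle) (H : ℝ → ℝ) : Prop where
  one_le : ∀ x, 1 ≤ deriv H x
  mem_Par_iff : ∀ x, E x ∈ Par h ↔ deriv H x = 1
  finite : (Par h).Finite

/-- Periodic points are zeros of the analytic functions `H^[s] x - x - m`, hence countable, so `H' >
1` on a dense set and `H' ≥ 1` everywhere. A product of such factors equals `1` only if each factor
does; thus `Par h` is the set where `H' = 1`, the zero set of a nonzero analytic function on a
compact circle, and is finite. -/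
theorem IsLift.expanding {d : ℕ} (hd : 2 ≤ d) {h : Circle → Circle} {H : ℝ → ℝ}
    (hH : IsLift d h H) (hM : ∀ z, z ∉ Par h → 1 < D h z) : Expanding h H := by
  have hcount : {x | E x ∈ Par h}.Countable := by
    have hsub : {x | E x ∈ Par h} ⊆ ⋃ (s : ℕ) (m : ℤ), {x | 0 < s ∧ H^[s] x - x - m = 0} := by
      rintro x ⟨s, hs, hx, -⟩
      rw [(hH.iterate s).lifts, E_eq_iff] at hx
      obtain ⟨m, hm⟩ := hx
      refine mem_iUnion₂.mpr ⟨s, m, hs, ?_⟩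
      rw [hm]; ring
    refine (countable_iUnion fun s => countable_iUnion fun m => ?_).mono hsub
    rcases Nat.eq_zero_or_pos s with rfl | hs
    · simp
    have hs' := hH.iterate s
    set f : ℝ → ℝ := fun x => H^[s] x - x - m with hf
    have hfa : AnalyticOnNhd ℝ f univ := fun x _ =>
      ((hs'.analytic x).sub analyticAt_id).sub analyticAt_const
    -- If the function vanished identically, the iterate would have degree `d ^ s = 1`, against `d ≥
    -- 2`.
    have hne : ∃ x, f x ≠ 0 := by
      by_contra! h0
      have h1 := h0 1
      have h2 := h0 0
      have h3 := hs'.translate 0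
      simp only [hf] at h1 h2
      rw [zero_add] at h3
      have h4 : ((d ^ s : ℕ) : ℝ) = 1 := by linarith
      have h5 : d ^ s = 1 := by exact_mod_cast h4
      have := Nat.one_lt_pow hs.ne' hd
      omega
    obtain ⟨x, hx⟩ := hne
    have h1 := hfa.preimage_zero_mem_codiscrete hx
    have h2 := (mem_codiscrete'.mp h1).2
    rw [preimage_compl, compl_compl] at h2
    have h3 : (f ⁻¹' {0}).Countable := by
      have : DiscreteTopology (f ⁻¹' {0}) := h2.to_subtype
      exact countable_coe_iff.mp (countable_of_Lindelof_of_discrete (X := f ⁻¹' {0}))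
    exact h3.mono fun x hx => hx.2
  have hone : ∀ x, 1 ≤ deriv H x := by
    have hcl : IsClosed {x | 1 ≤ deriv H x} :=
      isClosed_le continuous_const
        (continuous_iff_continuousAt.mpr fun x => (hH.deriv_analytic x trivial).continuousAt)
    have hdense := hcount.dense_compl ℝ
    have hsub : {x | E x ∈ Par h}ᶜ ⊆ {x | 1 ≤ deriv H x} := fun x hx => by
      have := hM (E x) hx
      rw [hH.D_eq] at this
      exact this.le
    intro x
    exact (hcl.closure_subset_iff.mpr hsub) (hdense x)
  have hiter : ∀ s x, 1 ≤ deriv H^[s] x := by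
    intro s
    induction s with
    | zero => intro x; simp
    | succ s ih =>
      intro x
      rw [Function.iterate_succ, (((hH.iterate s).hasDerivAt _).comp x (hH.hasDerivAt x)).deriv]
      nlinarith [ih (H x), hone x]
  have hiff : ∀ x, E x ∈ Par h ↔ deriv H x = 1 := by
    refine fun x => ⟨?_, fun h1 => ?_⟩
    · rintro ⟨s, hs, -, h2⟩
      obtain ⟨s, rfl⟩ := Nat.exists_eq_succ_of_ne_zero hs.ne'
      rw [(hH.iterate _).D_eq, Function.iterate_succ,
        (((hH.iterate s).hasDerivAt _).comp x (hH.hasDerivAt x)).deriv] at h2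
      nlinarith [hiter s (H x), hone x]
    · by_contra hx
      have := hM _ hx
      rw [hH.D_eq] at this
      linarith
  refine ⟨hone, hiff, ?_⟩
  -- By the mean value theorem on `[0, 1]` some value of `H'` is the degree `d`, which exceeds `1`.
  have hne : ∃ x, deriv H x - 1 ≠ 0 := by
    by_contra! h0
    obtain ⟨c, -, hc⟩ := exists_deriv_eq_slope H zero_lt_one hH.continuous.continuousOn
      fun x _ => (hH.analytic x).differentiableAt.differentiableWithinAt
    have h1 := hH.translate 0
    rw [zero_add] at h1
    rw [h1] at hc
    have h2 := h0 c
    have h3 : (2 : ℝ) ≤ d := by exact_mod_cast hd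
    simp at hc
    linarith
  obtain ⟨x, hx⟩ := hne
  have hfa : AnalyticOnNhd ℝ (fun x => deriv H x - 1) univ := fun x hx =>
    (hH.deriv_analytic x hx).sub analyticAt_const
  have h1 := hfa.preimage_zero_mem_codiscrete hx
  have h2 := (isCompact_Icc (a := (0 : ℝ)) (b := 1)).finite_sdiff_of_mem_codiscreteWithin
    (codiscreteWithin_mono (subset_univ _) h1)
  refine (h2.image E).subset fun p hp => ?_
  obtain ⟨y, rfl⟩ := E_surjective p
  have hy : E (Int.fract y) = E y := by
    rw [E_eq_iff]
    exact ⟨-⌊y⌋, by push_cast; rw [Int.fract]; ring⟩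
  refine ⟨Int.fract y, ⟨⟨Int.fract_nonneg y, (Int.fract_lt_one y).le⟩, ?_⟩, hy⟩
  rw [← hy] at hp
  simpa [sub_eq_zero] using (hiff _).mp hp

end

/-! ### Two-sided germs, and half arcs as graphs -/

section

/-- Conjugation of a map by the reflection in the imaginary axis. -/
def mirror (F : ℂ → ℂ) : ℂ → ℂ := fun z => -conj (F (-conj z))

/-- `F` and `G` are mutually inverse real germs at `0`, tangent to the identity and preserving the
upper half plane, and `F` is repelling along the real axis. -/
structure RealGerm (F G : ℂ → ℂ) : Prop extends Germ F G where
  F_zero : F 0 = 0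
  conj_F : ∀ᶠ z in 𝓝 (0 : ℂ), F (conj z) = conj (F z)
  conj_G : ∀ᶠ z in 𝓝 (0 : ℂ), G (conj z) = conj (G z)
  push_right : ∀ᶠ x : ℝ in 𝓝[>] 0, x < (F x).re
  push_left : ∀ᶠ x : ℝ in 𝓝[<] 0, (F x).re < x

/-- For a real germ, conjugation by `z ↦ -conj z` is conjugation by `z ↦ -z`; in particular it is
again holomorphic. -/
theorem mirror_eventuallyEq {F : ℂ → ℂ} (h : ∀ᶠ z in 𝓝 (0 : ℂ), F (conj z) = conj (F z)) :
    mirror F =ᶠ[𝓝 0] fun z => -F (-z) := by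
  have h1 : Tendsto (fun z : ℂ => -z) (𝓝 0) (𝓝 0) := by
    simpa using (continuous_neg (G := ℂ)).tendsto 0
  filter_upwards [h1.eventually h] with z hz
  rw [map_neg] at hz
  simp [mirror, hz]

theorem tendsto_neg_conj : Tendsto (fun z : ℂ => -conj z) (𝓝 0) (𝓝 0) := by
  have : Continuous fun z : ℂ => -conj z := continuous_conj.neg
  simpa using this.tendsto 0

theorem analyticAt_neg_comp_neg {F : ℂ → ℂ} (h : AnalyticAt ℂ F 0) :
    AnalyticAt ℂ (fun z => -F (-z)) 0 := by
  have : AnalyticAt ℂ (fun z : ℂ => -z) 0 := by fun_prop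
  exact (AnalyticAt.fun_comp (by simpa using h) this).neg

theorem RealGerm.mirror {F G : ℂ → ℂ} (h : RealGerm F G) : RealGerm (mirror F) (mirror G) where
  analyticF := (analyticAt_neg_comp_neg h.analyticF).congr (mirror_eventuallyEq h.conj_F).symm
  analyticG := (analyticAt_neg_comp_neg h.analyticG).congr (mirror_eventuallyEq h.conj_G).symm
  G_zero := by simp [ParabolicExternal.mirror, h.G_zero]
  F_zero := by simp [ParabolicExternal.mirror, h.F_zero]
  deriv_F := by
    rw [(mirror_eventuallyEq h.conj_F).deriv_eq, deriv.fun_neg, deriv_comp_neg]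
    simp [h.deriv_F]
  inv := by
    filter_upwards [tendsto_neg_conj.eventually h.inv] with z hz
    simp [ParabolicExternal.mirror, hz]
  im_pos := by
    filter_upwards [tendsto_neg_conj.eventually h.im_pos] with z hz h0
    simp only [ParabolicExternal.mirror, neg_im, conj_im, neg_neg]
    exact hz (by simpa using h0)
  conj_F := by
    filter_upwards [tendsto_neg_conj.eventually h.conj_F] with z hz
    simp only [ParabolicExternal.mirror]
    rw [← map_neg conj (conj z), hz]
    simp
  conj_G := by
    filter_upwards [tendsto_neg_conj.eventually h.conj_G] with z hz
    simp only [ParabolicExternal.mirror]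
    rw [← map_neg conj (conj z), hz]
    simp
  push_right := by
    have h1 : Tendsto (fun x : ℝ => -x) (𝓝[>] 0) (𝓝[<] 0) := by
      simpa using tendsto_neg_nhdsGT (a := (0 : ℝ))
    filter_upwards [h1.eventually h.push_left] with x hx
    simp only [ParabolicExternal.mirror, neg_re, conj_re, conj_ofReal]
    push_cast at hx
    linarith
  push_left := by
    have h1 : Tendsto (fun x : ℝ => -x) (𝓝[<] 0) (𝓝[>] 0) := by
      simpa using tendsto_neg_nhdsLT (a := (0 : ℝ))
    filter_upwards [h1.eventually h.push_right] with x hx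
    simp only [ParabolicExternal.mirror, neg_re, conj_re, conj_ofReal]
    push_cast at hx
    linarith

theorem Good.mono {F : ℂ → ℂ} {N : ℕ} {a a' : ℝ} {z : ℂ} (h : Good F N a z) (ha : a' ≤ a)
    (hz : 0 < z.re) : Good F N a' z :=
  { h with push_re := (mul_le_mul_of_nonneg_right ha (pow_nonneg hz.le N)).trans h.push_re }

theorem RealGerm.exists_eventually_good {F G : ℂ → ℂ} (h : RealGerm F G) :
    ∃ N₀ : ℕ, ∀ N ≥ N₀, ∃ a > 0, ∀ᶠ z in sectorFilter, Good F N a z := by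
  refine ParabolicExternal.exists_eventually_good h.analyticF h.F_zero h.deriv_F ?_ h.push_right
  have h1 : Tendsto (fun x : ℝ => (x : ℂ)) (𝓝 0) (𝓝 0) := by
    simpa using continuous_ofReal.tendsto (0 : ℝ)
  filter_upwards [h1.eventually h.conj_F] with x hx
  rw [conj_ofReal] at hx
  exact conj_eq_iff_im.mp hx.symm

theorem exists_uniform_good {ι : Type*} [Finite ι] {F G : ι → ℂ → ℂ}
    (h : ∀ i, RealGerm (F i) (G i)) : ∃ N : ℕ, ∃ a > 0, ∃ κ > 0, ∃ r > 0, κ ≤ 1 / 2 ∧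
      ∀ i, ∀ z ∈ sector (2 * κ) r, Good (F i) N a z := by
  choose N₀ hN₀ using fun i => (h i).exists_eventually_good
  -- The germs may differ in their order of tangency to the identity, but the cone field needs a
  -- single exponent along a whole orbit: take an upper bound of the finitely many thresholds.
  obtain ⟨N, hN⟩ := (Set.finite_range N₀).bddAbove
  have hN' : ∀ i, N₀ i ≤ N := fun i => hN (mem_range_self i)
  choose a ha hgood using fun i => hN₀ i N (hN' i)
  obtain ⟨a', ha', haa⟩ : ∃ a' > 0, ∀ i, a' ≤ a i := by
    rcases isEmpty_or_nonempty ι with he | he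
    · exact ⟨1, one_pos, fun i => he.elim i⟩
    · obtain ⟨i, hi⟩ := Finite.exists_min a
      exact ⟨a i, ha i, hi⟩
  obtain ⟨κ, hκ, r, hr, hs⟩ := eventually_sectorFilter.mp (eventually_all.mpr hgood)
  refine ⟨N, a', ha', min (κ / 2) (1 / 2), by positivity, r, hr, min_le_right _ _,
    fun i z hz => ?_⟩
  refine (hs z (sector_mono ?_ le_rfl hz) i).mono (haa i) hz.1
  linarith [min_le_left (κ / 2) (1 / 2)]

namespace HalfArc

variable {ι : Type*} {s : ι → ι} {F G : ι → ℂ → ℂ} {κ r ε : ℝ} {σ : ι → ℝ → ℂ}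

theorem hasDerivAt (h : HalfArc s F G κ r ε σ) (i : ι) {t : ℝ} (ht : t ≤ 1) :
    HasDerivAt (σ i) (deriv (σ i) t) t :=
  ((h.smooth i t ht).differentiableAt (by simp)).hasDerivAt

theorem strictMonoOn (h : HalfArc s F G κ r ε σ) (i : ι) :
    StrictMonoOn (fun t => (σ i t).re) (Iic 1) :=
  strictMonoOn_of_hasDerivAt_pos (convex_Iic 1)
    (fun _ ht => (hasDerivAt_re_im (h.hasDerivAt i ht)).1) fun t ht => h.deriv_re i t ht

theorem continuousOn (h : HalfArc s F G κ r ε σ) (i : ι) : ContinuousOn (σ i) (Iic 1) :=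
  fun _ ht => (h.hasDerivAt i ht).continuousAt.continuousWithinAt

theorem image_re (h : HalfArc s F G κ r ε σ) (i : ι) :
    (fun t => (σ i t).re) '' Iic 1 = Ioc 0 (ε / κ) := by
  ext x
  refine ⟨?_, fun hx => ?_⟩
  · rintro ⟨t, ht, rfl⟩
    refine ⟨(h.mem i t ht).1, ?_⟩
    have := (h.strictMonoOn i).monotoneOn ht (mem_Iic.mpr le_rfl) ht
    simpa [h.one] using this
  · obtain ⟨t, ht1, ht⟩ := (((h.tendsto i).eventually (gt_mem_nhds hx.1)).and
      (eventually_le_atBot 1)).exists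
    have hc : ContinuousOn (fun t => (σ i t).re) (Icc t 1) :=
      continuous_re.comp_continuousOn ((h.continuousOn i).mono Icc_subset_Iic_self)
    obtain ⟨u, hu, hux⟩ := intermediate_value_Icc ht hc
      (show x ∈ Icc (σ i t).re (σ i 1).re from ⟨ht1.le, by simpa [h.one] using hx.2⟩)
    exact ⟨u, hu.2, hux⟩

/-- The real part is strictly increasing along the half arc, so the parameter is a continuous
function of it: the inverse of an order isomorphism between intervals. -/
theorem exists_section (h : HalfArc s F G κ r ε σ) (i : ι) :
    ∃ φ : ℝ → ℝ, ContinuousOn φ (Ioc 0 (ε / κ)) ∧ ∀ t ≤ 1, (σ i t).im = φ (σ i t).re := by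
  have hm := h.strictMonoOn i
  set e := hm.orderIso (fun t => (σ i t).re) (Iic 1) with he
  have : OrdConnected ((fun t => (σ i t).re) '' Iic (1 : ℝ)) := by
    rw [h.image_re]; exact ordConnected_Ioc
  have hc : Continuous fun x => (σ i (e.symm x)).im :=
    continuous_im.comp <| (continuousOn_iff_continuous_domRestrict.mp (h.continuousOn i)).comp
      e.symm.continuous
  classical
  refine ⟨fun x => if hx : x ∈ (fun t => (σ i t).re) '' Iic 1 then (σ i (e.symm ⟨x, hx⟩)).im else 0,
    ?_, fun t ht => ?_⟩
  · rw [← h.image_re i, continuousOn_iff_continuous_domRestrict]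
    convert hc using 1
    ext x
    exact dif_pos x.2
  · have hx : (σ i t).re ∈ (fun t => (σ i t).re) '' Iic 1 := ⟨t, ht, rfl⟩
    refine Eq.trans ?_ (dif_pos hx).symm
    have : e.symm ⟨(σ i t).re, hx⟩ = ⟨t, ht⟩ := by
      rw [OrderIso.symm_apply_eq]
      rfl
    rw [this]

/-- The graph is extended by `0` to the left and by `ε` to the right. Continuity at the tip `0`
comes from squeezing the function between `0` and `κ |x|`. -/
theorem exists_graph (h : HalfArc s F G κ r ε σ) (hκ : 0 < κ) (hε : 0 < ε) (i : ι) :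
    ∃ f : ℝ → ℝ, Continuous f ∧ (∀ x ≤ 0, f x = 0) ∧ (∀ x, ε / κ ≤ x → f x = ε) ∧
      (∀ x < ε / κ, f x < ε) ∧ (∀ x, 0 ≤ f x) ∧ (∀ x, f x ≤ κ * |x|) ∧
      ∀ t ≤ 1, (σ i t).im = f (σ i t).re := by
  obtain ⟨φ, hφc, hφ⟩ := h.exists_section i
  have hX : 0 < ε / κ := by positivity
  have hrep : ∀ x, 0 < x → ∃ t ≤ 1, (σ i t).re = min x (ε / κ) ∧
      (σ i t).im = φ (min x (ε / κ)) := fun x hx => by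
    have : min x (ε / κ) ∈ Ioc 0 (ε / κ) := ⟨lt_min hx hX, min_le_right _ _⟩
    rw [← h.image_re i] at this
    obtain ⟨t, ht, hre⟩ := this
    exact ⟨t, ht, hre, by rw [hφ t ht]; exact congrArg φ hre⟩
  set f : ℝ → ℝ := fun x => if x ≤ 0 then 0 else φ (min x (ε / κ)) with hf
  have hfpos : ∀ x, 0 < x → f x = φ (min x (ε / κ)) := fun x hx => if_neg (not_le.mpr hx)
  have hfneg : ∀ x ≤ 0, f x = 0 := fun x hx => if_pos hx
  have h0 : ∀ x, 0 ≤ f x := fun x => by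
    rcases le_or_gt x 0 with hx | hx
    · rw [hfneg x hx]
    · obtain ⟨t, ht, -, h2⟩ := hrep x hx
      rw [hfpos x hx, ← h2]
      exact (h.im_pos i t ht).le
  have hle : ∀ x, f x ≤ κ * |x| := fun x => by
    rcases le_or_gt x 0 with hx | hx
    · rw [hfneg x hx]; positivity
    · obtain ⟨t, ht, h1, h2⟩ := hrep x hx
      rw [hfpos x hx, ← h2]
      refine (h.mem i t ht).2.2.2.trans ?_
      rw [h1, abs_of_pos hx]
      exact mul_le_mul_of_nonneg_left (min_le_left _ _) hκ.le
  refine ⟨f, ?_, hfneg, fun x hx => ?_, fun x hx => ?_, h0, hle, fun t ht => ?_⟩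
  · refine continuous_iff_continuousAt.mpr fun x => ?_
    rcases lt_trichotomy x 0 with hx | rfl | hx
    · exact continuousAt_const.congr ((gt_mem_nhds hx).mono fun y hy => (hfneg y hy.le).symm)
    · have h1 : Tendsto (fun x : ℝ => κ * |x|) (𝓝 0) (𝓝 0) := by
        have : Continuous fun x : ℝ => κ * |x| := by fun_prop
        simpa using this.tendsto 0
      have := tendsto_of_tendsto_of_tendsto_of_le_of_le tendsto_const_nhds h1 h0 hle
      rwa [ContinuousAt, hfneg 0 le_rfl]
    · have hmin : ContinuousOn (fun x => φ (min x (ε / κ))) (Ioi 0) :=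
        hφc.comp (by fun_prop) fun y hy => ⟨lt_min hy hX, min_le_right _ _⟩
      exact (hmin.continuousAt (Ioi_mem_nhds hx)).congr
        ((lt_mem_nhds hx).mono fun y hy => (hfpos y hy).symm)
  · rw [hfpos x (hX.trans_le hx), min_eq_right hx]
    have := hφ 1 le_rfl
    rw [h.one] at this
    exact this.symm
  · rcases le_or_gt x 0 with hx0 | hx0
    · rwa [hfneg x hx0]
    · obtain ⟨t, ht, h1, h2⟩ := hrep x hx0
      rw [hfpos x hx0, ← h2]
      refine h.im_lt i t (lt_of_le_of_ne ht ?_)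
      rintro rfl
      rw [h.one, min_eq_left hx.le] at h1
      exact hx.ne h1.symm
  · rw [hfpos _ (h.mem i t ht).1, min_eq_left, hφ t ht]
    have : (σ i t).re ∈ (fun t => (σ i t).re) '' Iic 1 := ⟨t, ht, rfl⟩
    rw [h.image_re] at this
    exact this.2

end HalfArc

end

/-! ### Invariance of the graphs and smooth parametrizations -/

section

/-- The graph of `f : (0, X] → ℝ`. -/
def halfGraph (X : ℝ) (f : ℝ → ℝ) : Set ℂ := {z | 0 < z.re ∧ z.re ≤ X ∧ z.im = f z.re}

/-- The maps `F i` and `G i` permute the pieces below the height `ε` of the graphs of `f i`. -/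
structure HalfInvariant {ι : Type*} (s : ι → ι) (F G : ι → ℂ → ℂ) (X ε : ℝ) (f : ι → ℝ → ℝ) :
    Prop where
  fwd : ∀ i, ∀ z ∈ halfGraph X (f i), (F i z).im < ε → F i z ∈ halfGraph X (f (s i))
  back : ∀ i, ∀ z ∈ halfGraph X (f (s i)), z.im < ε →
    G i z ∈ halfGraph X (f i) ∧ F i (G i z) = z ∧ (G i z).im < ε

namespace HalfArc

variable {ι : Type*} {s : ι → ι} {F G : ι → ℂ → ℂ} {κ r ε : ℝ} {σ : ι → ℝ → ℂ}

theorem halfGraph_eq (h : HalfArc s F G κ r ε σ) {f : ℝ → ℝ} {i : ι}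
    (hf : ∀ t ≤ 1, (σ i t).im = f (σ i t).re) : halfGraph (ε / κ) f = σ i '' Iic 1 := by
  ext z
  constructor
  · rintro ⟨h1, h2, h3⟩
    have : z.re ∈ (fun t => (σ i t).re) '' Iic 1 := by rw [h.image_re]; exact ⟨h1, h2⟩
    obtain ⟨t, ht, hre⟩ := this
    exact ⟨t, ht, Complex.ext hre (by rw [hf t ht, h3]; exact congrArg f hre)⟩
  · rintro ⟨t, ht, rfl⟩
    have : (σ i t).re ∈ (fun t => (σ i t).re) '' Iic 1 := ⟨t, ht, rfl⟩
    rw [h.image_re] at this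
    exact ⟨this.1, this.2, hf t ht⟩

/-- A point with parameter in `(0, 1]` is mapped above the height `ε`, so a point mapped below it
has parameter at most `0` and its image is the point of parameter `t + 1`. -/
theorem halfInvariant (h : HalfArc s F G κ r ε σ) {f : ι → ℝ → ℝ}
    (hf : ∀ i, ∀ t ≤ 1, (σ i t).im = f i (σ i t).re) : HalfInvariant s F G (ε / κ) ε f where
  fwd i z hz hlt := by
    rw [h.halfGraph_eq (hf i)] at hz
    rw [h.halfGraph_eq (hf (s i))]
    obtain ⟨t, ht, rfl⟩ := hz
    rcases le_or_gt t 0 with h0 | h0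
    · exact ⟨t + 1, by simpa using h0, (h.fwd i t h0).symm⟩
    · exact absurd hlt (h.exit i t ⟨h0, ht⟩).not_gt
  back i z hz hlt := by
    rw [h.halfGraph_eq (hf (s i))] at hz
    rw [h.halfGraph_eq (hf i)]
    obtain ⟨t, ht, rfl⟩ := hz
    have ht1 : t < 1 := by
      refine lt_of_le_of_ne ht ?_
      rintro rfl
      simp [h.one] at hlt
    have h1 := h.back i (t - 1) (by linarith)
    have h2 := h.fwd i (t - 1) (by linarith)
    rw [sub_add_cancel] at h1 h2
    rw [← h1]
    exact ⟨⟨t - 1, by simp; linarith, rfl⟩, h2, h.im_lt i _ (by linarith)⟩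

theorem tendsto_zero (h : HalfArc s F G κ r ε σ) (i : ι) : Tendsto (σ i) atBot (𝓝 0) := by
  rw [tendsto_zero_iff_norm_tendsto_zero]
  have h1 : Tendsto (fun t => (1 + κ) * (σ i t).re) atBot (𝓝 0) := by
    simpa using (h.tendsto i).const_mul (1 + κ)
  refine tendsto_of_tendsto_of_tendsto_of_le_of_le' tendsto_const_nhds h1
    (Eventually.of_forall fun _ => norm_nonneg _) ?_
  filter_upwards [eventually_le_atBot 1] with t ht
  exact norm_le_of_mem_sector (h.mem i t ht)

end HalfArc

/-- A smooth parametrization `u : (0, 1] → ℂ` of the graph of `f : (0, X] → ℝ`. -/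
structure HalfCurve (X ε : ℝ) (f : ℝ → ℝ) (u : ℝ → ℂ) : Prop where
  smooth : ∀ t ∈ Ioc (0 : ℝ) 1, ContDiffAt ℝ ∞ u t
  deriv_re : ∀ t ∈ Ioc (0 : ℝ) 1, 0 < (deriv u t).re
  tendsto : Tendsto u (𝓝[>] 0) (𝓝 0)
  one : u 1 = ⟨X, ε⟩
  graph : ∀ t ∈ Ioc (0 : ℝ) 1, (u t).im = f (u t).re

/-- The substitution `2 - 1 / t` maps `(0, 1]` increasingly onto `(-∞, 1]`, which brings the tip to
`t = 0`. -/
theorem HalfArc.halfCurve {ι : Type*} {s : ι → ι} {F G : ι → ℂ → ℂ} {κ r ε : ℝ} {σ : ι → ℝ → ℂ}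
    (h : HalfArc s F G κ r ε σ) {f : ℝ → ℝ} {i : ι} (hf : ∀ t ≤ 1, (σ i t).im = f (σ i t).re) :
    HalfCurve (ε / κ) ε f fun t => σ i (2 - t⁻¹) := by
  have hle : ∀ t ∈ Ioc (0 : ℝ) 1, 2 - t⁻¹ ≤ 1 := fun t ht => by
    have := (one_le_inv₀ ht.1).mpr ht.2
    linarith
  have hinv : ∀ t ∈ Ioc (0 : ℝ) 1, HasDerivAt (fun t : ℝ => 2 - t⁻¹) ((t ^ 2)⁻¹) t := fun t ht => by
    simpa using (hasDerivAt_inv ht.1.ne').const_sub 2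
  refine ⟨fun t ht => ?_, fun t ht => ?_, ?_, ?_, fun t ht => hf _ (hle t ht)⟩
  · exact (h.smooth i _ (hle t ht)).comp t
      (contDiffAt_const.sub (contDiffAt_id.inv ht.1.ne'))
  · rw [show (fun t => σ i (2 - t⁻¹)) = σ i ∘ fun t => 2 - t⁻¹ from rfl,
      ((h.hasDerivAt i (hle t ht)).scomp t (hinv t ht)).deriv, real_smul, re_ofReal_mul]
    have := ht.1
    exact mul_pos (by positivity) (h.deriv_re i _ (hle t ht))
  · refine (h.tendsto_zero i).comp ?_
    simpa [sub_eq_add_neg] using tendsto_atBot_add_const_left _ (2 : ℝ)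
      (tendsto_neg_atTop_atBot.comp tendsto_inv_nhdsGT_zero)
  · have := h.one i
    norm_num [this]

/-- A parametrization `c : [-1, 1] → ℂ`, smooth except at `0`, of the graph of
`f : [-X, X] → ℝ`. -/
structure ArcCurve (X ε : ℝ) (f : ℝ → ℝ) (c : ℝ → ℂ) : Prop where
  continuousOn : ContinuousOn c (Icc (-1) 1)
  zero : c 0 = 0
  smooth : ∀ t ∈ Icc (-1 : ℝ) 1 \ {0}, ContDiffAt ℝ ∞ c t
  deriv_re : ∀ t ∈ Icc (-1 : ℝ) 1 \ {0}, 0 < (deriv c t).re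
  left : c (-1) = ⟨-X, ε⟩
  right : c 1 = ⟨X, ε⟩
  graph : ∀ t ∈ Icc (-1 : ℝ) 1, (c t).im = f (c t).re

theorem HalfCurve.arcCurve {X ε : ℝ} {f₁ f₂ f : ℝ → ℝ} {u₁ u₂ : ℝ → ℂ} (h₁ : HalfCurve X ε f₁ u₁)
    (h₂ : HalfCurve X ε f₂ u₂) (h0 : f 0 = 0) (hpos : ∀ x > 0, f x = f₁ x)
    (hneg : ∀ x > 0, f (-x) = f₂ x) (hp₁ : ∀ t ∈ Ioc (0 : ℝ) 1, 0 < (u₁ t).re)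
    (hp₂ : ∀ t ∈ Ioc (0 : ℝ) 1, 0 < (u₂ t).re) : ∃ c, ArcCurve X ε f c := by
  set c : ℝ → ℂ := fun t => if 0 < t then u₁ t else if t < 0 then -conj (u₂ (-t)) else 0 with hc
  have cpos : ∀ t, 0 < t → c t = u₁ t := fun t ht => if_pos ht
  have cneg : ∀ t, t < 0 → c t = -conj (u₂ (-t)) := fun t ht => by
    rw [hc]; simp only [if_neg ht.not_gt, if_pos ht]
  have c0 : c 0 = 0 := by simp [hc]
  have epos : ∀ t, 0 < t → c =ᶠ[𝓝 t] u₁ := fun t ht => (lt_mem_nhds ht).mono fun y hy => cpos y hy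
  have eneg : ∀ t, t < 0 → c =ᶠ[𝓝 t] fun t => -conj (u₂ (-t)) := fun t ht =>
    (gt_mem_nhds ht).mono fun y hy => cneg y hy
  have hsm : ∀ t ∈ Icc (-1 : ℝ) 1 \ {0}, ContDiffAt ℝ ∞ c t ∧ 0 < (deriv c t).re := by
    rintro t ⟨ht, ht0⟩
    rcases lt_or_gt_of_ne (show t ≠ 0 from ht0) with h | h
    · have hmem : -t ∈ Ioc (0 : ℝ) 1 := ⟨by linarith, by linarith [ht.1]⟩
      have hd := ((h₂.smooth _ hmem).differentiableAt (by simp)).hasDerivAt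
      refine ⟨?_, ?_⟩
      · refine ContDiffAt.congr_of_eventuallyEq ?_ (eneg t h)
        exact (conjCLE.contDiff.contDiffAt.comp t
          ((h₂.smooth _ hmem).comp t contDiffAt_id.neg)).neg
      · rw [(eneg t h).deriv_eq]
        have h3 : HasDerivAt (fun t => -conj (u₂ (-t))) (-(conjCLE ((-1 : ℝ) • deriv u₂ (-t)))) t :=
          (conjCLE.hasFDerivAt.comp_hasDerivAt t (hd.scomp t (hasDerivAt_neg t))).neg
        rw [h3.deriv]
        simpa using h₂.deriv_re _ hmem
    · have hmem : t ∈ Ioc (0 : ℝ) 1 := ⟨h, ht.2⟩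
      refine ⟨(h₁.smooth t hmem).congr_of_eventuallyEq (epos t h), ?_⟩
      rw [(epos t h).deriv_eq]
      exact h₁.deriv_re t hmem
  refine ⟨c, ⟨fun t ht => ?_, c0, fun t ht => (hsm t ht).1, fun t ht => (hsm t ht).2, ?_, ?_,
    fun t ht => ?_⟩⟩
  · by_cases h : t = 0
    · subst h
      refine ContinuousAt.continuousWithinAt ?_
      rw [continuousAt_iff_continuous_left'_right', ContinuousWithinAt, ContinuousWithinAt, c0]
      constructor
      · have h1 : Tendsto (fun t : ℝ => -t) (𝓝[<] 0) (𝓝[>] 0) := by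
          simpa using tendsto_neg_nhdsLT (a := (0 : ℝ))
        have h2 := tendsto_neg_conj.comp (h₂.tendsto.comp h1)
        exact h2.congr' (eventually_mem_nhdsWithin.mono fun y hy => (cneg y hy).symm)
      · exact h₁.tendsto.congr' (eventually_mem_nhdsWithin.mono fun y hy => (cpos y hy).symm)
    · exact (hsm t ⟨ht, h⟩).1.continuousAt.continuousWithinAt
  · rw [cneg _ (by norm_num), neg_neg, h₂.one]
    apply Complex.ext <;> simp
  · rw [cpos _ one_pos, h₁.one]
  · rcases lt_trichotomy t 0 with h | rfl | h
    · have hmem : -t ∈ Ioc (0 : ℝ) 1 := ⟨by linarith, by linarith [ht.1]⟩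
      rw [cneg t h]
      simp [h₂.graph _ hmem, hneg _ (hp₂ _ hmem)]
    · simp [c0, h0]
    · have hmem : t ∈ Ioc (0 : ℝ) 1 := ⟨h, ht.2⟩
      rw [cpos t h, h₁.graph _ hmem, hpos _ (hp₁ _ hmem)]

theorem ArcCurve.strictMonoOn {X ε : ℝ} {f : ℝ → ℝ} {c : ℝ → ℂ} (h : ArcCurve X ε f c) :
    StrictMonoOn (fun t => (c t).re) (Icc (-1) 1) := by
  have hc : ContinuousOn (fun t => (c t).re) (Icc (-1) 1) :=
    continuous_re.comp_continuousOn h.continuousOn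
  have hd : ∀ t ∈ Icc (-1 : ℝ) 1 \ {0}, 0 < deriv (fun t => (c t).re) t := fun t ht => by
    rw [(hasDerivAt_re_im ((h.smooth t ht).differentiableAt (by simp)).hasDerivAt).1.deriv]
    exact h.deriv_re t ht
  have h1 : StrictMonoOn (fun t => (c t).re) (Icc (-1) 0) :=
    strictMonoOn_of_deriv_pos (convex_Icc _ _) (hc.mono (Icc_subset_Icc_right zero_le_one))
      fun t ht => by
        rw [interior_Icc] at ht
        exact hd t ⟨⟨ht.1.le, by linarith [ht.2]⟩, ht.2.ne⟩
  have h2 : StrictMonoOn (fun t => (c t).re) (Icc 0 1) :=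
    strictMonoOn_of_deriv_pos (convex_Icc _ _) (hc.mono (Icc_subset_Icc_left (by norm_num)))
      fun t ht => by
        rw [interior_Icc] at ht
        exact hd t ⟨⟨by linarith [ht.1], ht.2.le⟩, ht.1.ne'⟩
  have := h1.union h2 (isGreatest_Icc (by norm_num)) (isLeast_Icc zero_le_one)
  rwa [Icc_union_Icc_eq_Icc (by norm_num) zero_le_one] at this

theorem ArcCurve.image {X ε : ℝ} {f : ℝ → ℝ} {c : ℝ → ℂ} (h : ArcCurve X ε f c) :
    c '' Icc (-1) 1 = {z | |z.re| ≤ X ∧ z.im = f z.re} := by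
  have hm := h.strictMonoOn.monotoneOn
  ext z
  constructor
  · rintro ⟨t, ht, rfl⟩
    refine ⟨abs_le.mpr ⟨?_, ?_⟩, h.graph t ht⟩
    · simpa [h.left] using hm (left_mem_Icc.mpr (by norm_num)) ht ht.1
    · simpa [h.right] using hm ht (right_mem_Icc.mpr (by norm_num)) ht.2
  · rintro ⟨h1, h2⟩
    have hc : ContinuousOn (fun t => (c t).re) (Icc (-1) 1) :=
      continuous_re.comp_continuousOn h.continuousOn
    obtain ⟨t, ht, hre⟩ := intermediate_value_Icc (show (-1 : ℝ) ≤ 1 by norm_num) hc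
      (show z.re ∈ Icc (c (-1)).re (c 1).re by simpa [h.left, h.right] using abs_le.mp h1)
    exact ⟨t, ht, Complex.ext hre (by rw [h.graph t ht, h2]; exact congrArg f hre)⟩

end

/-! ### Systems of arcs through the parabolic points -/

/-- A system of arcs through `0`, permuted by the maps `F i` and `G i` below the height `ε`. -/
structure ArcSystem {ι : Type*} (s : ι → ι) (F G : ι → ℂ → ℂ) (X ε : ℝ) (f : ι → ℝ → ℝ)
    (c : ι → ℝ → ℂ) : Prop where
  graph : ∀ i, IsArcGraph X ε (f i)
  curve : ∀ i, ArcCurve X ε (f i) (c i)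
  fwd : ∀ i z, |z.re| ≤ X → z.im = f i z.re → (F i z).im < ε → F i z ∈ openArc X 0 (f (s i))
  back : ∀ i, ∀ z ∈ openArc X 0 (f (s i)), G i z ∈ openArc X 0 (f i) ∧ F i (G i z) = z

theorem mem_openArc_of_mem_halfGraph {X ε : ℝ} {f : ℝ → ℝ} {z : ℂ} (hf : IsArcGraph X ε f)
    (h : z ∈ halfGraph X f) (hz : z.im < ε) : z ∈ openArc X 0 f := by
  obtain ⟨h1, h2, h3⟩ := h
  refine ⟨?_, by rw [sub_zero]; exact h3⟩
  rw [sub_zero, abs_of_pos h1]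
  refine lt_of_le_of_ne h2 fun h => ?_
  rw [h3, hf.eq_of_le _ (by rw [← h]; exact le_abs_self _)] at hz
  exact hz.false

/-- Right and left half arcs are produced together, by applying `exists_halfArc` to the germs and
their mirror images; a Boolean index records the side. This yields common values of `κ` and `ε` for
both sides and all points. -/
theorem exists_arcSystem {ι : Type*} [Finite ι] (s : ι → ι) {F G : ι → ℂ → ℂ}
    (h : ∀ i, RealGerm (F i) (G i)) : ∃ κ > 0, κ ≤ 1 / 2 ∧ ∃ r > 0,
      (∀ i z, 0 < |z.re| → |z.re| < r → 0 < z.im → z.im ≤ 2 * κ * |z.re| → z.im < (F i z).im) ∧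
      ∃ ε₀ > 0, ∀ ε, 0 < ε → ε ≤ ε₀ → ∃ f c, ArcSystem s F G (ε / κ) ε f c ∧
        ∀ i x, f i x ≤ κ * |x| := by
  set F' : ι × Bool → ℂ → ℂ := fun j => bif j.2 then F j.1 else mirror (F j.1) with hF'
  set G' : ι × Bool → ℂ → ℂ := fun j => bif j.2 then G j.1 else mirror (G j.1) with hG'
  have h' : ∀ j, RealGerm (F' j) (G' j) := by
    rintro ⟨i, b⟩
    cases b
    · exact (h i).mirror
    · exact h i
  obtain ⟨N, a, ha, κ, hκ, r, hr, hκ1, hgood⟩ := exists_uniform_good h'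
  refine ⟨κ, hκ, hκ1, r, hr, fun i z h0 hzr him hle => ?_, ?_⟩
  · rcases lt_or_gt_of_ne (abs_pos.mp h0) with hz | hz
    · rw [abs_of_neg hz] at hzr hle
      have := (hgood (i, false) (-conj z) ⟨by simpa using hz, by simpa using hzr,
        by simpa using him.le, by simpa using hle⟩).push_im (by simpa using him)
      simpa [hF', mirror] using this
    · rw [abs_of_pos hz] at hzr hle
      simpa [hF'] using (hgood (i, true) z ⟨hz, hzr, him.le, hle⟩).push_im him
  obtain ⟨ε₀, hε₀, hex⟩ := exists_halfArc (fun j : ι × Bool => (s j.1, j.2)) hκ hκ1 hr ha hgood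
    fun j => (h' j).toGerm
  -- The bound `κ / 4` makes the half-width `ε / κ` at most `1 / 4`, as an arc graph requires.
  refine ⟨min ε₀ (κ / 4), by positivity, fun ε hε hεle => ?_⟩
  obtain ⟨σ, hσ⟩ := hex ε hε (hεle.trans (min_le_left _ _))
  have hX : 0 < ε / κ := by positivity
  have hX4 : ε / κ ≤ 1 / 4 := by
    rw [div_le_iff₀ hκ]
    linarith [hεle.trans (min_le_right _ _)]
  choose g hgc hgneg hgε hglt hg0 hgκ hgσ using hσ.exists_graph hκ hε
  have hinv := hσ.halfInvariant hgσ
  -- Each summand vanishes on its own nonpositive half-line, so the sum glues the two graphs without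
  -- a case distinction.
  set f : ι → ℝ → ℝ := fun i x => g (i, true) x + g (i, false) (-x) with hf
  have hpos : ∀ i x, 0 ≤ x → f i x = g (i, true) x := fun i x hx => by
    rw [hf]; simp only [hgneg (i, false) (-x) (by linarith), add_zero]
  have hneg : ∀ i x, x ≤ 0 → f i x = g (i, false) (-x) := fun i x hx => by
    rw [hf]; simp only [hgneg (i, true) x hx, zero_add]
  have hf0 : ∀ i, f i 0 = 0 := fun i => by rw [hpos i 0 le_rfl, hgneg _ 0 le_rfl]
  have hgraph : ∀ i, IsArcGraph (ε / κ) ε (f i) := fun i => by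
    have hc1 := hgc (i, true)
    have hc2 := hgc (i, false)
    refine ⟨hX, hX4, by fun_prop, fun x hx => ?_, fun x hx => ?_,
      fun x => add_nonneg (hg0 _ _) (hg0 _ _)⟩
    · rcases le_total 0 x with h0 | h0
      · rw [hpos i x h0]
        exact hgε _ x (by rwa [abs_of_nonneg h0] at hx)
      · rw [hneg i x h0]
        exact hgε _ (-x) (by rwa [abs_of_nonpos h0] at hx)
    · rcases le_total 0 x with h0 | h0
      · rw [hpos i x h0]
        exact hglt _ x (by rwa [abs_of_nonneg h0] at hx)
      · rw [hneg i x h0]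
        exact hglt _ (-x) (by rwa [abs_of_nonpos h0] at hx)
  have hhalf : ∀ j, HalfCurve (ε / κ) ε (g j) fun t => σ j (2 - t⁻¹) := fun j =>
    hσ.halfCurve (hgσ j)
  have hre : ∀ j, ∀ t ∈ Ioc (0 : ℝ) 1, 0 < (σ j (2 - t⁻¹)).re := fun j t ht => by
    have := (one_le_inv₀ ht.1).mpr ht.2
    exact (hσ.mem j _ (by linarith)).1
  choose c hc using fun i => (hhalf (i, true)).arcCurve (hhalf (i, false)) (hf0 i)
    (fun x hx => hpos i x (le_of_lt hx)) (fun x hx => by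
      rw [hneg i (-x) (by linarith [show 0 < x from hx]), neg_neg]) (hre _) (hre _)
  have hgr : ∀ i z, z ∈ halfGraph (ε / κ) (g (i, true)) → z ∈ halfGraph (ε / κ) (f i) :=
    fun i z hz => ⟨hz.1, hz.2.1, by rw [hpos i _ hz.1.le]; exact hz.2.2⟩
  have hgl : ∀ i z, z.im < ε → -conj z ∈ halfGraph (ε / κ) (g (i, false)) →
      z ∈ openArc (ε / κ) 0 (f i) := by
    rintro i z hlt ⟨h1, h2, h3⟩
    simp only [neg_re, conj_re, neg_im, conj_im, neg_neg] at h1 h2 h3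
    refine ⟨?_, by rw [sub_zero, hneg i _ (by linarith)]; exact h3⟩
    rw [sub_zero, abs_of_neg (by linarith)]
    refine lt_of_le_of_ne h2 fun h => ?_
    rw [h3, hgε _ _ h.ge] at hlt
    exact hlt.false
  have hzero : ∀ i, (0 : ℂ) ∈ openArc (ε / κ) 0 (f i) := fun i => by
    simp [openArc, hf0, hX]
  refine ⟨f, c, ⟨hgraph, hc, fun i z hz him hlt => ?_, fun i z hz => ?_⟩, fun i x => ?_⟩
  · rcases lt_trichotomy z.re 0 with h0 | h0 | h0
    · have hm : -conj z ∈ halfGraph (ε / κ) (g (i, false)) := by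
        refine ⟨by simpa using h0, ?_, ?_⟩
        · simpa [abs_of_neg h0] using hz
        · simp [him, hneg i _ h0.le]
      refine hgl (s i) _ hlt ?_
      have := hinv.fwd (i, false) _ hm (by simpa [hF', mirror] using hlt)
      simpa [hF', mirror] using this
    · have : z = 0 := Complex.ext h0 (by simp [him, h0, hf0])
      rw [this, (h i).F_zero]
      exact hzero _
    · rw [abs_of_pos h0] at hz
      have hm : z ∈ halfGraph (ε / κ) (g (i, true)) := ⟨h0, hz, by rw [← hpos i _ h0.le]; exact him⟩
      exact mem_openArc_of_mem_halfGraph (hgraph _)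
        (hgr (s i) _ (hinv.fwd (i, true) z hm hlt)) hlt
  · obtain ⟨h1, h2⟩ := hz
    rw [sub_zero] at h1 h2
    have hlt : z.im < ε := h2 ▸ (hgraph _).lt_of_lt _ h1
    rcases lt_trichotomy z.re 0 with h0 | h0 | h0
    · have hm : -conj z ∈ halfGraph (ε / κ) (g (s i, false)) := by
        refine ⟨by simpa using h0, ?_, ?_⟩
        · simpa [abs_of_neg h0] using h1.le
        · simp [h2, hneg (s i) _ h0.le]
      obtain ⟨h3, h4, h5⟩ := hinv.back (i, false) _ hm (by simpa using hlt)
      simp only [hF', hG', mirror, cond_false, map_neg, conj_conj, neg_neg, neg_im, conj_im] at h3 h4 h5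
      refine ⟨hgl i _ h5 h3, ?_⟩
      simpa using congrArg (fun w => conj (-w)) h4
    · have : z = 0 := Complex.ext h0 (by simp [h2, h0, hf0])
      rw [this, (h i).G_zero, (h i).F_zero]
      exact ⟨hzero _, rfl⟩
    · rw [abs_of_pos h0] at h1
      have hm : z ∈ halfGraph (ε / κ) (g (s i, true)) :=
        ⟨h0, h1.le, by rw [← hpos (s i) _ h0.le]; exact h2⟩
      obtain ⟨h3, h4, h5⟩ := hinv.back (i, true) z hm hlt
      exact ⟨mem_openArc_of_mem_halfGraph (hgraph _) (hgr i _ h3) h5, h4⟩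
  · rcases le_total 0 x with h0 | h0
    · rw [hpos i x h0]
      exact hgκ _ x
    · rw [hneg i x h0, ← abs_neg x]
      exact hgκ _ (-x)

/-! ### The circle map in a strip coordinate -/

section

/-- A circle map `k` in the coordinate `Θ` near the unit circle, in which it is given by the strip
map `f`. -/
structure Model (d : ℕ) (k : Circle → Circle) (π : ℝ → Circle) (f G Θ : ℂ → ℂ) (R : ℝ) : Prop where
  two_le : 2 ≤ d
  mem_F : k ∈ F d
  finite : (Par k).Finite
  map_par : ∀ p ∈ Par k, k p ∈ Par k
  strip : StripMap d R (1 / 2) f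
  inv : StripInv f G R (1 / 2 * (R / 2))
  chart : Chart 1 R Θ
  coe : ∀ x, (π x : ℂ) = Θ x
  surjective : Function.Surjective π
  semiconj : ∀ x : ℝ, k (π x) = π (f x).re
  norm_lt : ∀ z ∈ ParabolicExternal.strip R, ‖Θ z‖ < 1 ↔ z.im < 0
  map_conj : ∀ z ∈ ParabolicExternal.strip R, reflection (Θ z) = Θ (conj z)
  one_le : ∀ x : ℝ, 1 ≤ (deriv f x).re
  mem_par_iff : ∀ x : ℝ, π x ∈ Par k ↔ deriv f x = 1

namespace Model

variable {d : ℕ} {k : Circle → Circle} {π : ℝ → Circle} {f G Θ : ℂ → ℂ} {R : ℝ}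

theorem R_pos (m : Model d k π f G Θ R) : 0 < R := m.strip.R_pos

theorem ofReal_re (m : Model d k π f G Θ R) (x : ℝ) : ((f x).re : ℂ) = f x :=
  Complex.ext (by simp) (by simp [m.strip.im_ofReal])

theorem hasDerivAt_real (m : Model d k π f G Θ R) (x : ℝ) :
    HasDerivAt (fun x : ℝ => (f x).re) (deriv f x).re x :=
  (hasDerivAt_ofReal_of_complex (fun x => (m.ofReal_re x).symm)
    (m.strip.analyticAt (ofReal_mem_strip m.R_pos x)).differentiableAt).1

theorem deriv_im (m : Model d k π f G Θ R) (x : ℝ) : (deriv f x).im = 0 :=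
  (hasDerivAt_ofReal_of_complex (H := fun x => (f x).re) (fun x => (m.ofReal_re x).symm)
    (m.strip.analyticAt (ofReal_mem_strip m.R_pos x)).differentiableAt).2

theorem one_lt (m : Model d k π f G Θ R) {x : ℝ} (hx : π x ∉ Par k) : 1 < (deriv f x).re := by
  refine lt_of_le_of_ne (m.one_le x) fun h => hx ?_
  rw [m.mem_par_iff]
  exact Complex.ext h.symm (m.deriv_im x)

theorem π_eq_iff (m : Model d k π f G Θ R) {x y : ℝ} : π x = π y ↔ ∃ n : ℤ, x = y + n := by
  rw [← Circle.coe_inj, m.coe, m.coe,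
    m.chart.eq_iff _ (ofReal_mem_strip m.R_pos x) _ (ofReal_mem_strip m.R_pos y)]
  refine exists_congr fun n => ?_
  simp only [Nat.cast_one, one_mul]
  norm_cast

/-- Since `f' ≥ 1`, the function `f - id` is monotone. If it were constant on an interval, all
points there would be parabolic, against finiteness. This gives repulsion on both sides of a
parabolic point. -/
theorem sub_lt_sub (m : Model d k π f G Θ R) {x y : ℝ} (hxy : x < y) :
    y - x < (f y).re - (f x).re := by
  have hd : ∀ u : ℝ, HasDerivAt (fun u : ℝ => (f u).re - u) ((deriv f u).re - 1) u := fun u =>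
    (m.hasDerivAt_real u).sub (hasDerivAt_id u)
  have hmono : Monotone fun u : ℝ => (f u).re - u :=
    monotone_of_deriv_nonneg (fun u => (hd u).differentiableAt) fun u => by
      rw [(hd u).deriv]; linarith [m.one_le u]
  by_contra! hle
  have heq : (f y).re - y = (f x).re - x := le_antisymm (by linarith) (hmono hxy.le)
  have hpar : ∀ u ∈ Ioo x y, π u ∈ Par k := fun u hu => by
    by_contra hu'
    have h1 : (fun u : ℝ => (f u).re - u) =ᶠ[𝓝 u] fun _ => (f x).re - x := by
      filter_upwards [Ioo_mem_nhds hu.1 hu.2] with v hv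
      exact le_antisymm ((hmono hv.2.le).trans heq.le) (hmono hv.1.le)
    have h2 := (hd u).unique ((hasDerivAt_const u ((f x).re - x)).congr_of_eventuallyEq h1)
    linarith [m.one_lt hu']
  have hlt : x < min y (x + 1) := lt_min hxy (by linarith)
  have hinj : InjOn π (Ioo x (min y (x + 1))) := by
    intro u hu v hv huv
    obtain ⟨n, hn⟩ := m.π_eq_iff.mp huv
    have h1 := hu.2.trans_le (min_le_right _ _)
    have h2 := hv.2.trans_le (min_le_right _ _)
    have h3 := hu.1
    have h4 := hv.1
    have h5 : (n : ℝ) < 1 := by linarith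
    have h6 : (-1 : ℝ) < n := by linarith
    have h7 : n < 1 := by exact_mod_cast h5
    have h8 : -1 < n := by exact_mod_cast h6
    have : n = 0 := by omega
    simpa [this] using hn
  refine ((Ioo_infinite hlt).image hinj) (m.finite.subset ?_)
  rintro _ ⟨u, hu, rfl⟩
  exact hpar u ⟨hu.1, hu.2.trans_le (min_le_left _ _)⟩

theorem mem_strip_real (m : Model d k π f G Θ R) (x : ℝ) :
    (x : ℂ) ∈ ParabolicExternal.strip (1 / 2 * (R / 2)) :=
  ofReal_mem_strip (by linarith [m.R_pos]) x

/-- The expression of `k` near the parabolic point `π x`, in coordinates centered at `x` and at its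
image. -/
theorem realGerm (m : Model d k π f G Θ R) {x : ℝ} (hx : π x ∈ Par k) :
    RealGerm (fun z => f (x + z) - (f x).re) (fun z => G ((f x).re + z) - x) := by
  have hxs := ofReal_mem_strip m.R_pos x
  have hys := m.mem_strip_real (f x).re
  have hG := m.inv.differentiableOn m.strip
  have hy : G (f x) = x := m.inv.left m.strip hxs (m.ofReal_re x ▸ hys)
  have hev : ∀ᶠ z in 𝓝 (0 : ℂ), ((f x).re : ℂ) + z ∈ ParabolicExternal.strip (1 / 2 * (R / 2)) := by
    have : Tendsto (fun z : ℂ => ((f x).re : ℂ) + z) (𝓝 0) (𝓝 ((f x).re : ℂ)) := by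
      have : Continuous fun z : ℂ => ((f x).re : ℂ) + z := by fun_prop
      simpa using this.tendsto 0
    exact this.eventually ((isOpen_strip _).mem_nhds hys)
  have hev' : ∀ᶠ z in 𝓝 (0 : ℂ), (x : ℂ) + z ∈ ParabolicExternal.strip R := by
    have : Tendsto (fun z : ℂ => (x : ℂ) + z) (𝓝 0) (𝓝 (x : ℂ)) := by
      have : Continuous fun z : ℂ => (x : ℂ) + z := by fun_prop
      simpa using this.tendsto 0
    exact this.eventually ((isOpen_strip _).mem_nhds hxs)
  refine ⟨⟨?_, ?_, ?_, ?_, ?_, ?_⟩, ?_, ?_, ?_, ?_, ?_⟩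
  · have h1 : AnalyticAt ℂ (fun z : ℂ => (x : ℂ) + z) 0 := by fun_prop
    exact (AnalyticAt.fun_comp (by simpa using m.strip.analyticAt hxs) h1).sub analyticAt_const
  · have h1 : AnalyticAt ℂ (fun z : ℂ => ((f x).re : ℂ) + z) 0 := by fun_prop
    exact (AnalyticAt.fun_comp (by
      simpa using hG.analyticAt ((isOpen_strip _).mem_nhds hys)) h1).sub analyticAt_const
  · rw [add_zero, m.ofReal_re, hy, sub_self]
  · rw [deriv_sub_const, deriv_comp_const_add, add_zero, (m.mem_par_iff x).mp hx]
  · filter_upwards [hev] with z hz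
    rw [add_sub_cancel, m.inv.right _ hz]
    ring
  · filter_upwards [hev] with z hz h0
    rw [sub_im, ofReal_im, sub_zero, m.inv.im_pos_iff m.strip hz]
    simpa using h0
  · simp [m.ofReal_re]
  · filter_upwards [hev'] with z hz
    rw [map_sub, ← m.strip.map_conj _ hz]
    simp
  · filter_upwards [hev] with z hz
    rw [map_sub, ← m.inv.map_conj m.strip hz]
    simp
  · filter_upwards [self_mem_nhdsWithin] with u hu
    have := m.sub_lt_sub (show x < x + u by linarith [show 0 < u from hu])
    push_cast at this
    rw [sub_re, Complex.ofReal_re]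
    linarith
  · filter_upwards [self_mem_nhdsWithin] with u hu
    have := m.sub_lt_sub (show x + u < x by linarith [show u < 0 from hu])
    push_cast at this
    rw [sub_re, Complex.ofReal_re]
    linarith

end Model

end

/-! ### The range and the domain as annuli -/

section

theorem mem_quarter_strip {R ε : ℝ} {z : ℂ} (hz : z ∈ strip ε) (hεR : 8 * ε ≤ R) :
    z ∈ strip (1 / 2 * (R / 2)) := by
  have h : |z.im| < ε := hz
  have := abs_nonneg z.im
  exact strip_mono (by linarith) hz

namespace Model

variable {d : ℕ} {k : Circle → Circle} {π : ℝ → Circle} {f G Θ : ℂ → ℂ} {R ε : ℝ}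

theorem Θ_ne_zero (m : Model d k π f G Θ R) {z : ℂ} (hz : z ∈ ParabolicExternal.strip R) :
    Θ z ≠ 0 := fun h => by
  have h1 := (m.norm_lt z hz).mp (by simp [h])
  have h2 := m.map_conj z hz
  rw [h] at h2
  -- The reflection takes the value `0` at `0`, because division by zero gives `0`. So `z` and `conj
  -- z` would both lie below the real line.
  have h3 := (m.norm_lt (conj z) (conj_mem_strip.mpr hz)).mp (by simp [← h2, reflection])
  rw [conj_im] at h3
  linarith

theorem G_mem (m : Model d k π f G Θ R) {z : ℂ} (hz : z ∈ ParabolicExternal.strip ε)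
    (hεR : 8 * ε ≤ R) : |(G z).im| < 2 * ε := by
  have h1 := m.inv.im_le m.strip (mem_quarter_strip hz hεR)
  have : |z.im| < ε := hz
  linarith

/-- The inverse `G` turns translation by `d` into translation by `1`, under which `Θ` is periodic;
hence the domain is the strip modulo `d`. The condition `8 ε ≤ R` keeps the strip inside the domain
of `G`, of half-width `R / 4`. -/
theorem chart_comp (m : Model d k π f G Θ R) (hε : 0 < ε) (hεR : 8 * ε ≤ R) :
    Chart d ε (Θ ∘ G) := by
  have hs : ∀ z ∈ ParabolicExternal.strip ε, z ∈ ParabolicExternal.strip (1 / 2 * (R / 2)) :=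
    fun z hz => mem_quarter_strip hz hεR
  have hG : ∀ z ∈ ParabolicExternal.strip ε, G z ∈ ParabolicExternal.strip R := fun z hz =>
    m.inv.mem z (hs z hz)
  have hd : ∀ z ∈ ParabolicExternal.strip ε,
      HasDerivAt (Θ ∘ G) (deriv Θ (G z) * (deriv f (G z))⁻¹) z := fun z hz =>
    (m.chart.analyticAt (hG z hz)).differentiableAt.hasDerivAt.comp z
      (m.inv.hasDerivAt m.strip (hs z hz))
  refine ⟨by linarith [m.two_le], hε, fun z hz => (hd z hz).differentiableAt.differentiableWithinAt,
    fun z hz => ?_, fun z hz w hw => ?_⟩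
  · rw [(hd z hz).deriv]
    exact mul_ne_zero (m.chart.deriv_ne_zero _ (hG z hz))
      (inv_ne_zero (m.strip.deriv_ne_zero (hG z hz)))
  · rw [Function.comp_apply, Function.comp_apply, m.chart.eq_iff _ (hG z hz) _ (hG w hw)]
    refine exists_congr fun n => ?_
    simp only [Nat.cast_one, one_mul]
    rw [← m.inv.translate m.strip (hs w hw)]
    have hw' : w + d * n ∈ ParabolicExternal.strip ε := Chart.add_mem_strip hw n
    refine ⟨fun h => ?_, fun h => by rw [h]⟩
    rw [← m.inv.right z (hs z hz), h, m.inv.right _ (hs _ hw')]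

theorem chart_mono (m : Model d k π f G Θ R) (hε : 0 < ε) (hεR : 8 * ε ≤ R) : Chart 1 ε Θ :=
  m.chart.mono hε (by linarith)

theorem mem_range_iff (m : Model d k π f G Θ R) (hε : 0 < ε) (hεR : 8 * ε ≤ R) {z : ℂ}
    (hz : z ∈ ParabolicExternal.strip R) : Θ z ∈ Θ '' ParabolicExternal.strip ε ↔ |z.im| < ε := by
  refine ⟨?_, fun h => ⟨z, h, rfl⟩⟩
  rintro ⟨w, hw, h⟩
  obtain ⟨n, rfl⟩ := (m.chart.eq_iff _ (strip_mono (by linarith) hw) _ hz).mp h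
  simpa [ParabolicExternal.strip] using hw

theorem mem_domain_iff (m : Model d k π f G Θ R) (hεR : 8 * ε ≤ R) {z : ℂ}
    (hz : z ∈ ParabolicExternal.strip R) :
    Θ z ∈ (Θ ∘ G) '' ParabolicExternal.strip ε ↔ |(f z).im| < ε := by
  constructor
  · rintro ⟨w, hw, h⟩
    have hws := mem_quarter_strip hw hεR
    obtain ⟨n, hn⟩ := (m.chart.eq_iff _ (m.inv.mem w hws) _ hz).mp h
    have h1 := m.strip.translate_int n z hz
    rw [Nat.cast_one, one_mul] at hn
    rw [← hn, m.inv.right w hws] at h1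
    have h2 : |w.im| < ε := hw
    rw [h1] at h2
    simpa using h2
  · intro h
    have h1 : f z ∈ ParabolicExternal.strip ε := h
    exact ⟨f z, h1, congrArg Θ (m.inv.left m.strip hz (mem_quarter_strip h1 hεR))⟩

/-- The extension is `Θ (G z) ↦ Θ z`. It is well defined because points with the same image in the
domain differ by a multiple of `d`, an integer translation that `Θ` does not see. -/
theorem exists_extension (m : Model d k π f G Θ R) (hε : 0 < ε) (hεR : 8 * ε ≤ R) :
    ∃ g : ℂ → ℂ, (∀ z ∈ ParabolicExternal.strip ε, g ((Θ ∘ G) z) = Θ z) ∧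
      (∀ z : Circle, g z = k z) ∧ DifferentiableOn ℂ g ((Θ ∘ G) '' ParabolicExternal.strip ε) := by
  have hc := m.chart_comp hε hεR
  have hc1 := m.chart_mono hε hεR
  obtain ⟨g, hg⟩ : ∃ g : ℂ → ℂ, ∀ z ∈ ParabolicExternal.strip ε, g ((Θ ∘ G) z) = Θ z := by
    classical
    have hex : ∀ w ∈ (Θ ∘ G) '' ParabolicExternal.strip ε,
        ∃ z ∈ ParabolicExternal.strip ε, (Θ ∘ G) z = w := fun w hw => hw
    choose! v hv1 hv2 using hex
    refine ⟨fun w => Θ (v w), fun z hz => ?_⟩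
    have hm := mem_image_of_mem (Θ ∘ G) hz
    obtain ⟨n, hn⟩ := (hc.eq_iff _ (hv1 _ hm) _ hz).mp (hv2 _ hm)
    refine (hc1.eq_iff _ (hv1 _ hm) _ hz).mpr ⟨d * n, ?_⟩
    rw [hn]
    push_cast
    ring
  refine ⟨g, hg, fun z => ?_, ?_⟩
  · obtain ⟨x, rfl⟩ := m.surjective z
    have h1 := hg (f x) (m.ofReal_re x ▸ ofReal_mem_strip hε _)
    rw [Function.comp_apply, m.inv.left m.strip (ofReal_mem_strip m.R_pos x)
      (m.ofReal_re x ▸ m.mem_strip_real _), ← m.coe] at h1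
    rw [h1, m.semiconj, m.coe, m.ofReal_re]
  · rintro _ ⟨z, hz, rfl⟩
    refine (differentiableAt_of_comp (F := Θ) (hc.analyticAt hz) (hc.deriv_ne_zero z hz) ?_
      (hc1.analyticAt hz).differentiableAt).differentiableWithinAt
    filter_upwards [(isOpen_strip ε).mem_nhds hz] with y hy
    exact hg y hy

theorem annulus_range (m : Model d k π f G Θ R) (hε : 0 < ε) (hεR : 8 * ε ≤ R) :
    IsSymmetricAnnulus (Θ '' ParabolicExternal.strip ε) := by
  have hc := m.chart_mono hε hεR
  have hs : ParabolicExternal.strip ε ⊆ ParabolicExternal.strip R := strip_mono (by linarith)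
  refine ⟨hc.isOpen_image (isOpen_strip _) subset_rfl, ?_, hc.annular, fun w hw => ?_, ?_⟩
  · rintro ⟨z, hz, h⟩
    exact m.Θ_ne_zero (hs hz) h
  · obtain ⟨x, hx⟩ := m.surjective ⟨w, by simpa [Submonoid.unitSphere] using hw⟩
    refine ⟨x, ofReal_mem_strip hε x, ?_⟩
    rw [← m.coe, hx]
  · rintro _ ⟨z, hz, rfl⟩
    exact ⟨conj z, conj_mem_strip.mpr hz, (m.map_conj z (hs hz)).symm⟩

theorem annulus_domain (m : Model d k π f G Θ R) (hε : 0 < ε) (hεR : 8 * ε ≤ R) :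
    IsSymmetricAnnulus ((Θ ∘ G) '' ParabolicExternal.strip ε) := by
  have hc := m.chart_comp hε hεR
  have hG : ∀ z ∈ ParabolicExternal.strip ε, G z ∈ ParabolicExternal.strip R := fun z hz =>
    m.inv.mem z (mem_quarter_strip hz hεR)
  refine ⟨hc.isOpen_image (isOpen_strip _) subset_rfl, ?_, hc.annular, fun w hw => ?_, ?_⟩
  · rintro ⟨z, hz, h⟩
    exact m.Θ_ne_zero (hG z hz) h
  · obtain ⟨x, hx⟩ := m.surjective ⟨w, by simpa [Submonoid.unitSphere] using hw⟩
    have h1 : w = Θ x := by rw [← m.coe, hx]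
    rw [h1, m.mem_domain_iff hεR (ofReal_mem_strip m.R_pos x), m.strip.im_ofReal, abs_zero]
    exact hε
  · rintro _ ⟨z, hz, rfl⟩
    refine ⟨conj z, conj_mem_strip.mpr hz, ?_⟩
    rw [Function.comp_apply, Function.comp_apply, m.map_conj _ (hG z hz),
      m.inv.map_conj m.strip (mem_quarter_strip hz hεR)]

theorem covering (m : Model d k π f G Θ R) (hε : 0 < ε) (hεR : 8 * ε ≤ R) {g : ℂ → ℂ}
    (hg : ∀ z ∈ ParabolicExternal.strip ε, g ((Θ ∘ G) z) = Θ z)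
    (hgd : DifferentiableOn ℂ g ((Θ ∘ G) '' ParabolicExternal.strip ε)) :
    IsHolomorphicCovering d g ((Θ ∘ G) '' ParabolicExternal.strip ε)
      (Θ '' ParabolicExternal.strip ε) := by
  have hm : MapsTo g ((Θ ∘ G) '' ParabolicExternal.strip ε) (Θ '' ParabolicExternal.strip ε) := by
    rintro _ ⟨z, hz, rfl⟩
    exact ⟨z, hz, (hg z hz).symm⟩
  exact ⟨hgd, ⟨hm, (m.chart_comp hε hεR).isCoveringMap (m.chart_mono hε hεR) hg hm⟩,
    fun w hw => (m.chart_comp hε hεR).ncard_fiber (m.chart_mono hε hεR) hg hw⟩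

end Model

end

/-! ### The dividing arcs in the plane -/

section

/-- The arc with its end points, the graph of `f` over an interval centered at `Q`. -/
def closedArc (X Q : ℝ) (f : ℝ → ℝ) : Set ℂ := {z | |z.re - Q| ≤ X ∧ z.im = f (z.re - Q)}

theorem sub_mem_openArc {X Q : ℝ} {f : ℝ → ℝ} {z : ℂ} {a : ℝ} :
    z - a ∈ openArc X Q f ↔ z ∈ openArc X (Q + a) f := by
  simp [openArc, sub_sub, add_comm]

theorem sub_mem_upperRegion {X ε Q : ℝ} {f : ℝ → ℝ} {z : ℂ} {a : ℝ} :
    z - a ∈ upperRegion X ε Q f ↔ z ∈ upperRegion X ε (Q + a) f := by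
  simp [upperRegion, sub_sub, add_comm]

theorem Chart.image_eq_of_shift {ε : ℝ} {Θ : ℂ → ℂ} (hΘ : Chart 1 ε Θ) {S T : Set ℂ} {n : ℤ}
    (hT : T ⊆ strip ε) (h : ∀ z : ℂ, z - (n : ℝ) ∈ S ↔ z ∈ T) : Θ '' S = Θ '' T := by
  have hn : ∀ z ∈ strip ε, ∀ m : ℤ, Θ (z + m) = Θ z := fun z hz m => by
    simpa using hΘ.map_add hz m
  ext w
  constructor
  · rintro ⟨z, hz, rfl⟩
    have h1 : z + n ∈ T := (h _).mp (by simpa using hz)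
    refine ⟨z + n, h1, ?_⟩
    have := hn _ (hT h1) (-n)
    push_cast at this
    rw [← this, add_neg_cancel_right]
  · rintro ⟨z, hz, rfl⟩
    refine ⟨z - (n : ℝ), (h z).mpr hz, ?_⟩
    have := hn _ (hT hz) (-n)
    push_cast at this
    simpa [sub_eq_add_neg] using this

/-- A model with a system of arcs through the points `P i`, the lifts of the parabolic points. -/
structure ArcModel (d : ℕ) (k : Circle → Circle) (π : ℝ → Circle) (f G Θ : ℂ → ℂ) (R : ℝ)
    (P : Par k → ℝ) (s : Par k → Par k) (X ε : ℝ) (φ : Par k → ℝ → ℝ) (c : Par k → ℝ → ℂ) :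
    Prop extends Model d k π f G Θ R where
  coe_s : ∀ i, (s i : Circle) = k i
  π_P : ∀ i, π (P i) = i
  system : ArcSystem s (fun i z => f (P i + z) - (f (P i)).re)
    (fun i z => G ((f (P i)).re + z) - P i) X ε φ c
  ε_pos : 0 < ε
  ε_le : 8 * ε ≤ R

namespace ArcModel

variable {d : ℕ} {k : Circle → Circle} {π : ℝ → Circle} {f G Θ : ℂ → ℂ} {R : ℝ} {P : Par k → ℝ}
  {s : Par k → Par k} {X ε : ℝ} {φ : Par k → ℝ → ℝ} {c : Par k → ℝ → ℂ}

theorem closedArc_subset (m : ArcModel d k π f G Θ R P s X ε φ c) (i : Par k) (Q : ℝ) :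
    closedArc X Q (φ i) ⊆ ParabolicExternal.strip R := fun z hz => by
  have h1 := (m.system.graph i).le (z.re - Q)
  have h2 := (m.system.graph i).nonneg (z.re - Q)
  have h3 := m.ε_le
  have h4 := m.ε_pos
  have h5 : |z.im| ≤ ε := by rw [hz.2, abs_of_nonneg h2]; exact h1
  exact lt_of_le_of_lt h5 (by linarith)

theorem mem_openArc (m : ArcModel d k π f G Θ R P s X ε φ c) {i : Par k} {Q : ℝ} {z : ℂ}
    (hz : z ∈ closedArc X Q (φ i)) (h : z.im < ε) : z ∈ openArc X Q (φ i) := by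
  refine ⟨lt_of_le_of_ne hz.1 fun he => ?_, hz.2⟩
  rw [hz.2, (m.system.graph i).eq_of_le _ he.ge] at h
  exact h.false

theorem openArc_subset_closedArc {Q : ℝ} {f : ℝ → ℝ} : openArc X Q f ⊆ closedArc X Q f :=
  fun _ hz => ⟨hz.1.le, hz.2⟩

theorem add_mem_closedArc (m : ArcModel d k π f G Θ R P s X ε φ c) (i : Par k) {t : ℝ}
    (ht : t ∈ Icc (-1 : ℝ) 1) : P i + c i t ∈ closedArc X (P i) (φ i) := by
  have : c i t ∈ c i '' Icc (-1) 1 := mem_image_of_mem _ ht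
  rw [(m.system.curve i).image] at this
  simpa [closedArc] using this

theorem trace_eq (m : ArcModel d k π f G Θ R P s X ε φ c) (i : Par k) :
    trace (fun t => Θ (P i + c i t)) = Θ '' closedArc X (P i) (φ i) := by
  ext w
  constructor
  · rintro ⟨t, ht, rfl⟩
    exact mem_image_of_mem _ (m.add_mem_closedArc i ht)
  · rintro ⟨z, hz, rfl⟩
    have h1 : z - (P i : ℝ) ∈ c i '' Icc (-1) 1 := by
      rw [(m.system.curve i).image]
      simpa [closedArc] using hz
    obtain ⟨t, ht, h⟩ := h1
    exact ⟨t, ht, by simp only [h, add_sub_cancel]⟩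

theorem trace_inter_range (m : ArcModel d k π f G Θ R P s X ε φ c) (i : Par k) :
    trace (fun t => Θ (P i + c i t)) ∩ Θ '' ParabolicExternal.strip ε =
      Θ '' openArc X (P i) (φ i) := by
  rw [m.trace_eq]
  ext w
  constructor
  · rintro ⟨⟨z, hz, rfl⟩, hw⟩
    rw [m.mem_range_iff m.ε_pos m.ε_le (m.closedArc_subset i _ hz)] at hw
    exact mem_image_of_mem _ (m.mem_openArc hz ((le_abs_self _).trans_lt hw))
  · rintro ⟨z, hz, rfl⟩
    exact ⟨mem_image_of_mem _ (openArc_subset_closedArc hz),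
      mem_image_of_mem _ ((m.system.graph i).openArc_subset _ hz)⟩

theorem f_mem_openArc (m : ArcModel d k π f G Θ R P s X ε φ c) (i : Par k) {z : ℂ}
    (hz : z ∈ closedArc X (P i) (φ i)) (h : (f z).im < ε) :
    f z ∈ openArc X (f (P i)).re (φ (s i)) := by
  have h1 := m.system.fwd i (z - (P i : ℝ)) (by simpa using hz.1) (by simpa using hz.2)
    (by simpa using h)
  simp only [add_sub_cancel] at h1
  simpa using sub_mem_openArc.mp h1

theorem G_mem_openArc (m : ArcModel d k π f G Θ R P s X ε φ c) (i : Par k) {w : ℂ}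
    (hw : w ∈ openArc X (f (P i)).re (φ (s i))) : G w ∈ openArc X (P i) (φ i) := by
  have h1 := (m.system.back i (w - ((f (P i)).re : ℝ))
    (sub_mem_openArc.mpr (by simpa using hw))).1
  simp only [add_sub_cancel] at h1
  simpa using sub_mem_openArc.mp h1

theorem trace_inter_domain (m : ArcModel d k π f G Θ R P s X ε φ c) (i : Par k) :
    trace (fun t => Θ (P i + c i t)) ∩ (Θ ∘ G) '' ParabolicExternal.strip ε =
      (Θ ∘ G) '' openArc X (f (P i)).re (φ (s i)) := by
  rw [m.trace_eq]
  ext w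
  constructor
  · rintro ⟨⟨z, hz, rfl⟩, hw⟩
    have hzs := m.closedArc_subset i _ hz
    rw [m.mem_domain_iff m.ε_le hzs] at hw
    refine ⟨f z, m.f_mem_openArc i hz ((le_abs_self _).trans_lt hw), ?_⟩
    exact congrArg Θ (m.inv.left m.strip hzs (mem_quarter_strip hw m.ε_le))
  · rintro ⟨w, hw, rfl⟩
    exact ⟨mem_image_of_mem _ (openArc_subset_closedArc (m.G_mem_openArc i hw)),
      mem_image_of_mem _ ((m.system.graph _).openArc_subset _ hw)⟩

theorem exists_int (m : ArcModel d k π f G Θ R P s X ε φ c) (i : Par k) :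
    ∃ n : ℤ, (f (P i)).re = P (s i) + n := by
  rw [← m.π_eq_iff, ← m.semiconj, m.π_P, m.π_P, m.coe_s]

theorem image_openArc (m : ArcModel d k π f G Θ R P s X ε φ c) (i : Par k) :
    Θ '' openArc X (P (s i)) (φ (s i)) = Θ '' openArc X (f (P i)).re (φ (s i)) := by
  obtain ⟨n, hn⟩ := m.exists_int i
  rw [hn]
  exact (m.chart_mono m.ε_pos m.ε_le).image_eq_of_shift ((m.system.graph _).openArc_subset _)
    fun z => sub_mem_openArc

theorem image_upperRegion (m : ArcModel d k π f G Θ R P s X ε φ c) (i : Par k) :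
    Θ '' upperRegion X ε (P (s i)) (φ (s i)) = Θ '' upperRegion X ε (f (P i)).re (φ (s i)) := by
  obtain ⟨n, hn⟩ := m.exists_int i
  rw [hn]
  exact (m.chart_mono m.ε_pos m.ε_le).image_eq_of_shift ((m.system.graph _).upperRegion_subset _)
    fun z => sub_mem_upperRegion

theorem one_le_norm (m : ArcModel d k π f G Θ R P s X ε φ c) (i : Par k) {z : ℂ}
    (hz : z ∈ closedArc X (P i) (φ i)) : 1 ≤ ‖Θ z‖ := by
  by_contra! h
  rw [m.norm_lt z (m.closedArc_subset i _ hz), hz.2] at h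
  exact h.not_ge ((m.system.graph i).nonneg _)

theorem mem_frontier (m : ArcModel d k π f G Θ R P s X ε φ c) {z : ℂ} (hz : z.im = ε) :
    Θ z ∈ frontier (Θ '' ParabolicExternal.strip ε) := by
  have hε := m.ε_pos
  have hεR := m.ε_le
  have hzs : z ∈ ParabolicExternal.strip R := by
    change |z.im| < R
    rw [hz, abs_of_pos hε]
    linarith
  rw [((m.chart_mono hε hεR).isOpen_image (isOpen_strip _) subset_rfl).frontier_eq]
  refine ⟨?_, ?_⟩
  · have hcl : z ∈ closure (ParabolicExternal.strip ε) := by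
      have h1 : Tendsto (fun t : ℝ => z - t * I) (𝓝[>] 0) (𝓝 z) := by
        have : Continuous fun t : ℝ => z - t * I := by fun_prop
        have h2 := this.tendsto 0
        simp only [ofReal_zero, zero_mul, sub_zero] at h2
        exact h2.mono_left nhdsWithin_le_nhds
      refine mem_closure_of_tendsto h1 ?_
      filter_upwards [Ioo_mem_nhdsGT hε] with t ht
      change |(z - t * I).im| < ε
      rw [abs_lt]
      simp [hz]
      constructor <;> linarith [ht.1, ht.2]
    exact (m.chart.analyticAt hzs).continuousAt.continuousWithinAt.mem_closure_image hcl
  · rw [m.mem_range_iff hε hεR hzs, hz, abs_of_pos hε]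
    exact lt_irrefl ε

theorem isArcThrough (m : ArcModel d k π f G Θ R P s X ε φ c) (i : Par k) :
    IsArcThrough (Θ '' ParabolicExternal.strip ε) i fun t => Θ (P i + c i t) := by
  have hcurve := m.system.curve i
  have hmem := fun {t} => m.add_mem_closedArc i (t := t)
  have han : ∀ t ∈ Icc (-1 : ℝ) 1, AnalyticAt ℂ Θ (P i + c i t) := fun t ht =>
    m.chart.analyticAt (m.closedArc_subset i _ (hmem ht))
  have hsub : ∀ t ∈ Ioo (-1 : ℝ) 1, t ∈ Icc (-1 : ℝ) 1 := fun t ht => Ioo_subset_Icc_self ht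
  refine ⟨fun t ht => ?_, fun t ht u hu h => ?_, ?_, fun t ht => ?_, ?_, ?_, fun t ht => ?_,
    fun t ht => ?_, fun t ht => ?_⟩
  · have h1 : ContinuousWithinAt (fun t => (P i : ℂ) + c i t) (Icc (-1) 1) t :=
      continuousWithinAt_const.add (hcurve.continuousOn t ht)
    exact ContinuousAt.comp_continuousWithinAt (g := Θ) (f := fun t => (P i : ℂ) + c i t)
      (han t ht).continuousAt h1
  · obtain ⟨n, hn⟩ := (m.chart.eq_iff _ (m.closedArc_subset i _ (hmem ht)) _
      (m.closedArc_subset i _ (hmem hu))).mp h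
    have h1 := (hmem ht).1
    have h2 := (hmem hu).1
    have hX := (m.system.graph i).X_le
    have h3 := congrArg re hn
    simp only [Nat.cast_one, one_mul, add_re, intCast_re] at h3
    rw [abs_le] at h1 h2
    simp only [add_re, Complex.ofReal_re] at h1 h2
    have h5 : (n : ℝ) < 1 := by linarith
    have h6 : (-1 : ℝ) < n := by linarith
    have h7 : n < 1 := by exact_mod_cast h5
    have h8 : -1 < n := by exact_mod_cast h6
    have h9 : n = 0 := by omega
    refine hcurve.strictMonoOn.injOn ht hu ?_
    simpa [h9] using h3
  · rw [hcurve.zero, add_zero, ← m.coe, m.π_P]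
  · refine mem_image_of_mem _ ((m.system.graph i).openArc_subset (P i) ?_)
    refine ⟨?_, (hmem (hsub t ht)).2⟩
    have h1 := hcurve.strictMonoOn (left_mem_Icc.mpr (by norm_num)) (hsub t ht) ht.1
    have h2 := hcurve.strictMonoOn (hsub t ht) (right_mem_Icc.mpr (by norm_num)) ht.2
    simp only [hcurve.left, hcurve.right] at h1 h2
    rw [abs_lt]
    simpa using ⟨h1, h2⟩
  · exact m.mem_frontier (by simp [hcurve.left])
  · exact m.mem_frontier (by simp [hcurve.right])
  · rw [mem_ball_zero_iff, not_lt]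
    exact m.one_le_norm i (hmem ht)
  · have h1 : ContDiffAt ℝ ∞ Θ (P i + c i t) :=
      ((han t ht.1).contDiffAt (n := ∞)).restrict_scalars ℝ
    exact (h1.comp t (contDiffAt_const.add (hcurve.smooth t ht))).contDiffWithinAt
  · have h1 : HasDerivAt (fun t => P i + c i t) (deriv (c i) t) t :=
      (((hcurve.smooth t ht).differentiableAt (by simp)).hasDerivAt).const_add _
    have h2 := ((han t ht.1).differentiableAt.hasDerivAt).comp t h1
    have h3 := h2.hasDerivWithinAt (s := Icc (-1) 1)
    rw [show (fun t => Θ (P i + c i t)) = Θ ∘ fun t => P i + c i t from rfl,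
      h3.derivWithin (uniqueDiffOn_Icc (by norm_num) t ht.1)]
    refine mul_ne_zero (m.chart.deriv_ne_zero _ (m.closedArc_subset i _ (hmem ht.1))) fun h => ?_
    have := hcurve.deriv_re t ht
    rw [h] at this
    simp at this

end ArcModel

end

/-! ### Correspondence of the regions cut off by the arcs -/

section

namespace ArcModel

variable {d : ℕ} {k : Circle → Circle} {π : ℝ → Circle} {f G Θ : ℂ → ℂ} {R : ℝ} {P : Par k → ℝ}
  {s : Par k → Par k} {X ε : ℝ} {φ : Par k → ℝ → ℝ} {c : Par k → ℝ → ℂ}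

theorem upperRegion_subset (m : ArcModel d k π f G Θ R P s X ε φ c) (i : Par k) (Q : ℝ) :
    upperRegion X ε Q (φ i) ⊆ ParabolicExternal.strip R :=
  ((m.system.graph i).upperRegion_subset Q).trans (strip_mono (by linarith [m.ε_le, m.ε_pos]))

/-- Descend vertically from `f z` to the real line and follow the image under `G`. It starts at `z`,
above the arc, and ends on the real line, not above it, so it crosses the arc. By invariance the
crossing is carried by `f` to the arc of `s i`, vertically below `f z`. -/
theorem f_mem_upperRegion (m : ArcModel d k π f G Θ R P s X ε φ c) (i : Par k) {z : ℂ}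
    (hz : z ∈ upperRegion X ε (P i) (φ i)) (h : |(f z).im| < ε) :
    f z ∈ upperRegion X ε (f (P i)).re (φ (s i)) := by
  have hzs := m.upperRegion_subset i _ hz
  have hG : G (f z) = z := m.inv.left m.strip hzs (mem_quarter_strip h m.ε_le)
  have hφ := m.system.graph i
  set w := f z with hw
  have hb : 0 < w.im := (m.strip.im_pos_iff hzs).mpr ((hφ.nonneg _).trans_lt hz.2.1)
  have hbε : w.im < ε := (le_abs_self _).trans_lt h
  set v : ℝ → ℂ := fun t => w.re + t * I with hv
  have hvb : v w.im = w := re_add_im w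
  have hvim : ∀ t, (v t).im = t := fun t => ofReal_add_ofReal_mul_I_im _ _
  have hvre : ∀ t, (v t).re = w.re := fun t => ofReal_add_ofReal_mul_I_re _ _
  have hvs : ∀ t ∈ Icc 0 w.im, v t ∈ ParabolicExternal.strip (1 / 2 * (R / 2)) := fun t ht => by
    refine mem_quarter_strip (ε := ε) ?_ m.ε_le
    change |(v t).im| < ε
    rw [hvim, abs_of_nonneg ht.1]
    exact ht.2.trans_lt hbε
  have hd : ∀ t ∈ Icc 0 w.im, HasDerivAt (fun t => G (v t)) ((deriv f (G (v t)))⁻¹ * I) t :=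
    fun t ht => by
      have h1 : HasDerivAt v I t :=
        (((ofRealCLM.hasDerivAt (x := t)).mul_const I).const_add (w.re : ℂ)).congr_deriv (by simp)
      exact (m.inv.hasDerivAt m.strip (hvs t ht)).comp t h1
  -- Along the path the height of `G` is monotone, so the crossing lies below the height of `z` and
  -- hence below `ε`. There the graph of `φ i` is the actual arc, not its constant extension.
  have hmono : StrictMonoOn (fun t => (G (v t)).im) (Icc 0 w.im) := by
    refine strictMonoOn_of_hasDerivAt_pos (convex_Icc _ _)
      (fun t ht => (hasDerivAt_re_im (hd t ht)).2) fun t ht => ?_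
    have h1 := m.inv.mem _ (hvs t ht)
    have h2 := m.strip.deriv_re _ h1
    have h3 : 0 < normSq (deriv f (G (v t))) := normSq_pos.mpr (m.strip.deriv_ne_zero h1)
    simp only [mul_I_im, inv_re]
    exact div_pos (by linarith) h3
  have hcont : ContinuousOn (fun t => (G (v t)).im - φ i ((G (v t)).re - P i)) (Icc 0 w.im) := by
    have h1 : ContinuousOn (fun t => G (v t)) (Icc 0 w.im) := fun t ht =>
      (hd t ht).continuousAt.continuousWithinAt
    exact (continuous_im.comp_continuousOn h1).sub (hφ.continuous.comp_continuousOn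
      ((continuous_re.comp_continuousOn h1).sub continuousOn_const))
  have h0 : (G (v 0)).im - φ i ((G (v 0)).re - P i) ≤ 0 := by
    have h1 : conj (G (v 0)) = G (v 0) := by
      rw [← m.inv.map_conj m.strip (hvs 0 ⟨le_rfl, hb.le⟩)]
      simp [hv]
    rw [conj_eq_iff_im.mp h1]
    linarith [hφ.nonneg ((G (v 0)).re - P i)]
  have h1 : 0 < (G (v w.im)).im - φ i ((G (v w.im)).re - P i) := by
    rw [hvb, hG]
    linarith [hz.2.1]
  obtain ⟨t, ht, hteq⟩ := intermediate_value_Icc hb.le hcont ⟨h0, h1.le⟩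
  simp only at hteq
  have htne : t ≠ w.im := fun h => by
    rw [h] at hteq
    linarith
  have htlt : t < w.im := lt_of_le_of_ne ht.2 htne
  have h2 : (G (v t)).im < ε := by
    have := hmono ht (right_mem_Icc.mpr hb.le) htlt
    simp only [hvb, hG] at this
    exact this.trans hz.2.2
  have h3 : |(G (v t)).re - P i| < X := by
    by_contra! hle
    rw [hφ.eq_of_le _ hle] at hteq
    linarith
  have h4 := m.f_mem_openArc i (z := G (v t)) ⟨h3.le, by linarith⟩ (by
    rw [m.inv.right _ (hvs t ht), hvim]
    linarith)
  rw [m.inv.right _ (hvs t ht)] at h4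
  obtain ⟨h5, h6⟩ := h4
  rw [hvre] at h5 h6
  rw [hvim] at h6
  exact ⟨h5, by rw [← h6]; exact htlt, hbε⟩

theorem mem_domain_upperRegion (m : ArcModel d k π f G Θ R P s X ε φ c) (i : Par k) {w : ℂ}
    (hw : w ∈ Θ '' upperRegion X ε (P i) (φ i))
    (hd : w ∈ (Θ ∘ G) '' ParabolicExternal.strip ε) :
    w ∈ (Θ ∘ G) '' upperRegion X ε (f (P i)).re (φ (s i)) := by
  obtain ⟨z, hz, rfl⟩ := hw
  have hzs := m.upperRegion_subset i _ hz
  rw [m.mem_domain_iff m.ε_le hzs] at hd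
  exact ⟨f z, m.f_mem_upperRegion i hz hd,
    congrArg Θ (m.inv.left m.strip hzs (mem_quarter_strip hd m.ε_le))⟩

theorem divides_range (m : ArcModel d k π f G Θ R P s X ε φ c) (i : Par k) :
    Divides (trace fun t => Θ (P i + c i t)) (Θ '' ParabolicExternal.strip ε)
      (Θ '' lowerRegion 1 ε (P i) (φ i)) (Θ '' upperRegion X ε (P i) (φ i)) :=
  (m.chart_mono m.ε_pos m.ε_le).divides (m.system.graph i) _ (m.trace_inter_range i)

theorem divides_domain (m : ArcModel d k π f G Θ R P s X ε φ c) (i : Par k) :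
    Divides (trace fun t => Θ (P i + c i t)) ((Θ ∘ G) '' ParabolicExternal.strip ε)
      ((Θ ∘ G) '' lowerRegion d ε (f (P i)).re (φ (s i)))
      ((Θ ∘ G) '' upperRegion X ε (f (P i)).re (φ (s i))) :=
  (m.chart_comp m.ε_pos m.ε_le).divides (m.system.graph (s i)) _ (m.trace_inter_domain i)

/-- A point of `W` off the arc that is not in `Ω` is in `Δ`; if it is also in `W'`, it belongs to
`Δ'` by `mem_domain_upperRegion`, which is disjoint from `Ω'`. -/
theorem inter_subset (m : ArcModel d k π f G Θ R P s X ε φ c) (i : Par k) :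
    (ball (0 : ℂ) 1 ∪ (Θ ∘ G) '' lowerRegion d ε (f (P i)).re (φ (s i))) ∩
      (ball (0 : ℂ) 1 ∪ Θ '' ParabolicExternal.strip ε) ⊆
      ball (0 : ℂ) 1 ∪ Θ '' lowerRegion 1 ε (P i) (φ i) := by
  rintro w ⟨h1, h2⟩
  by_cases hb : w ∈ ball (0 : ℂ) 1
  · exact Or.inl hb
  replace h1 := h1.resolve_left hb
  replace h2 := h2.resolve_left hb
  have h3 := (m.divides_domain i).union.subset (Or.inl h1)
  rcases (m.divides_range i).union.symm.subset ⟨h2, h3.2⟩ with h | h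
  · exact Or.inr h
  · exact absurd (m.mem_domain_upperRegion i h h3.1)
      (disjoint_left.mp (m.divides_domain i).disjoint h1)

theorem subset_box (m : ArcModel d k π f G Θ R P s X ε φ c) (i : Par k) (Q : ℝ) :
    upperRegion X ε Q (φ i) ⊆ box Q ε ∧ openArc X Q (φ i) ⊆ box Q ε := by
  have hX := (m.system.graph i).X_le
  exact ⟨fun z hz => ⟨hz.1.trans_le (by linarith), (m.system.graph i).upperRegion_subset Q hz⟩,
    fun z hz => ⟨hz.1.trans_le (by linarith), (m.system.graph i).openArc_subset Q hz⟩⟩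

theorem isBiholomorphic (m : ArcModel d k π f G Θ R P s X ε φ c) {g : ℂ → ℂ}
    (hg : ∀ z ∈ ParabolicExternal.strip ε, g ((Θ ∘ G) z) = Θ z)
    (hgd : DifferentiableOn ℂ g ((Θ ∘ G) '' ParabolicExternal.strip ε)) (i : Par k) :
    IsBiholomorphic g ((Θ ∘ G) '' upperRegion X ε (f (P i)).re (φ (s i)))
      (Θ '' upperRegion X ε (P (s i)) (φ (s i))) := by
  rw [m.image_upperRegion]
  exact (m.chart_mono m.ε_pos m.ε_le).isBiholomorphic (m.chart_comp m.ε_pos m.ε_le) hg hgd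
    (m.subset_box _ _).1

theorem isDiffeo (m : ArcModel d k π f G Θ R P s X ε φ c) {g : ℂ → ℂ}
    (hg : ∀ z ∈ ParabolicExternal.strip ε, g ((Θ ∘ G) z) = Θ z)
    (hgd : DifferentiableOn ℂ g ((Θ ∘ G) '' ParabolicExternal.strip ε)) (i : Par k) :
    IsDiffeo g ((trace fun t => Θ (P i + c i t)) ∩ (Θ ∘ G) '' ParabolicExternal.strip ε)
      ((trace fun t => Θ (P (s i) + c (s i) t)) ∩ Θ '' ParabolicExternal.strip ε) := by
  rw [m.trace_inter_domain, m.trace_inter_range, m.image_openArc]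
  exact (m.chart_mono m.ε_pos m.ε_le).isDiffeo (m.chart_comp m.ε_pos m.ε_le) hg hgd
    (m.subset_box _ _).2

theorem disjoint_trace (m : ArcModel d k π f G Θ R P s X ε φ c) {i j : Par k}
    (h : ∀ n : ℤ, 2 * X < |P i - P j - n|) :
    Disjoint (trace fun t => Θ (P i + c i t)) (trace fun t => Θ (P j + c j t)) := by
  rw [m.trace_eq, m.trace_eq, disjoint_left]
  rintro _ ⟨z, hz, rfl⟩ ⟨w, hw, hwz⟩
  obtain ⟨n, hn⟩ := (m.chart.eq_iff _ (m.closedArc_subset j _ hw) _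
    (m.closedArc_subset i _ hz)).mp hwz
  have h1 := hz.1
  have h2 := hw.1
  have h3 := congrArg re hn
  simp only [Nat.cast_one, one_mul, add_re, intCast_re] at h3
  have h4 := h (-n)
  rw [h3] at h2
  have h5 : P i - P j - ((-n : ℤ) : ℝ) = (z.re + n - P j) - (z.re - P i) := by push_cast; ring
  rw [h5] at h4
  linarith [abs_sub (z.re + n - P j) (z.re - P i)]

end ArcModel

end

/-! ### Compact containment -/

section

/-- The estimates on `f` which hold on thin strips. -/
structure Thin {ι : Type*} (P : ι → ℝ) (f : ℂ → ℂ) (κ r δ ε : ℝ) : Prop where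
  wedge : ∀ i z, 0 < |z.re| → |z.re| < r → 0 < z.im → z.im ≤ 2 * κ * |z.re| →
    z.im < (f (P i + z) - (f (P i)).re).im
  near : ∀ i z, ‖z‖ < δ → ‖f (P i + z) - (f (P i)).re - z‖ ≤ κ / 10 * ‖z‖
  expand : ∀ x y : ℝ, |x| ≤ 1 / 2 → (∀ i, ∀ n : ℤ, r ≤ |x - P i - n|) → |y| ≤ 2 * ε →
    1 < (deriv f (x + y * I)).re
  le_δ : 2 * ε / κ < δ

/-- In the complement of the wedge around the real direction, a point above the level `ε` which
is mapped below the level `ε` is mapped above the arc. -/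
theorem mem_above_arc {κ ε : ℝ} {φ : ℝ → ℝ} {z w : ℂ} (hκ : 0 < κ) (hκ1 : κ ≤ 1 / 2) (hε : 0 < ε)
    (hφ : ∀ x, φ x ≤ κ * |x|) (hz : 2 * κ * |z.re| < z.im) (hw : w.im ≤ ε)
    (h : ‖w - z‖ ≤ κ / 10 * ‖z‖) : |w.re| < ε / κ ∧ φ w.re < w.im := by
  have h0 := abs_nonneg z.re
  have hy : 0 < z.im := lt_of_le_of_lt (by positivity) hz
  have h1 : κ * ‖z‖ ≤ z.im := by
    have := norm_le_abs_re_add_abs_im z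
    rw [abs_of_pos hy] at this
    nlinarith
  have h2 : |w.re - z.re| ≤ z.im / 10 := by
    rw [← sub_re]
    linarith [abs_re_le_norm (w - z)]
  have h3 : |w.im - z.im| ≤ z.im / 10 := by
    rw [← sub_im]
    linarith [abs_im_le_norm (w - z)]
  have h4 : |w.re| ≤ |z.re| + z.im / 10 := by
    have := abs_add_le (w.re - z.re) z.re
    rw [sub_add_cancel] at this
    linarith
  have h5 := (abs_le.mp h3).1
  have h6 : κ * |w.re| < 3 / 5 * z.im := by nlinarith
  constructor
  · rw [lt_div_iff₀ hκ]
    nlinarith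
  · exact (hφ _).trans_lt (by linarith)

theorem closure_image_subset {S : Set ℂ} {A : Set ℂ} {Θ : ℂ → ℂ} (hS : IsCompact S)
    (hc : ContinuousOn Θ S) (hA : A ⊆ Θ '' S) : closure A ⊆ Θ '' S :=
  closure_minimal hA (hS.image_of_continuousOn hc).isClosed

namespace ArcModel

variable {d : ℕ} {k : Circle → Circle} {π : ℝ → Circle} {f G Θ : ℂ → ℂ} {R : ℝ} {P : Par k → ℝ}
  {s : Par k → Par k} {X ε : ℝ} {φ : Par k → ℝ → ℝ} {c : Par k → ℝ → ℂ}

/-- A fundamental box cut by the closed condition `|Im f| ≤ ε`. Its image contains `W'`, so each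
point of the closure of `W'` has a representative in the strip with `|Im f| ≤ ε`. -/
theorem exists_compact (m : ArcModel d k π f G Θ R P s X ε φ c) :
    ∃ S : Set ℂ, IsCompact S ∧ S ⊆ ParabolicExternal.strip R ∧
      (∀ z ∈ S, |z.re| ≤ 1 / 2 ∧ |z.im| ≤ 2 * ε ∧ |(f z).im| ≤ ε) ∧
      (Θ ∘ G) '' ParabolicExternal.strip ε ⊆ Θ '' S := by
  have hε := m.ε_pos
  have hεR := m.ε_le
  set B : Set ℂ := Icc (-(1 / 2)) (1 / 2) ×ℂ Icc (-(2 * ε)) (2 * ε) with hB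
  have hBc : IsCompact B := isCompact_Icc.reProdIm isCompact_Icc
  have hBs : B ⊆ ParabolicExternal.strip R := fun z hz => by
    have : |z.im| ≤ 2 * ε := abs_le.mpr hz.2
    exact this.trans_lt (by linarith)
  have hfc : ContinuousOn (fun z => |(f z).im|) B :=
    (continuous_im.comp_continuousOn (m.strip.differentiableOn.continuousOn.mono hBs)).abs
  refine ⟨B ∩ (fun z => |(f z).im|) ⁻¹' Iic ε,
    hBc.of_isClosed_subset (hfc.preimage_isClosed_of_isClosed hBc.isClosed isClosed_Iic)
      inter_subset_left, inter_subset_left.trans hBs,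
    fun z hz => ⟨abs_le.mpr hz.1.1, abs_le.mpr hz.1.2, hz.2⟩, ?_⟩
  rintro _ ⟨w, hw, rfl⟩
  have hws := mem_quarter_strip hw hεR
  have hGs := m.inv.mem w hws
  have hGim := m.G_mem hw hεR
  obtain ⟨z, hzs, hz, hzre, hzim, n, hn⟩ := m.chart.exists_rep hGs 0
  refine ⟨z, ⟨⟨abs_le.mp (by simpa using hzre), abs_le.mp (by rw [hzim]; exact hGim.le)⟩, ?_⟩, hz⟩
  have h1 := m.strip.translate_int n z hzs
  rw [Nat.cast_one, one_mul] at hn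
  rw [← hn, m.inv.right w hws] at h1
  have h2 : |w.im| < ε := hw
  rw [h1] at h2
  simp only [add_im, mul_im, natCast_re, intCast_im, natCast_im, intCast_re] at h2
  simpa using h2.le

/-- Integrate `Re f' - 1 > 0` along the vertical segment that starts at a real point, where `f` is
real. -/
theorem im_lt_of_far (m : ArcModel d k π f G Θ R P s X ε φ c) {κ r δ : ℝ} (ht : Thin P f κ r δ ε)
    {z : ℂ} (hre : |z.re| ≤ 1 / 2) (him : 0 < z.im) (hle : z.im ≤ 2 * ε)
    (hfar : ∀ i, ∀ n : ℤ, r ≤ |z.re - P i - n|) : z.im < (f z).im := by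
  set v : ℝ → ℂ := fun t => z.re + t * I with hv
  have hvs : ∀ t ∈ Icc 0 z.im, v t ∈ ParabolicExternal.strip R := fun t h => by
    change |(v t).im| < R
    rw [show (v t).im = t from ofReal_add_ofReal_mul_I_im _ _, abs_of_nonneg h.1]
    linarith [h.2, m.ε_le, m.ε_pos]
  have hd : ∀ t ∈ Icc 0 z.im, HasDerivAt (fun t => (f (v t)).im - t) ((deriv f (v t)).re - 1) t :=
    fun t h => by
      have h1 : HasDerivAt v I t :=
        (((ofRealCLM.hasDerivAt (x := t)).mul_const I).const_add (z.re : ℂ)).congr_deriv (by simp)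
      have h2 := (m.strip.analyticAt (hvs t h)).differentiableAt.hasDerivAt.comp t h1
      have h3 := (hasDerivAt_re_im h2).2.sub (hasDerivAt_id t)
      rw [mul_I_im] at h3
      exact h3
  have hmono := strictMonoOn_of_hasDerivAt_pos (convex_Icc _ _) hd fun t h => by
    have := ht.expand z.re t hre hfar (by rw [abs_of_nonneg h.1]; exact h.2.trans hle)
    linarith
  have h1 := hmono (left_mem_Icc.mpr him.le) (right_mem_Icc.mpr him.le) him
  simp only [hv, re_add_im, ofReal_zero, zero_mul, add_zero, m.strip.im_ofReal, sub_zero] at h1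
  linarith

/-- A point `z` of the closure outside `W` and the disc has height at least `ε`, while `f z` has
height at most `ε`. Far from the parabolic points, or in a flat wedge at one of them, `f` raises
heights strictly, which is a contradiction. In the remaining cone `f` is nearly the identity and
puts `z` above an arc; this is an open condition, so it would hold at points of `A` too. -/
theorem compactlyContained (m : ArcModel d k π f G Θ R P s X ε φ c) {κ r δ : ℝ} (hκ : 0 < κ)
    (hκ1 : κ ≤ 1 / 2) (hX : X = ε / κ) (hφ : ∀ i x, φ i x ≤ κ * |x|) (ht : Thin P f κ r δ ε)
    {A : Set ℂ} (hA : A ⊆ (Θ ∘ G) '' ParabolicExternal.strip ε)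
    (hdisj : ∀ i, Disjoint A ((Θ ∘ G) '' upperRegion X ε (f (P i)).re (φ (s i)))) :
    CompactlyContained (A ∪ ball (0 : ℂ) 1) (Θ '' ParabolicExternal.strip ε ∪ ball (0 : ℂ) 1) := by
  obtain ⟨S, hS, hSR, hSb, hSim⟩ := m.exists_compact
  have hε := m.ε_pos
  have hΘc : ContinuousOn Θ S := m.chart.differentiableOn.continuousOn.mono hSR
  have hcl := closure_image_subset hS hΘc (hA.trans hSim)
  rw [CompactlyContained, closure_union, closure_ball _ one_ne_zero]
  refine ⟨((hS.image_of_continuousOn hΘc).of_isClosed_subset isClosed_closure hcl).union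
    (isCompact_closedBall 0 1), union_subset (fun w hw => ?_) fun w hw => ?_⟩
  swap
  · rw [← ball_union_sphere] at hw
    rcases hw with hw | hw
    · exact Or.inr hw
    · exact Or.inl ((m.annulus_range m.ε_pos m.ε_le).circle_subset hw)
  by_contra hnot
  obtain ⟨z, hz, rfl⟩ := hcl hw
  obtain ⟨hre, him, hfim⟩ := hSb z hz
  have hzs := hSR hz
  have h1 : Θ z ∉ Θ '' ParabolicExternal.strip ε := fun h => hnot (Or.inl h)
  have h2 : ¬ ‖Θ z‖ < 1 := fun h => hnot (Or.inr (mem_ball_zero_iff.mpr h))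
  rw [m.mem_range_iff hε m.ε_le hzs, not_lt] at h1
  rw [m.norm_lt z hzs, not_lt] at h2
  rw [abs_of_nonneg h2] at h1 him
  have hpos : 0 < z.im := hε.trans_le h1
  have hfle : (f z).im ≤ ε := (le_abs_self _).trans hfim
  by_cases hfar : ∀ i, ∀ n : ℤ, r ≤ |z.re - P i - n|
  · exact absurd (m.im_lt_of_far ht hre hpos him hfar) (not_lt.mpr (hfle.trans h1))
  push Not at hfar
  obtain ⟨i, n, hr⟩ := hfar
  have hshift : ∀ y ∈ ParabolicExternal.strip R, f (y - n) = f y - d * n := fun y hy => by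
    have := m.strip.translate_int (-n) y hy
    push_cast at this
    rw [sub_eq_add_neg, this]
    ring
  set ζ : ℂ := z - (P i : ℝ) - n with hζ
  have hζre : ζ.re = z.re - P i - n := by simp [hζ]
  have hζim : ζ.im = z.im := by simp [hζ]
  have hPζ : (P i : ℂ) + ζ = z - n := by rw [hζ]; ring
  have hF : f (P i + ζ) = f z - d * n := by rw [hPζ, hshift z hzs]
  have hFim : (f (P i + ζ) - (f (P i)).re).im = (f z).im := by rw [hF]; simp
  -- The wedge has twice the slope that bounds the arcs. This leaves room, outside it, for the error
  -- of `f` as an approximation of the identity.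
  rcases le_or_gt ζ.im (2 * κ * |ζ.re|) with hwedge | hwedge
  · have h0 : 0 < |ζ.re| := by
      by_contra! h0
      have : |ζ.re| = 0 := le_antisymm h0 (abs_nonneg _)
      rw [this, hζim] at hwedge
      linarith
    have := ht.wedge i ζ h0 (by rwa [hζre]) (by rwa [hζim]) hwedge
    rw [hFim, hζim] at this
    linarith
  · have hnorm : ‖ζ‖ < δ := by
      refine lt_of_le_of_lt ?_ ht.le_δ
      rw [le_div_iff₀ hκ]
      have h3 := norm_le_abs_re_add_abs_im ζ
      rw [hζim, abs_of_pos hpos] at h3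
      rw [hζim] at hwedge
      nlinarith [abs_nonneg ζ.re]
    have hab := mem_above_arc hκ hκ1 hε (hφ (s i)) hwedge (by rw [hFim]; exact hfle)
      (ht.near i ζ hnorm)
    rw [hF] at hab
    have hcont : ContinuousAt (fun y => f y - d * n - (f (P i)).re) z :=
      ((m.strip.analyticAt hzs).continuousAt.sub continuousAt_const).sub continuousAt_const
    have hopen : IsOpen {u : ℂ | |u.re| < ε / κ ∧ φ (s i) u.re < u.im} := by
      have := (m.system.graph (s i)).continuous
      have ha : IsOpen {u : ℂ | |u.re| < ε / κ} := isOpen_lt (by fun_prop) (by fun_prop)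
      have hb : IsOpen {u : ℂ | φ (s i) u.re < u.im} := isOpen_lt (by fun_prop) (by fun_prop)
      exact ha.inter hb
    have hev : ∀ᶠ y in 𝓝 z, y ∈ ParabolicExternal.strip R ∧
        f y - d * n - (f (P i)).re ∈ {u : ℂ | |u.re| < ε / κ ∧ φ (s i) u.re < u.im} :=
      Filter.Eventually.and ((isOpen_strip R).mem_nhds hzs) (hcont.eventually (hopen.mem_nhds hab))
    obtain ⟨N, hN, hNo, hzN⟩ := _root_.eventually_nhds_iff.mp hev
    have hNs : N ⊆ ParabolicExternal.strip R := fun y hy => (hN y hy).1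
    -- The limit point itself may be mapped to height exactly `ε`. A nearby point of `A` is mapped
    -- strictly below `ε` and still above the arc, that is, into the region excluded by `hdisj`.
    obtain ⟨_, ⟨y, hy, rfl⟩, hyA⟩ := mem_closure_iff.mp hw _ (m.chart.isOpen_image hNo hNs)
      (mem_image_of_mem _ hzN)
    have hys := hNs hy
    have hyd := hA hyA
    rw [m.mem_domain_iff m.ε_le hys] at hyd
    obtain ⟨h3, h4⟩ := (hN y hy).2
    refine disjoint_left.mp (hdisj i) hyA ⟨f y - d * n, ⟨?_, ?_, ?_⟩, ?_⟩
    · rw [hX]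
      simpa using h3
    · simpa using h4
    · simpa using (le_abs_self _).trans_lt hyd
    · have hyn : y - n ∈ ParabolicExternal.strip R := by
        have h6 : |y.im| < R := hys
        change |(y - n).im| < R
        simpa using h6
      have hfy : f (y - n) ∈ ParabolicExternal.strip ε := by
        rw [hshift y hys]
        change |(f y - d * n).im| < ε
        simpa using hyd
      have h5 := m.chart.map_add hyn n
      rw [Nat.cast_one, one_mul, sub_add_cancel] at h5
      rw [h5, ← hshift y hys]
      exact congrArg Θ (m.inv.left m.strip hyn (mem_quarter_strip hfy m.ε_le))

end ArcModel

end

/-! ### Choice of the constants and assembly -/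

section

theorem ArcModel.isParabolicExternal {d : ℕ} {k : Circle → Circle} {π : ℝ → Circle}
    {f G Θ : ℂ → ℂ} {R : ℝ} {P : Par k → ℝ} {s : Par k → Par k} {X ε : ℝ} {φ : Par k → ℝ → ℝ}
    {c : Par k → ℝ → ℂ} (m : ArcModel d k π f G Θ R P s X ε φ c) {κ r δ : ℝ} (hκ : 0 < κ)
    (hκ1 : κ ≤ 1 / 2) (hX : X = ε / κ) (hφ : ∀ i x, φ i x ≤ κ * |x|) (ht : Thin P f κ r δ ε)
    (hsep : ∀ i j, i ≠ j → ∀ n : ℤ, 2 * X < |P i - P j - n|) :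
    ∃ g W' γ, IsParabolicExternal d k g W' (Θ '' ParabolicExternal.strip ε) γ := by
  obtain ⟨g, hg, hgk, hgd⟩ := m.exists_extension m.ε_pos m.ε_le
  obtain ⟨γ, hγ⟩ : ∃ γ : Circle → ℝ → ℂ, ∀ i : Par k, γ i = fun t => Θ (P i + c i t) :=
    ⟨Function.extend Subtype.val (fun i t => Θ (P i + c i t)) fun _ _ => 0,
      fun i => Subtype.val_injective.extend_apply _ _ i⟩
  have hext : ∀ S : Par k → Set ℂ, ∃ S' : Circle → Set ℂ, ∀ i : Par k, S' i = S i := fun S =>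
    ⟨Function.extend Subtype.val S fun _ => ∅, fun i => Subtype.val_injective.extend_apply _ _ i⟩
  obtain ⟨Ω, hΩ⟩ := hext fun i => Θ '' lowerRegion 1 ε (P i) (φ i)
  obtain ⟨Δ, hΔ⟩ := hext fun i => Θ '' upperRegion X ε (P i) (φ i)
  obtain ⟨Ω', hΩ'⟩ := hext fun i => (Θ ∘ G) '' lowerRegion d ε (f (P i)).re (φ (s i))
  obtain ⟨Δ', hΔ'⟩ := hext fun i => (Θ ∘ G) '' upperRegion X ε (f (P i)).re (φ (s i))
  refine ⟨g, (Θ ∘ G) '' ParabolicExternal.strip ε, γ, m.two_le, m.mem_F, m.finite,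
    m.annulus_domain m.ε_pos m.ε_le, m.annulus_range m.ε_pos m.ε_le, hgk,
    m.covering m.ε_pos m.ε_le hg hgd, fun p hp => ?_, fun p hp q hq hpq => ?_, fun p hp => ?_,
    Ω, Δ, Ω', Δ', fun p hp => ?_, ?_⟩
  · lift p to Par k using hp
    rw [hγ]
    exact m.isArcThrough p
  · lift p to Par k using hp
    lift q to Par k using hq
    rw [hγ, hγ]
    exact m.disjoint_trace (hsep p q fun h => hpq (congrArg Subtype.val h))
  · lift p to Par k using hp
    rw [← m.coe_s, hγ, hγ]
    exact m.isDiffeo hg hgd p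
  · lift p to Par k using hp
    rw [← m.coe_s, hγ, hΩ, hΔ, hΔ, hΩ', hΔ']
    exact ⟨m.divides_range p, m.divides_domain p, m.isBiholomorphic hg hgd p, m.inter_subset p⟩
  · refine m.compactlyContained hκ hκ1 hX hφ ht inter_subset_left fun i => ?_
    refine (m.divides_domain i).disjoint.mono_left ?_
    rw [← hΩ']
    exact inter_subset_right.trans (iInter₂_subset (i : Circle) i.2)

namespace Model

variable {d : ℕ} {k : Circle → Circle} {π : ℝ → Circle} {f G Θ : ℂ → ℂ} {R : ℝ} {P : Par k → ℝ}

theorem exists_near (m : Model d k π f G Θ R) (hP : ∀ i, π (P i) = i) {η : ℝ} (hη : 0 < η) :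
    ∃ δ > 0, ∀ i z, ‖z‖ < δ → ‖f (P i + z) - (f (P i)).re - z‖ ≤ η * ‖z‖ := by
  have := m.finite.to_subtype
  have h : ∀ i : Par k, ∀ᶠ z in 𝓝 (0 : ℂ), ‖f (P i + z) - (f (P i)).re - z‖ ≤ η * ‖z‖ := fun i => by
    have hg := m.realGerm (x := P i) (by rw [hP]; exact i.2)
    have hd := (hasDerivAt_iff_isLittleO.mp hg.analyticF.differentiableAt.hasDerivAt).def hη
    rw [hg.deriv_F] at hd
    filter_upwards [hd] with z hz
    rw [hg.F_zero] at hz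
    simpa using hz
  obtain ⟨δ, hδ, hd⟩ := Metric.eventually_nhds_iff.mp (eventually_all.mpr h)
  exact ⟨δ, hδ, fun i z hz => hd (by simpa using hz) i⟩

/-- Real points at distance at least `r` from the parabolic ones modulo `1` form a compact set in
the unit interval around `0`. There `f' > 1`, and this persists on a complex neighbourhood. -/
theorem exists_expand (m : Model d k π f G Θ R) (hP : ∀ i, π (P i) = i) {r : ℝ} (hr : 0 < r) :
    ∃ η > 0, ∀ x y : ℝ, |x| ≤ 1 / 2 → (∀ i, ∀ n : ℤ, r ≤ |x - P i - n|) → |y| < η →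
      1 < (deriv f (x + y * I)).re := by
  set K : Set ℝ := {x | |x| ≤ 1 / 2 ∧ ∀ i, ∀ n : ℤ, r ≤ |x - P i - n|} with hK
  have hKc : IsCompact K := by
    refine (isCompact_Icc (a := -(1 / 2 : ℝ)) (b := 1 / 2)).of_isClosed_subset ?_
      fun x hx => abs_le.mp hx.1
    have h1 : IsClosed {x : ℝ | |x| ≤ 1 / 2} := isClosed_le (by fun_prop) (by fun_prop)
    have h2 : IsClosed {x : ℝ | ∀ i, ∀ n : ℤ, r ≤ |x - P i - n|} := by
      simp only [ofPred_forall]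
      exact isClosed_iInter fun i => isClosed_iInter fun n =>
        isClosed_le (by fun_prop) (by fun_prop)
    exact h1.inter h2
  have hdc : ContinuousOn (fun z => (deriv f z).re) (ParabolicExternal.strip R) := fun z hz =>
    (continuous_re.continuousAt.comp
      (m.strip.analyticAt hz).deriv.continuousAt).continuousWithinAt
  have hU := hdc.isOpen_inter_preimage (isOpen_strip R) (isOpen_Ioi (a := (1 : ℝ)))
  have hsub : (fun x : ℝ => (x : ℂ)) '' K ⊆
      ParabolicExternal.strip R ∩ (fun z => (deriv f z).re) ⁻¹' Ioi 1 := by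
    rintro _ ⟨x, hx, rfl⟩
    refine ⟨ofReal_mem_strip m.R_pos x, m.one_lt fun hpar => ?_⟩
    obtain ⟨n, hn⟩ := m.π_eq_iff.mp (hP ⟨π x, hpar⟩).symm
    have h1 := hx.2 ⟨π x, hpar⟩ n
    have h2 : x - P ⟨π x, hpar⟩ - n = 0 := by linarith
    rw [h2, abs_zero] at h1
    linarith
  obtain ⟨η, hη, hthick⟩ := (hKc.image continuous_ofReal).exists_thickening_subset_open hU hsub
  refine ⟨η, hη, fun x y hx hfar hy => (hthick ?_).2⟩
  refine mem_thickening_iff.mpr ⟨x, mem_image_of_mem _ ⟨hx, hfar⟩, ?_⟩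
  simpa [dist_eq_norm] using hy

theorem exists_separation (m : Model d k π f G Θ R) (hP : ∀ i, π (P i) = i) :
    ∃ ρ > 0, ∀ i j, i ≠ j → ∀ n : ℤ, ρ ≤ |P i - P j - n| := by
  have := m.finite.to_subtype
  have h : ∀ ij : Par k × Par k, ∃ ρ > 0, ij.1 ≠ ij.2 → ∀ n : ℤ, ρ ≤ |P ij.1 - P ij.2 - n| := by
    rintro ⟨i, j⟩
    by_cases hij : i = j
    · exact ⟨1, one_pos, fun h => absurd hij h⟩
    · refine ⟨|P i - P j - round (P i - P j)|, abs_pos.mpr fun h0 => hij ?_, fun _ n =>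
        round_le _ n⟩
      have h1 : π (P i) = π (P j) := m.π_eq_iff.mpr ⟨round (P i - P j), by linarith⟩
      rw [hP, hP] at h1
      exact Subtype.ext h1
  choose ρ hρ hsep using h
  rcases isEmpty_or_nonempty (Par k × Par k) with he | he
  · exact ⟨1, one_pos, fun i j => (he.false (i, j)).elim⟩
  · obtain ⟨ij, hij⟩ := Finite.exists_min ρ
    exact ⟨ρ ij, hρ ij, fun i j h n => (hij (i, j)).trans (hsep (i, j) h n)⟩

theorem exists_isParabolicExternal (m : Model d k π f G Θ R) :
    ∃ ε₀ > 0, ∀ ε, 0 < ε → ε ≤ ε₀ →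
      ∃ g W' γ, IsParabolicExternal d k g W' (Θ '' ParabolicExternal.strip ε) γ := by
  have := m.finite.to_subtype
  choose P hP using fun i : Par k => m.surjective i
  obtain ⟨κ, hκ, hκ1, r, hr, hwedge, ε₁, hε₁, hsys⟩ :=
    exists_arcSystem (fun i : Par k => (⟨k i, m.map_par i i.2⟩ : Par k))
      fun i => m.realGerm (x := P i) (by rw [hP]; exact i.2)
  obtain ⟨δ, hδ, hnear⟩ := m.exists_near hP (show 0 < κ / 10 by positivity)
  obtain ⟨η, hη, hexp⟩ := m.exists_expand hP hr
  obtain ⟨ρ, hρ, hsep⟩ := m.exists_separation hP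
  have hR := m.R_pos
  -- The bounds give, in order: the arcs exist; `8 ε ≤ R`; `2 ε / κ < δ`, so that points outside the
  -- wedge are near the parabolic point; `2 ε < η`, for the expansion far from these points; and `2
  -- ε / κ < ρ`, so that distinct arcs are disjoint.
  refine ⟨min ε₁ (min (R / 8) (min (κ * δ / 4) (min (η / 4) (κ * ρ / 4)))), by positivity,
    fun ε hε hle => ?_⟩
  simp only [le_min_iff] at hle
  obtain ⟨hle1, hleR, hleδ, hleη, hleρ⟩ := hle
  obtain ⟨φ, c, hsys, hφ⟩ := hsys ε hε hle1
  have hm : ArcModel d k π f G Θ R P (fun i => ⟨k i, m.map_par i i.2⟩) (ε / κ) ε φ c :=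
    { m with
      coe_s := fun _ => rfl
      π_P := hP
      system := hsys
      ε_pos := hε
      ε_le := by linarith }
  refine hm.isParabolicExternal hκ hκ1 rfl hφ (r := r) (δ := δ)
    ⟨hwedge, hnear, fun x y hx hfar hy => hexp x y hx hfar (by linarith), ?_⟩ fun i j hij n => ?_
  · rw [div_lt_iff₀ hκ]
    nlinarith [mul_pos hκ hδ]
  · refine lt_of_lt_of_le ?_ (hsep i j hij n)
    rw [← mul_div_assoc, div_lt_iff₀ hκ]
    nlinarith [mul_pos hκ hρ]

end Model

end

/-! ### The outer coordinate and the main results -/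

section

theorem IsLift.exists_lt_deriv {d : ℕ} {h : Circle → Circle} {H : ℝ → ℝ} (hH : IsLift d h H) :
    ∃ c > 0, ∀ x, c < deriv H x := by
  have hc : Continuous (deriv H) :=
    continuous_iff_continuousAt.mpr fun x => (hH.deriv_analytic x trivial).continuousAt
  obtain ⟨y, -, hy⟩ := (isCompact_Icc (a := (0 : ℝ)) (b := 1)).exists_isMinOn
    (nonempty_Icc.mpr zero_le_one) hc.continuousOn
  refine ⟨deriv H y / 2, half_pos (hH.deriv_pos y), fun x => ?_⟩
  have h1 := hH.deriv_translate_int (Int.fract x) ⌊x⌋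
  rw [Int.fract_add_floor] at h1
  rw [h1]
  have h2 : deriv H y ≤ deriv H (Int.fract x) :=
    hy ⟨Int.fract_nonneg x, (Int.fract_lt_one x).le⟩
  linarith [hH.deriv_pos y]

/-- The coordinate near the unit circle given by the complexification `f` of a lift; it maps the
upper half plane to the outside of the disc. -/
def outerChart (f : ℂ → ℂ) (z : ℂ) : ℂ := exp (2 * Real.pi * I * f (-z))

theorem norm_outerChart (f : ℂ → ℂ) (z : ℂ) :
    ‖outerChart f z‖ = Real.exp (-(2 * Real.pi * (f (-z)).im)) := by
  rw [outerChart, norm_exp]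
  congr 1
  rw [mul_assoc, mul_assoc, ← ofReal_ofNat, re_ofReal_mul, re_ofReal_mul, I_mul_re]
  ring

namespace StripMap

variable {R c : ℝ} {f : ℂ → ℂ}

theorem neg_mem_strip {z : ℂ} (hz : z ∈ strip R) : -z ∈ strip R := by
  have : |z.im| < R := hz
  change |(-z).im| < R
  simpa using this

theorem chart (hf : StripMap 1 R c f) : Chart 1 R (outerChart f) := by
  have hd : ∀ z ∈ strip R, HasDerivAt (outerChart f)
      (exp (2 * Real.pi * I * f (-z)) * (2 * Real.pi * I * -deriv f (-z))) z := fun z hz => by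
    have h1 := (hf.analyticAt (neg_mem_strip hz)).differentiableAt.hasDerivAt.comp z
      (hasDerivAt_neg z)
    rw [mul_neg_one] at h1
    exact (h1.const_mul (2 * Real.pi * I)).cexp
  refine ⟨one_pos, hf.R_pos, fun z hz => (hd z hz).differentiableAt.differentiableWithinAt,
    fun z hz => ?_, fun z hz w hw => ?_⟩
  · rw [(hd z hz).deriv]
    exact mul_ne_zero (exp_ne_zero _) (mul_ne_zero two_pi_I_ne_zero
      (neg_ne_zero.mpr (hf.deriv_ne_zero (neg_mem_strip hz))))
  · have h1 := exp_eq_exp_div_iff one_pos (f (-z)) (f (-w))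
    simp only [Nat.cast_one, div_one, one_mul] at h1
    rw [outerChart, outerChart, h1]
    have htr : ∀ n : ℤ, f (-w + n) = f (-w) + n := fun n => by
      simpa using hf.translate_int n _ (neg_mem_strip hw)
    have hmem : ∀ n : ℤ, -w + n ∈ strip R := fun n => by
      have := (add_ofReal_mem_strip (n : ℝ)).mpr (neg_mem_strip hw)
      simpa using this
    constructor
    · rintro ⟨n, hn⟩
      rw [← htr] at hn
      have := hf.injOn (neg_mem_strip hz) (hmem n) hn
      refine ⟨-n, ?_⟩
      push_cast
      linear_combination -this
    · rintro ⟨n, hn⟩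
      refine ⟨-n, ?_⟩
      rw [← htr, hn]
      push_cast
      ring_nf

theorem norm_outerChart_lt_one (hf : StripMap 1 R c f) {z : ℂ} (hz : z ∈ strip R) :
    ‖outerChart f z‖ < 1 ↔ z.im < 0 := by
  have := Real.pi_pos
  rw [norm_outerChart, Real.exp_lt_one_iff, neg_lt_zero, mul_pos_iff_of_pos_left (by positivity),
    hf.im_pos_iff (neg_mem_strip hz), neg_im, neg_pos]

theorem reflection_outerChart (hf : StripMap 1 R c f) {z : ℂ} (hz : z ∈ strip R) :
    reflection (outerChart f z) = outerChart f (conj z) := by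
  rw [reflection, outerChart, outerChart, ← map_neg conj, hf.map_conj _ (neg_mem_strip hz),
    ← exp_conj, one_div, ← exp_neg]
  congr 1
  simp [map_ofNat]

end StripMap

/-- The conjugate `k` is studied in the coordinate transported by `φ`, where it is given by the same
strip map as `h`. Only parabolicity, which is invariant under conjugation, has to be compared
between `h` and `k`. -/
theorem exists_model {d : ℕ} (hd : 2 ≤ d) {h φ k : Circle → Circle} {H Φ : ℝ → ℝ}
    (hH : IsLift d h H) (hM : ∀ z, z ∉ Par h → 1 < D h z) (hΦ : IsLift 1 φ Φ)
    (hk : k ∘ φ = φ ∘ h) {R₀ c : ℝ} {f₀ : ℂ → ℂ} (hf₀ : StripMap 1 R₀ c f₀)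
    (hf₀Φ : ∀ x : ℝ, f₀ x = Φ x) :
    ∃ π f G R, Model d k π f G (outerChart f₀) R := by
  have he := hH.expanding hd hM
  obtain ⟨ψ, Ψ, hΨ, hψφ, hφψ⟩ := hΦ.exists_inverse
  have hkeq : k = φ ∘ h ∘ ψ := by
    ext1 z
    rw [← hφψ z]
    have := congrFun hk (ψ z)
    simp only [Function.comp_apply, hψφ] at this ⊢
    exact this
  have hK : IsLift d k (Φ ∘ H ∘ Ψ) := by
    rw [hkeq]
    simpa using hΦ.comp (hH.comp hΨ)
  have hψk : h ∘ ψ = ψ ∘ k := by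
    rw [hkeq]
    ext1 z
    simp [hψφ]
  have hpar : ∀ p, φ p ∈ Par k ↔ p ∈ Par h := fun p =>
    ⟨fun hp => hψφ p ▸ hΨ.map_mem_Par hK hH hψk hp, fun hp => hΦ.map_mem_Par hH hK hk hp⟩
  -- The outer chart evaluates the lift at `-z`, in order to send the upper half plane outside the
  -- disc; accordingly `H` is conjugated by `x ↦ -x`.
  set H' : ℝ → ℝ := fun x => -H (-x) with hH'
  have hd' : ∀ x, HasDerivAt H' (deriv H (-x)) x := fun x => by
    exact (((hH.hasDerivAt (-x)).scomp x (hasDerivAt_neg x)).neg).congr_deriv (by simp)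
  have han : ∀ x, AnalyticAt ℝ H' x := fun x =>
    ((hH.analytic (-x)).fun_comp analyticAt_id.neg).neg
  obtain ⟨R₁, f, hf, hfH⟩ := exists_stripMap (d := d) (show (0 : ℝ) < 1 / 2 by norm_num) han
    (fun x => by
      have := hH.translate_int (-x) (-1)
      push_cast at this
      simp only [hH']
      rw [show -(x + 1) = -x + -1 by ring, this]
      ring)
    fun x => by rw [(hd' x).deriv]; linarith [he.one_le (-x)]
  have hR : 0 < min R₀ R₁ := lt_min hf₀.R_pos hf.R_pos
  have hf := hf.mono hR (min_le_right _ _)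
  have hf₀ := hf₀.mono hR (min_le_left _ _)
  obtain ⟨G, hG⟩ := hf.exists_inv
  have hderiv := fun x : ℝ => hasDerivAt_ofReal_of_complex hfH
    (hf.analyticAt (ofReal_mem_strip hR x)).differentiableAt
  have hre : ∀ x : ℝ, (deriv f x).re = deriv H (-x) := fun x => (hderiv x).1.unique (hd' x)
  refine ⟨fun x => E (Φ (-x)), f, G, min R₀ R₁, hd, ⟨_, hK⟩, ?_, fun p hp =>
    hK.map_mem_Par hK hK rfl hp, hf, hG, hf₀.chart, fun x => ?_, ?_, fun x => ?_,
    fun z hz => hf₀.norm_outerChart_lt_one hz, fun z hz => hf₀.reflection_outerChart hz,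
    fun x => ?_, fun x => ?_⟩
  · refine (he.finite.image φ).subset fun p hp => ⟨ψ p, ?_, hφψ p⟩
    rwa [← hpar, hφψ]
  · rw [coe_E, outerChart, ← hf₀Φ, ofReal_neg]
  · intro z
    obtain ⟨y, rfl⟩ := E_surjective z
    obtain ⟨x, rfl⟩ := hΦ.surjective y
    exact ⟨-x, by simp⟩
  · have := congrFun hk (E (-x))
    simp only [Function.comp_apply, hΦ.lifts, hH.lifts] at this
    simp [this, hfH, hH']
  · rw [hre]
    exact he.one_le _
  · rw [← hΦ.lifts, hpar, he.mem_Par_iff, ← hre]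
    refine ⟨fun h1 => Complex.ext h1 (hderiv x).2, fun h1 => by rw [h1]; rfl⟩

theorem stripMap_id : StripMap 1 1 1 id where
  R_pos := one_pos
  c_pos := one_pos
  differentiableOn := differentiableOn_id
  translate z _ := by simp
  map_conj z _ := rfl
  deriv_re z _ := by simp

theorem exists_thin_parabolicExternal {d : ℕ} (hd : 2 ≤ d) {h : Circle → Circle} (hh : h ∈ M d) :
    ∃ ε₀ : ℝ, 0 < ε₀ ∧ ∀ ε : ℝ, 0 < ε → ε ≤ ε₀ →
      ∃ (g : ℂ → ℂ) (W' W : Set ℂ) (γ : Circle → ℝ → ℂ),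
        IsParabolicExternal d h g W' W γ ∧ W ⊆ {z : ℂ | |Real.log ‖z‖| < ε} := by
  obtain ⟨⟨H, hH⟩, hM⟩ := hh
  obtain ⟨π, f, G, R, m⟩ := exists_model hd hH hM IsLift.id rfl stripMap_id fun x => rfl
  obtain ⟨ε₀, hε₀, hex⟩ := m.exists_isParabolicExternal
  have hpi := Real.pi_pos
  -- For the identity coordinate `log |Θ z| = 2 π Im z`, so a strip of half-width `ε / (2 π)` has
  -- the required image.
  refine ⟨2 * Real.pi * ε₀, by positivity, fun ε hε hle => ?_⟩
  obtain ⟨g, W', γ, hP⟩ := hex (ε / (2 * Real.pi)) (by positivity) (by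
    rw [div_le_iff₀ (by positivity)]
    linarith)
  refine ⟨g, W', _, γ, hP, ?_⟩
  rintro _ ⟨z, hz, rfl⟩
  have hz' : |z.im| < ε / (2 * Real.pi) := hz
  rw [lt_div_iff₀ (by positivity)] at hz'
  change |Real.log ‖outerChart id z‖| < ε
  rw [norm_outerChart, Real.log_exp]
  simpa [abs_mul, abs_of_pos hpi, mul_comm] using hz'

theorem conjugate_mem_P {d : ℕ} (hd : 2 ≤ d) {h φ k : Circle → Circle} (hh : h ∈ M d)
    (hφ : φ ∈ F 1) (hk : k ∘ φ = φ ∘ h) : k ∈ P d := by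
  obtain ⟨⟨H, hH⟩, hM⟩ := hh
  obtain ⟨Φ, hΦ⟩ := hφ
  obtain ⟨c, hc, hcΦ⟩ := hΦ.exists_lt_deriv
  obtain ⟨R₀, f₀, hf₀, hf₀Φ⟩ := exists_stripMap hc hΦ.analytic hΦ.translate hcΦ
  obtain ⟨π, f, G, R, m⟩ := exists_model hd hH hM hΦ hk hf₀ hf₀Φ
  obtain ⟨ε₀, hε₀, hex⟩ := m.exists_isParabolicExternal
  obtain ⟨g, W', γ, hP⟩ := hex ε₀ hε₀ le_rfl
  exact ⟨g, W', _, γ, hP⟩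

end

end

end ParabolicExternal

theorem mainTheorem6 (d : ℕ) (hd : 2 ≤ d) :
    (∀ h ∈ ParabolicExternal.M d, ∃ ε₀ : ℝ, 0 < ε₀ ∧ ∀ ε : ℝ, 0 < ε → ε ≤ ε₀ →
      ∃ (g : ℂ → ℂ) (W' W : Set ℂ) (γ : Circle → ℝ → ℂ),
        ParabolicExternal.IsParabolicExternal d h g W' W γ ∧
        W ⊆ {z : ℂ | |Real.log ‖z‖| < ε}) ∧
    ParabolicExternal.M d ⊆ ParabolicExternal.P d ∧
    (∀ h ∈ ParabolicExternal.M d, ∀ φ ∈ ParabolicExternal.F 1, ∀ k : Circle → Circle,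
      k ∘ φ = φ ∘ h → k ∈ ParabolicExternal.P d) := by
  refine ⟨fun h hh => ParabolicExternal.exists_thin_parabolicExternal hd hh, fun h hh => ?_,
    fun h hh φ hφ k hk => ParabolicExternal.conjugate_mem_P hd hh hφ hk⟩
  obtain ⟨ε₀, hε₀, hex⟩ := ParabolicExternal.exists_thin_parabolicExternal hd hh
  obtain ⟨g, W', W, γ, hP, -⟩ := hex ε₀ hε₀ le_rfl
  exact ⟨g, W', W, γ, hP⟩
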